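/- Let $\ell\ge 2$, and let $x=(x_1,x_2,\dots)$, $y=y_0$, $\check y=(y_\ell,y_{2\ell},\dots)$ be independent variables; write $\mathbf y=(y,\check y)$ and $\partial_x=\partial/\partial x_1$. Functions of $(x,\mathbf y)$ are formal power series over $\mathbb C$. Let $$W=1+\sum_{n\ge1}w_n(x,\mathbf y)\,\partial_x^{-n}$$ be a formal pseudo-differential operator which solves the $\ell$-Bogoyavlensky hierarchy, that is, $(W\partial_x^\ell W^{-1})_{\le -1}=0$ and, for all $n\ge1$, $$\frac{\partial W}{\partial x_n}=-\bigl(W\partial_x^nW^{-1}\bigr)_{\le-1}W,\qquad \frac{\partial W}{\partial y_{n\ell}}=\Bigl(W\partial_x^{n\ell}W^{-1}\frac{\partial W}{\partial y}W^{-1}\Bigr)_{\le-1}W,$$ where $(A)_{\le-1}$ is the part of $A$ of order at most $-1$. Put $\xi(x,\lambda)=\sum_{n\ge1}x_n\lambda^n$, and $\eta(b,\lambda)=\sum_{n\ge1}b_{n\ell}\lambda^{n\ell}$ for $b=(b_\ell,b_{2\ell},\dots)$. Let $$\Psi(x,\mathbf y,\lambda)=We^{\xi(x,\lambda)},\qquad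 \Psi^*(x,\mathbf y,\lambda)=(W^*)^{-1}e^{-\xi(x,\lambda)},$$ where $W^*$ is the formal adjoint and $\partial_x^ne^{\pm\xi}=(\pm\lambda)^ne^{\pm\xi}$ for all $n\in\mathbb Z$; these are formal power series in $(x,\mathbf y)$ whose coefficients are Laurent series in $1/\lambda$. The symbol $\oint_{\lambda=\infty}F\,d\lambda=0$ means that the coefficient of $\lambda^{-1}$ in $F$ vanishes. (1) With $x,x',y,\check y,b,c$ independent variables, $$\oint_{\lambda=\infty}\Psi\bigl(x',\,y-\eta(b,\lambda),\,\check y+b,\,\lambda\bigr)\,\Psi^*\bigl(x,\,y-\eta(c,\lambda),\,\check y+c,\,\lambda\bigr)\,d\lambda=0 .$$ (2) Let $\tau=\tau(x,\mathbf y)\neq0$ be a $\tau$-function of the solution, that is, a formal power series with $$\Psi=\frac{\tau(x-\epsilon(\lambda),\mathbf y)}{\tau(x,\mathbf y)}e^{\xi(x,\lambda)},\qquad \Psi^*=\frac{\tau(x+\epsilon(\lambda),\mathbf y)}{\tau(x,\mathbf y)}e^{-\xi(x,\lambda)},\qquad \epsilon(\lambda)=\Bigl(\frac1\lambda,\frac1{2\lambda^2},\frac1{3\lambda^3},\dots\Bigr).$$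 Then $\tau$ satisfies, for every $j\ge0$, the Hirota bilinear equations $$\sum_{m,k\ge0}p_m(2a)\,p_{m+k\ell+j\ell+1}(-\widetilde{D_x})\,p_k\bigl((\kappa-D_y)b\bigr)\,e^{\langle a,D_x\rangle+\langle b,D_{\check y}\rangle}\,\tau\cdot\tau=0,$$ identically in the indeterminates $a=(a_1,a_2,\dots)$, $b=(b_\ell,b_{2\ell},\dots)$ and $\kappa$. Here the $D$'s are Hirota's bilinear operators, $D_vf\cdot g=(\partial_{v'}-\partial_{v''})f(v')g(v'')|_{v'=v''=v}$, the polynomials $p_n$ are defined by $\sum_{n\ge0}p_n(x)\lambda^n=\exp\bigl(\sum_{k\ge1}x_k\lambda^k\bigr)$, and $\widetilde{D_x}=(D_{x_1},\tfrac12D_{x_2},\tfrac13D_{x_3},\dots)$, $\langle a,D_x\rangle=\sum_{n\ge1}a_nD_{x_n}$, $\langle b,D_{\check y}\rangle=\sum_{n\ge1}b_{n\ell}D_{y_{n\ell}}$; in $p_k((\kappa-D_y)b)$ the $n$-th argument is $(\kappa-D_y)b_{n\ell}$. -/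

import Mathlib

open Filter

noncomputable section

namespace Bogoyavlensky

/-! ### Variables and functions -/

/-- The independent variables of the hierarchy: `x n` is `x_n` (`n ≥ 1`), `y k` is `y_{kℓ}`
(`k ≥ 0`), so that `y 0` is the distinguished variable `y = y_0`. -/
inductive TimeVar : Type
  | x (n : ℕ+)
  | y (k : ℕ)

/-- "Functions" of `(x, y)`: formal power series over `ℂ` in the variables `x_n`, `y_{kℓ}`. -/
abbrev Fn : Type := MvPowerSeries TimeVar ℂ

/-- The partial derivative `∂/∂v`. -/
def pd (v : TimeVar) (f : Fn) : Fn := MvPowerSeries.pderiv ℂ v f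

/-- The derivation `∂_x`, where `x = x_1`. -/
def dx (f : Fn) : Fn := pd (TimeVar.x 1) f

theorem pd_zero (v : TimeVar) : pd v 0 = 0 := map_zero (MvPowerSeries.pderiv ℂ v)

theorem dx_zero : dx 0 = 0 := pd_zero _

theorem dx_iterate_zero (k : ℕ) : dx^[k] 0 = 0 := Function.iterate_fixed dx_zero k

/-! ### Formal pseudo-differential operators -/

/-- A formal pseudo-differential operator `∑ a_n ∂_x^n`, the integer `n` being bounded above. -/
@[ext]
structure PsDO : Type where
  coeff : ℤ → Fn
  bounded : ∃ N : ℤ, ∀ n : ℤ, N < n → coeff n = 0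

namespace PsDO

instance : One PsDO :=
  ⟨⟨fun n => if n = 0 then 1 else 0, ⟨0, fun _ hn => if_neg hn.ne'⟩⟩⟩

instance : Add PsDO :=
  ⟨fun A B => ⟨fun n => A.coeff n + B.coeff n, by
    obtain ⟨M, hM⟩ := A.bounded
    obtain ⟨N, hN⟩ := B.bounded
    refine ⟨max M N, fun n hn => ?_⟩
    rw [hM n (lt_of_le_of_lt (le_max_left _ _) hn), hN n (lt_of_le_of_lt (le_max_right _ _) hn),
      add_zero]⟩⟩

instance : Neg PsDO :=
  ⟨fun A => ⟨fun n => -A.coeff n, by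
    obtain ⟨M, hM⟩ := A.bounded
    exact ⟨M, fun n hn => by rw [hM n hn, neg_zero]⟩⟩⟩

/-- The operator `∂_x^n`. -/
def dxPow (n : ℤ) : PsDO :=
  ⟨fun m => if m = n then 1 else 0, ⟨n, fun _ hm => if_neg hm.ne'⟩⟩

/-- The coefficient of `∂_x^N` in the composition of `∑ a_m ∂_x^m` and `∑ b_n ∂_x^n`, obtained
from the Leibniz rule `∂_x^m ∘ b = ∑_k binom(m,k) b^{(k)} ∂_x^{m-k}`; here `n = N - m + k`.
Only finitely many terms are non-zero (`mulCoeff_support_finite`). -/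
def mulCoeff (a b : ℤ → Fn) (N : ℤ) : Fn :=
  ∑ᶠ p : ℤ × ℕ, Ring.choose p.1 p.2 • (a p.1 * dx^[p.2] (b (N - p.1 + p.2)))

theorem mulCoeff_support_finite (A B : PsDO) (N : ℤ) :
    (Function.support fun p : ℤ × ℕ =>
      Ring.choose p.1 p.2 • (A.coeff p.1 * dx^[p.2] (B.coeff (N - p.1 + p.2)))).Finite := by
  obtain ⟨M, hM⟩ := A.bounded
  obtain ⟨K, hK⟩ := B.bounded
  refine Set.Finite.subset
    ((Set.finite_Icc (N - K) M).prod (Set.finite_Iic (K - N + M).toNat)) ?_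
  rintro ⟨m, k⟩ h
  have h1 : m ≤ M := by
    by_contra hc
    exact h (by simp [hM m (not_le.mp hc)])
  have h2 : N - m + k ≤ K := by
    by_contra hc
    exact h (by simp [hK _ (not_le.mp hc), dx_iterate_zero])
  simp only [Set.mem_prod, Set.mem_Icc, Set.mem_Iic]
  omega

/-- Composition of pseudo-differential operators. -/
instance : Mul PsDO :=
  ⟨fun A B => ⟨mulCoeff A.coeff B.coeff, by
    obtain ⟨M, hM⟩ := A.bounded
    obtain ⟨K, hK⟩ := B.bounded
    refine ⟨M + K, fun n hn => ?_⟩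
    have h0 : ∀ p : ℤ × ℕ,
        Ring.choose p.1 p.2 • (A.coeff p.1 * dx^[p.2] (B.coeff (n - p.1 + p.2))) = 0 := by
      rintro ⟨m, k⟩
      by_cases h : m ≤ M
      · have : K < n - m + k := by omega
        simp [hK _ this, dx_iterate_zero]
      · simp [hM m (not_le.mp h)]
    simp [mulCoeff, h0]⟩⟩

/-- The part `(A)_{≤ k}`. -/
def trLE (k : ℤ) (A : PsDO) : PsDO :=
  ⟨fun n => if n ≤ k then A.coeff n else 0, ⟨k, fun _ hn => if_neg (not_le.mpr hn)⟩⟩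

/-- Coefficientwise partial derivative `∂A/∂v`. -/
def pdiff (v : TimeVar) (A : PsDO) : PsDO :=
  ⟨fun n => pd v (A.coeff n), by
    obtain ⟨M, hM⟩ := A.bounded
    exact ⟨M, fun n hn => by rw [hM n hn, pd_zero]⟩⟩

/-- The formal adjoint `A^* = ∑ (-∂_x)^n ∘ a_n`. The coefficient of `∂_x^N` collects the terms
`(-1)^n binom(n,k) a_n^{(k)}` with `n - k = N`; only finitely many are non-zero. -/
def adjoint (A : PsDO) : PsDO :=
  ⟨fun N => ∑ᶠ k : ℕ,
      ((Int.negOnePow (N + k) : ℤ) * Ring.choose (N + k : ℤ) k) • dx^[k] (A.coeff (N + k)), by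
    obtain ⟨M, hM⟩ := A.bounded
    refine ⟨M, fun n hn => ?_⟩
    have h0 : ∀ k : ℕ, A.coeff (n + k) = 0 := fun k => hM _ (by omega)
    simp [h0, dx_iterate_zero]⟩

/-- `A` has the form `1 + ∑_{n ≥ 1} w_n ∂_x^{-n}`. -/
def IsWilsonSato (A : PsDO) : Prop :=
  A.coeff 0 = 1 ∧ ∀ n : ℤ, 0 < n → A.coeff n = 0

/-- Powers of a pseudo-differential operator. -/
def npow (A : PsDO) : ℕ → PsDO
  | 0 => 1
  | k + 1 => A * npow A k

/-- The inverse of an operator `A = 1 + ∑_{n ≥ 1} w_n ∂_x^{-n}`, given by the geometric series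
`∑_k (1 - A)^k`; since `(1 - A)^k` has order at most `-k`, only the terms with `k ≤ -n` contribute
to the coefficient of `∂_x^n`. (It is only used for operators of this form.) -/
def inv (A : PsDO) : PsDO :=
  ⟨fun n => if n ≤ 0 then ∑ k ∈ Finset.range (n.natAbs + 1), ((1 + -A).npow k).coeff n else 0,
    ⟨0, fun _ hn => if_neg (not_le.mpr hn)⟩⟩

theorem coeff_mul (A B : PsDO) (N : ℤ) : (A * B).coeff N = mulCoeff A.coeff B.coeff N := rfl

theorem one_coeff (n : ℤ) : (1 : PsDO).coeff n = if n = 0 then 1 else 0 := rfl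

theorem mulCoeff_one_left (b : ℤ → Fn) (N : ℤ) : mulCoeff (1 : PsDO).coeff b N = b N := by
  rw [mulCoeff, finsum_eq_single _ ((0 : ℤ), 0)]
  · simp [one_coeff]
  · rintro ⟨m, k⟩ h
    by_cases hm : m = 0
    · subst hm
      obtain ⟨j, rfl⟩ : ∃ j, k = j + 1 := ⟨k - 1, by
        have : k ≠ 0 := fun hk => h (by rw [hk])
        omega⟩
      simp [Ring.choose_zero_succ]
    · simp [one_coeff, hm]

theorem coeff_sub_mul (A B C : PsDO) (N : ℤ) :
    ((A + -B) * C).coeff N = (A * C).coeff N - (B * C).coeff N := by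
  rw [coeff_mul, coeff_mul, coeff_mul, mulCoeff, mulCoeff, mulCoeff,
    ← finsum_sub_distrib (mulCoeff_support_finite A C N) (mulCoeff_support_finite B C N)]
  refine finsum_congr fun p => ?_
  change Ring.choose p.1 p.2 • ((A.coeff p.1 + -B.coeff p.1) * _) = _
  rw [← smul_sub, ← sub_mul, ← sub_eq_add_neg]

theorem dx_iterate_sum {ι : Type} (s : Finset ι) (f : ι → Fn) (k : ℕ) :
    dx^[k] (∑ i ∈ s, f i) = ∑ i ∈ s, dx^[k] (f i) := by
  induction k with
  | zero => rfl
  | succ k ih =>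
    simp only [Function.iterate_succ_apply', ih]
    exact map_sum (MvPowerSeries.pderiv ℂ (TimeVar.x 1)) _ _

theorem npow_coeff_eq_zero {X : PsDO} (hX : ∀ n : ℤ, 0 ≤ n → X.coeff n = 0) (k : ℕ) (n : ℤ)
    (hn : -(k : ℤ) < n) : (X.npow k).coeff n = 0 := by
  induction k generalizing n with
  | zero =>
    have : n ≠ 0 := by simp at hn; omega
    simp [npow, one_coeff, this]
  | succ k ih =>
    rw [npow, coeff_mul, mulCoeff]
    refine finsum_eq_zero_of_forall_eq_zero ?_
    rintro ⟨m, i⟩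
    by_cases hm : 0 ≤ m
    · simp [hX m hm]
    · have : (X.npow k).coeff (n - m + i) = 0 := ih _ (by push_cast at hn; omega)
      simp [this, dx_iterate_zero]

/-- `inv` is indeed the inverse of `1 + ∑_{n ≥ 1} w_n ∂_x^{-n}`. -/
theorem mul_inv_of_isWilsonSato {W : PsDO} (hW : W.IsWilsonSato) : W * W.inv = 1 := by
  set X : PsDO := 1 + -W with hXdef
  have hXc : ∀ n, X.coeff n = (1 : PsDO).coeff n - W.coeff n := fun n => by
    rw [sub_eq_add_neg]; rfl
  have hX : ∀ n : ℤ, 0 ≤ n → X.coeff n = 0 := by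
    intro n hn
    rcases hn.eq_or_lt with h | h
    · rw [hXc, ← h, hW.1, one_coeff, if_pos rfl, sub_self]
    · rw [hXc, hW.2 n h, one_coeff, if_neg h.ne', sub_self]
  have hinv : ∀ (T : ℕ) (n : ℤ), -(T : ℤ) ≤ n →
      W.inv.coeff n = ∑ k ∈ Finset.range (T + 1), (X.npow k).coeff n := by
    intro T n hn
    change (if n ≤ 0 then ∑ k ∈ Finset.range (n.natAbs + 1), (X.npow k).coeff n else 0) = _
    split_ifs with h
    · refine Finset.sum_subset (Finset.range_mono (by omega)) fun k _ hk => ?_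
      exact npow_coeff_eq_zero hX k n (by simp at hk; omega)
    · exact (Finset.sum_eq_zero fun k _ => npow_coeff_eq_zero hX k n (by omega)).symm
  ext1
  funext N
  have h1 : (X * W.inv).coeff N = W.inv.coeff N - (W * W.inv).coeff N := by
    rw [hXdef, coeff_sub_mul, coeff_mul 1, mulCoeff_one_left]
  have h2 : (X * W.inv).coeff N =
      ∑ i ∈ Finset.range (N.natAbs + 1), (X.npow (i + 1)).coeff N := by
    simp only [npow, coeff_mul, mulCoeff]
    rw [← finsum_sum_comm _ _ fun i _ => mulCoeff_support_finite X (X.npow i) N]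
    refine finsum_congr ?_
    rintro ⟨m, k⟩
    by_cases hm : 0 ≤ m
    · simp [hX m hm]
    · rw [hinv N.natAbs (N - m + k) (by omega), dx_iterate_sum, Finset.mul_sum, Finset.smul_sum]
  have h3 := Finset.sum_range_succ' (fun i => (X.npow i).coeff N) (N.natAbs + 1)
  rw [← h2, Finset.sum_range_succ, ← hinv _ N (by omega),
    npow_coeff_eq_zero hX (N.natAbs + 1) N (by omega), h1] at h3
  have h4 : (W * W.inv).coeff N = (X.npow 0).coeff N := by
    linear_combination h3
  exact h4

/-- The adjoint of `1 + ∑_{n ≥ 1} w_n ∂_x^{-n}` is again of this form. -/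
theorem IsWilsonSato.adjoint {W : PsDO} (hW : W.IsWilsonSato) : W.adjoint.IsWilsonSato := by
  constructor
  · change (∑ᶠ k : ℕ, ((Int.negOnePow (0 + k) : ℤ) * Ring.choose (0 + k : ℤ) k) •
      dx^[k] (W.coeff (0 + k))) = 1
    rw [finsum_eq_single _ 0]
    · simp [hW.1]
    · intro k hk
      rw [hW.2 _ (by omega), dx_iterate_zero, smul_zero]
  · intro n hn
    refine finsum_eq_zero_of_forall_eq_zero fun k => ?_
    rw [hW.2 _ (by omega), dx_iterate_zero, smul_zero]

end PsDO

/-! ### The hierarchy -/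

/-- `W` is (the Wilson-Sato operator of) a solution of the `ℓ`-Bogoyavlensky hierarchy. -/
structure IsSolution (ℓ : ℕ) (W : PsDO) : Prop where
  wilsonSato : W.IsWilsonSato
  /-- `(W ∂_x^ℓ W⁻¹)_{≤ -1} = 0` -/
  reduced : ∀ n : ℤ, n ≤ -1 → (W * PsDO.dxPow ℓ * W.inv).coeff n = 0
  /-- `∂W/∂x_n = -(W ∂_x^n W⁻¹)_{≤ -1} W` -/
  flow_x : ∀ n : ℕ+, W.pdiff (TimeVar.x n) =
    -(PsDO.trLE (-1) (W * PsDO.dxPow n * W.inv)) * W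
  /-- `∂W/∂y_{nℓ} = (W ∂_x^{nℓ} W⁻¹ (∂W/∂y) W⁻¹)_{≤ -1} W` -/
  flow_y : ∀ n : ℕ+, W.pdiff (TimeVar.y n) =
    PsDO.trLE (-1)
      (W * PsDO.dxPow ((n : ℕ) * ℓ : ℕ) * W.inv * W.pdiff (TimeVar.y 0) * W.inv) * W

/-! ### Baker-Akhiezer functions -/

/-- Laurent series in `1/λ` with finitely many positive powers of `λ`: the variable of
`LaurentSeries` is `1/λ`, so the coefficient of `λ^n` is the Laurent coefficient of index `-n`. -/
abbrev Lau : Type := LaurentSeries ℂ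

/-- `λ^n` -/
def lam (n : ℤ) : Lau := HahnSeries.single (-n) 1

/-- The linear form `∑_{n ≥ 1} c_n v_n` in the distinct variables `v_n`. -/
def linForm {σ R : Type} [CommRing R] (v : ℕ+ → σ) (c : ℕ+ → R) : MvPowerSeries σ R :=
  fun d => ∑ᶠ n : ℕ+, open Classical in if d = Finsupp.single (v n) 1 then c n else 0

/-- The exponential of a formal power series without constant term. -/
def fexp {σ R : Type} [CommRing R] [Algebra ℂ R] (f : MvPowerSeries σ R) : MvPowerSeries σ R :=
  (PowerSeries.exp ℂ).subst f

/-- `ξ(x, λ) = ∑_{n ≥ 1} x_n λ^n` -/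
def xi : MvPowerSeries TimeVar Lau := linForm TimeVar.x fun n => lam n

/-- The series `∑_n a_n (s λ)^n`, for a sign `s`. -/
def symbol (s : ℤˣ) (A : PsDO) : MvPowerSeries TimeVar Lau :=
  fun d => HahnSeries.ofSuppBddBelow
    (fun k : ℤ => ((s ^ k : ℤˣ) : ℤ) • MvPowerSeries.coeff d (A.coeff (-k))) (by
      obtain ⟨M, hM⟩ := A.bounded
      refine ⟨-M, fun k hk => ?_⟩
      by_contra hc
      exact hk (by simp [hM (-k) (by omega)]))

/-- The action of a pseudo-differential operator on `e^{s ξ(x, λ)}`, `s = ±1`, determined by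
`∂_x^n e^{s ξ} = (s λ)^n e^{s ξ}` for all integers `n`. -/
def onExp (s : ℤˣ) (A : PsDO) : MvPowerSeries TimeVar Lau :=
  symbol s A * fexp ((s : ℤ) • xi)

/-- The formal Baker-Akhiezer function `Ψ = W e^ξ`. -/
def bakerAkhiezer (W : PsDO) : MvPowerSeries TimeVar Lau := onExp 1 W

/-- The dual formal Baker-Akhiezer function `Ψ^* = (W^*)⁻¹ e^{-ξ}`. -/
def dualBakerAkhiezer (W : PsDO) : MvPowerSeries TimeVar Lau := onExp (-1) W.adjoint.inv

/-- The independent variables of the bilinear identity: `x'_n`, `x_n`, `y_{kℓ}` (`k ≥ 0`),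
`b_{nℓ}` and `c_{nℓ}`. -/
inductive BilVar : Type
  | x' (n : ℕ+)
  | x (n : ℕ+)
  | y (k : ℕ)
  | b (n : ℕ+)
  | c (n : ℕ+)

/-- `η(u, λ) = ∑_{n ≥ 1} u_{nℓ} λ^{nℓ}` for a sequence `u` of variables. -/
def eta {σ : Type} (ℓ : ℕ) (u : ℕ+ → σ) : MvPowerSeries σ Lau :=
  linForm u fun n => lam ((n : ℕ) * ℓ : ℕ)

/-- The arguments `(u, y - η(v, λ), y̌ + v)`, as a substitution for `(x, y, y̌)`. -/
def shiftArgs (ℓ : ℕ) (u v : ℕ+ → BilVar) : TimeVar → MvPowerSeries BilVar Lau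
  | TimeVar.x n => MvPowerSeries.X (u n)
  | TimeVar.y 0 => MvPowerSeries.X (BilVar.y 0) - eta ℓ v
  | TimeVar.y (k + 1) => MvPowerSeries.X (BilVar.y (k + 1)) + MvPowerSeries.X (v k.succPNat)

theorem coeff_linForm_zero {σ R : Type} [CommRing R] (v : ℕ+ → σ) (c : ℕ+ → R) :
    MvPowerSeries.constantCoeff (linForm v c) = 0 := by
  classical
  rw [← MvPowerSeries.coeff_zero_eq_constantCoeff_apply]
  change (∑ᶠ n : ℕ+, _) = _
  refine finsum_eq_zero_of_forall_eq_zero fun n => ?_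
  rw [if_neg]
  intro h
  have := DFunLike.congr_fun h (v n)
  simp at this

/-- The substitution is admissible, so that `MvPowerSeries.subst` is the actual substitution. -/
theorem hasSubst_shiftArgs (ℓ : ℕ) {u v : ℕ+ → BilVar} (hu : Function.Injective u)
    (hv : Function.Injective v) : MvPowerSeries.HasSubst (shiftArgs ℓ u v) := by
  classical
  constructor
  · rintro (n | (_ | k)) <;> simp [shiftArgs, eta, coeff_linForm_zero]
  · intro d
    have h1 : {n : ℕ+ | d = Finsupp.single (u n) 1}.Subsingleton := fun a ha b hb =>
      hu (Finsupp.single_left_injective one_ne_zero ((Eq.symm ha).trans hb))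
    have h2 : {k : ℕ | d = Finsupp.single (v k.succPNat) 1}.Subsingleton := fun a ha b hb =>
      Nat.succPNat_injective (hv (Finsupp.single_left_injective one_ne_zero ((Eq.symm ha).trans hb)))
    have h3 : {k : ℕ | d = Finsupp.single (BilVar.y (k+1)) 1}.Subsingleton := fun a ha b hb => by
      have := (Finsupp.single_left_injective one_ne_zero ((Eq.symm ha).trans hb))
      simpa using this
    refine Set.Finite.subset ((Set.finite_singleton (TimeVar.y 0)).union
      ((h1.finite.image TimeVar.x).union ((h2.finite.union h3.finite).image fun k => TimeVar.y (k + 1)))) ?_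
    rintro (n | (_ | k)) h
    · simp [shiftArgs, MvPowerSeries.coeff_X] at h
      simp [h]
    · simp
    · simp [shiftArgs, MvPowerSeries.coeff_X] at h
      simp
      by_contra hc
      push Not at hc
      simp [hc] at h

/-- The formal residue `∮ F dλ / (2πi)`: the coefficient of `λ^{-1}`. -/
def residue {σ : Type} (F : MvPowerSeries σ Lau) : MvPowerSeries σ ℂ :=
  fun d => (MvPowerSeries.coeff d F).coeff 1

/-! ### Constant coefficient differential operators, tau functions and Hirota equations -/

/-- The elementary Schur polynomials, `∑_n p_n(x) λ^n = exp(∑_{k ≥ 1} x_k λ^k)`. -/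
def schur (n : ℕ) : MvPolynomial ℕ+ ℂ :=
  PowerSeries.coeff n ((PowerSeries.exp ℂ).subst
    (PowerSeries.mk fun k => if h : 0 < k then MvPolynomial.X (⟨k, h⟩ : ℕ+) else 0) :
      PowerSeries (MvPolynomial ℕ+ ℂ))

/-- The iterated partial derivative `∏_i ∂_i^{d_i} f`. -/
def multiDeriv {σ : Type} (d : σ →₀ ℕ) (f : MvPowerSeries σ ℂ) : MvPowerSeries σ ℂ :=
  fun e => ((d.prod fun i k => (e i + k).descFactorial k : ℕ) : ℂ) * MvPowerSeries.coeff (e + d) f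

/-- The action `Q(∂) f` of a constant coefficient differential operator. -/
def applyDiff {σ : Type} (Q : MvPolynomial σ ℂ) (f : MvPowerSeries σ ℂ) : MvPowerSeries σ ℂ :=
  ∑ d ∈ Q.support, MvPolynomial.coeff d Q • multiDeriv d f

/-- `τ(x + s ε(λ), y)` for a number `s`, where `ε(λ) = (1/λ, 1/(2λ²), 1/(3λ³), …)`, i.e. the
Taylor expansion `exp(∑_n (s/n) λ^{-n} ∂_{x_n}) τ = ∑_N λ^{-N} p_N(s ∂̃_x) τ` with
`∂̃_x = (∂_{x_1}, ∂_{x_2}/2, ∂_{x_3}/3, …)`. -/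
def miwaShift (s : ℂ) (τ : Fn) : MvPowerSeries TimeVar Lau :=
  fun d => HahnSeries.ofSuppBddBelow
    (fun k : ℤ => if 0 ≤ k then MvPowerSeries.coeff d (applyDiff
      (MvPolynomial.aeval
        (fun n : ℕ+ => MvPolynomial.C (s / (n : ℂ)) * MvPolynomial.X (TimeVar.x n))
        (schur k.toNat)) τ) else 0)
    ⟨0, fun k hk => by
      by_contra hc
      exact hk (if_neg hc)⟩

/-- A power series in `(x, y)` regarded as independent of `λ`. -/
def constLam (f : Fn) : MvPowerSeries TimeVar Lau := MvPowerSeries.map HahnSeries.C f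

/-- `τ` is a tau function of `W`: `Ψ = (τ(x - ε(λ), y) / τ(x, y)) e^ξ` and
`Ψ^* = (τ(x + ε(λ), y) / τ(x, y)) e^{-ξ}`. -/
structure IsTau (W : PsDO) (τ : Fn) : Prop where
  ne_zero : τ ≠ 0
  wave : constLam τ * bakerAkhiezer W = miwaShift (-1) τ * fexp xi
  dual_wave : constLam τ * dualBakerAkhiezer W = miwaShift 1 τ * fexp (-xi)

/-- Hirota's bilinear operator `Q(D) f · g = Q(∂_{v'} - ∂_{v''}) f(v') g(v'') |_{v' = v'' = v}`. -/
def hirota (Q : MvPolynomial TimeVar ℂ) (f g : Fn) : Fn :=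
  MvPowerSeries.subst
    (Sum.elim MvPowerSeries.X MvPowerSeries.X : TimeVar ⊕ TimeVar → Fn)
    (applyDiff
      (MvPolynomial.aeval
        (fun v => MvPolynomial.X (Sum.inl v) - MvPolynomial.X (Sum.inr v)) Q)
      (MvPowerSeries.subst
          (fun v => (MvPowerSeries.X (Sum.inl v) : MvPowerSeries (TimeVar ⊕ TimeVar) ℂ)) f *
        MvPowerSeries.subst
          (fun v => (MvPowerSeries.X (Sum.inr v) : MvPowerSeries (TimeVar ⊕ TimeVar) ℂ)) g))

/-- The indeterminates `a_n`, `b_{nℓ}` (`n ≥ 1`) and `κ` of the Hirota equations. -/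
inductive ParVar : Type
  | a (n : ℕ+)
  | b (n : ℕ+)
  | kappa

/-- Formal power series in `a`, `b`, `κ` whose coefficients are polynomials in the Hirota
operators: the variable `v` of `MvPolynomial TimeVar ℂ` stands for `D_v`. -/
abbrev HirotaSymbol : Type := MvPowerSeries ParVar (MvPolynomial TimeVar ℂ)

/-- The symbol `p_m(2a) p_{m+kℓ+jℓ+1}(-D̃_x) p_k((κ - D_y) b) e^{⟨a, D_x⟩ + ⟨b, D_y̌⟩}`, where
`D̃_x = (D_{x_1}, D_{x_2}/2, …)` and `(κ - D_y) b = ((κ - D_y) b_ℓ, (κ - D_y) b_{2ℓ}, …)`. -/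
def hirotaTerm (ℓ j m k : ℕ) : HirotaSymbol :=
  MvPolynomial.aeval (fun n : ℕ+ => (2 * MvPowerSeries.X (ParVar.a n) : HirotaSymbol)) (schur m) *
  MvPowerSeries.C (MvPolynomial.aeval
    (fun n : ℕ+ => MvPolynomial.C (-1 / (n : ℂ)) * MvPolynomial.X (TimeVar.x n))
    (schur (m + k * ℓ + j * ℓ + 1))) *
  MvPolynomial.aeval
    (fun n : ℕ+ => ((MvPowerSeries.X ParVar.kappa -
      MvPowerSeries.C (MvPolynomial.X (TimeVar.y 0))) * MvPowerSeries.X (ParVar.b n) :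
        HirotaSymbol)) (schur k) *
  fexp (linForm ParVar.a (fun n => MvPolynomial.X (TimeVar.x n)) +
    linForm ParVar.b (fun n => MvPolynomial.X (TimeVar.y n)))

/-- The Hirota equations
`∑_{m,k ≥ 0} p_m(2a) p_{m+kℓ+jℓ+1}(-D̃_x) p_k((κ - D_y) b) e^{⟨a,D_x⟩ + ⟨b,D_y̌⟩} τ · τ = 0`
for all `j ≥ 0`: for each monomial `θ` in `a`, `b`, `κ`, the coefficients of `θ` in the finite
partial sums are eventually zero. -/
def HirotaEquations (ℓ : ℕ) (τ : Fn) : Prop :=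
  ∀ (j : ℕ) (θ : ParVar →₀ ℕ), ∀ᶠ S : Finset (ℕ × ℕ) in atTop,
    ∑ p ∈ S, hirota (MvPowerSeries.coeff θ (hirotaTerm ℓ j p.1 p.2)) τ τ = 0

end Bogoyavlensky

end

noncomputable section

namespace Bogoyavlensky

theorem pd_mul (v : TimeVar) (f g : Fn) : pd v (f * g) = pd v f * g + f * pd v g := by
  change MvPowerSeries.pderiv ℂ v (f * g) = _
  rw [Derivation.leibniz, smul_eq_mul, smul_eq_mul, add_comm, mul_comm g]
  rfl

theorem dx_iterate_add (k : ℕ) (f g : Fn) : dx^[k] (f + g) = dx^[k] f + dx^[k] g :=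
  iterate_map_add (MvPowerSeries.pderiv ℂ (TimeVar.x 1)) k f g

theorem dx_iterate_zsmul (k : ℕ) (c : ℤ) (f : Fn) : dx^[k] (c • f) = c • dx^[k] f := by
  induction k with
  | zero => rfl
  | succ k ih =>
    rw [Function.iterate_succ_apply', Function.iterate_succ_apply', ih]
    exact map_zsmul (MvPowerSeries.pderiv ℂ (TimeVar.x 1)) c _

theorem pd_comm (v w : TimeVar) (f : Fn) : pd v (pd w f) = pd w (pd v f) := by
  classical
  ext d
  simp only [pd, MvPowerSeries.coeff_pderiv, Finsupp.add_apply, Finsupp.single_apply]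
  rw [add_right_comm d]
  by_cases h : v = w
  · subst h; ring
  · rw [if_neg h, if_neg (Ne.symm h)]; push_cast; ring

theorem pd_dx_iterate (v : TimeVar) (k : ℕ) (f : Fn) : pd v (dx^[k] f) = dx^[k] (pd v f) := by
  induction k with
  | zero => rfl
  | succ k ih => rw [Function.iterate_succ_apply', Function.iterate_succ_apply', ← ih]; exact pd_comm _ _ _

/-- Leibniz rule for the iterated derivative. -/
theorem dx_iterate_mul (k : ℕ) (f g : Fn) :
    dx^[k] (f * g) = ∑ p ∈ Finset.HasAntidiagonal.antidiagonal k, k.choose p.1 • (dx^[p.1] f * dx^[p.2] g) := by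
  induction k with
  | zero => simp
  | succ k ih =>
    rw [Finset.sum_antidiagonal_choose_succ_nsmul (fun i j => dx^[i] f * dx^[j] g),
      Function.iterate_succ_apply', ih, ← Finset.sum_add_distrib]
    change MvPowerSeries.pderiv ℂ (TimeVar.x 1) _ = _
    rw [map_sum]
    refine Finset.sum_congr rfl fun p hp => ?_
    rw [map_nsmul]
    change _ • pd _ _ = _
    rw [pd_mul, Function.iterate_succ_apply', Function.iterate_succ_apply', smul_add, add_comm,
      Nat.choose_symm_of_eq_add (Finset.HasAntidiagonal.mem_antidiagonal.mp hp).symm]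
    rfl

namespace PsDO

instance : Zero PsDO := ⟨⟨fun _ => 0, 0, fun _ _ => rfl⟩⟩

@[simp] theorem coeff_zero (n : ℤ) : (0 : PsDO).coeff n = 0 := rfl

@[simp] theorem coeff_add (A B : PsDO) (n : ℤ) : (A + B).coeff n = A.coeff n + B.coeff n := rfl

@[simp] theorem coeff_neg (A : PsDO) (n : ℤ) : (-A).coeff n = -A.coeff n := rfl

theorem add_mul' (A B C : PsDO) : (A + B) * C = A * C + B * C := by
  ext1; funext N
  rw [coeff_add, coeff_mul, coeff_mul, coeff_mul, mulCoeff, mulCoeff, mulCoeff,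
    ← finsum_add_distrib (mulCoeff_support_finite A C N) (mulCoeff_support_finite B C N)]
  refine finsum_congr fun p => ?_
  rw [coeff_add, ← smul_add, ← add_mul]

theorem mul_add' (A B C : PsDO) : A * (B + C) = A * B + A * C := by
  ext1; funext N
  rw [coeff_add, coeff_mul, coeff_mul, coeff_mul, mulCoeff, mulCoeff, mulCoeff,
    ← finsum_add_distrib (mulCoeff_support_finite A B N) (mulCoeff_support_finite A C N)]
  refine finsum_congr fun p => ?_
  rw [coeff_add, ← smul_add, ← mul_add, dx_iterate_add]

/-- The function `a` times the operator `∂_x^m`. -/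
def mono (a : Fn) (m : ℤ) : PsDO :=
  ⟨fun n => if n = m then a else 0, ⟨m, fun _ hn => if_neg hn.ne'⟩⟩

theorem mono_coeff (a : Fn) (m n : ℤ) : (mono a m).coeff n = if n = m then a else 0 := rfl

theorem finsum_eq_antidiagonal {f : ℤ × ℕ → Fn} (M : ℤ) (r : ℕ)
    (h : ∀ q k, f (q, k) ≠ 0 → ∃ i : ℕ, q = M - i ∧ i + k = r) :
    ∑ᶠ p, f p = ∑ p ∈ Finset.HasAntidiagonal.antidiagonal r, f (M - p.1, p.2) := by
  classical
  rw [finsum_eq_sum_of_support_subset (s := (Finset.HasAntidiagonal.antidiagonal r).image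
    fun p => ((M - p.1 : ℤ), p.2)), Finset.sum_image]
  · rintro ⟨i, k⟩ - ⟨i', k'⟩ - h
    simp only [Prod.mk.injEq] at h ⊢
    omega
  · rintro ⟨q, k⟩ hq
    obtain ⟨i, rfl, hi⟩ := h q k hq
    simp only [Finset.coe_image, Set.mem_image, Finset.mem_coe, Finset.HasAntidiagonal.mem_antidiagonal]
    exact ⟨(i, k), hi, rfl⟩

theorem coeff_mul_mono (A : PsDO) {M : ℤ} (hM : ∀ n, M < n → A.coeff n = 0) (c : Fn) (p : ℤ)
    (r : ℕ) : (A * mono c p).coeff (M + p - r) = ∑ q ∈ Finset.HasAntidiagonal.antidiagonal r,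
      Ring.choose (M - q.1 : ℤ) q.2 • (A.coeff (M - q.1) * dx^[q.2] c) := by
  rw [coeff_mul, mulCoeff, finsum_eq_antidiagonal M r]
  · refine Finset.sum_congr rfl fun q hq => ?_
    have := Finset.HasAntidiagonal.mem_antidiagonal.mp hq
    rw [mono_coeff, if_pos (by omega)]
  · intro q k h
    have h1 : q ≤ M := by
      by_contra hc
      exact h (by simp [hM q (not_le.mp hc)])
    have h2 : M + p - r - q + k = p := by
      by_contra hc
      exact h (by simp [mono_coeff, hc, dx_iterate_zero])
    exact ⟨(M - q).toNat, by omega, by omega⟩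

theorem coeff_mono_mul (a : Fn) (m : ℤ) (B : PsDO) {K : ℤ} (hK : ∀ n, K < n → B.coeff n = 0)
    (r : ℕ) : (mono a m * B).coeff (m + K - r) = ∑ q ∈ Finset.HasAntidiagonal.antidiagonal r,
      Ring.choose m q.1 • (a * dx^[q.1] (B.coeff (K - q.2))) := by
  classical
  rw [coeff_mul, mulCoeff, finsum_eq_sum_of_support_subset (s := (Finset.HasAntidiagonal.antidiagonal r).image
    fun p => (m, p.1)), Finset.sum_image]
  · refine Finset.sum_congr rfl fun q hq => ?_
    have := Finset.HasAntidiagonal.mem_antidiagonal.mp hq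
    rw [mono_coeff, if_pos rfl, show m + K - r - m + (q.1 : ℤ) = K - q.2 by omega]
  · rintro ⟨i, k⟩ hi ⟨i', k'⟩ hi' h
    simp only [Prod.mk.injEq, true_and, Finset.mem_coe, Finset.HasAntidiagonal.mem_antidiagonal] at h hi hi' ⊢
    omega
  · rintro ⟨q, k⟩ h
    have h1 : q = m := by
      by_contra hc
      exact h (by simp [mono_coeff, hc])
    subst h1
    have h2 : q + K - r - q + k ≤ K := by
      by_contra hc
      exact h (by simp [hK _ (not_le.mp hc), dx_iterate_zero])
    simp only [Finset.coe_image, Set.mem_image, Finset.mem_coe, Finset.HasAntidiagonal.mem_antidiagonal,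
      Prod.mk.injEq, true_and]
    exact ⟨(k, r - k), by dsimp only; omega, rfl⟩

theorem coeff_mul_eq_zero {A B : PsDO} {M K : ℤ} (hM : ∀ n, M < n → A.coeff n = 0)
    (hK : ∀ n, K < n → B.coeff n = 0) (n : ℤ) (hn : M + K < n) : (A * B).coeff n = 0 := by
  rw [coeff_mul, mulCoeff]
  refine finsum_eq_zero_of_forall_eq_zero ?_
  rintro ⟨m, k⟩
  by_cases h : m ≤ M
  · simp [hK (n - m + k) (by omega), dx_iterate_zero]
  · simp [hM m (not_le.mp h)]

theorem mul_one' (A : PsDO) : A * 1 = A := by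
  ext1; funext N
  rw [coeff_mul, mulCoeff, finsum_eq_single _ (N, 0)]
  · simp [one_coeff]
  · rintro ⟨m, k⟩ h
    by_cases hk : N - m + k = 0
    · obtain ⟨j, rfl⟩ : ∃ j, k = j + 1 := ⟨k - 1, by
        have : k ≠ 0 := fun hk' => h (by subst hk'; simp at hk ⊢; omega)
        omega⟩
      dsimp only
      rw [hk, one_coeff, if_pos rfl, Function.iterate_succ_apply, dx, pd,
        MvPowerSeries.pderiv_one, dx_iterate_zero, mul_zero, smul_zero]
    · simp [one_coeff, hk, dx_iterate_zero]

instance : NonAssocRing PsDO where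
  add_assoc A B C := by ext1; funext n; exact add_assoc _ _ _
  zero_add A := by ext1; funext n; exact zero_add _
  add_zero A := by ext1; funext n; exact add_zero _
  add_comm A B := by ext1; funext n; exact add_comm _ _
  neg_add_cancel A := by ext1; funext n; exact neg_add_cancel _
  nsmul := nsmulRec
  zsmul := zsmulRec
  left_distrib := mul_add'
  right_distrib := add_mul'
  zero_mul A := by ext1; funext n; simp [coeff_mul, mulCoeff]
  mul_zero A := by ext1; funext n; simp [coeff_mul, mulCoeff, dx_iterate_zero]
  one_mul A := by ext1; funext n; exact mulCoeff_one_left _ _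
  mul_one := mul_one'

/-- Taking the coefficient of `∂_x^n`, as an additive map. -/
def coeffHom (n : ℤ) : PsDO →+ Fn where
  toFun A := A.coeff n
  map_zero' := rfl
  map_add' _ _ := rfl

@[simp] theorem coeff_sub (A B : PsDO) (n : ℤ) : (A - B).coeff n = A.coeff n - B.coeff n :=
  map_sub (coeffHom n) A B

theorem coeff_sum {ι : Type*} (s : Finset ι) (f : ι → PsDO) (n : ℤ) :
    (∑ i ∈ s, f i).coeff n = ∑ i ∈ s, (f i).coeff n :=
  map_sum (coeffHom n) f s

theorem coeff_zsmul (c : ℤ) (A : PsDO) (n : ℤ) : (c • A).coeff n = c • A.coeff n :=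
  map_zsmul (coeffHom n) c A

theorem trLE_coeff (k : ℤ) (A : PsDO) (n : ℤ) :
    (trLE k A).coeff n = if n ≤ k then A.coeff n else 0 := rfl

/-- An additive map that kills operators of sufficiently low order is determined by its values on
the operators `a ∂_x^m`. -/
theorem hom_ext_mono {G : Type*} [AddCommGroup G] (φ ψ : PsDO →+ G)
    (hφ : ∃ T : ℤ, ∀ A : PsDO, (∀ n, T < n → A.coeff n = 0) → φ A = 0)
    (hψ : ∃ T : ℤ, ∀ A : PsDO, (∀ n, T < n → A.coeff n = 0) → ψ A = 0)
    (h : ∀ a m, φ (mono a m) = ψ (mono a m)) (A : PsDO) : φ A = ψ A := by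
  obtain ⟨T, hT⟩ := hφ
  obtain ⟨T', hT'⟩ := hψ
  obtain ⟨M, hM⟩ := A.bounded
  have hA : A = trLE (min T T') A + ∑ n ∈ Finset.Ioc (min T T') M, mono (A.coeff n) n := by
    ext1; funext n
    simp only [coeff_add, coeff_sum, mono_coeff, trLE_coeff]
    rw [Finset.sum_ite_eq]
    by_cases h1 : n ≤ min T T'
    · rw [if_pos h1, if_neg (by simp only [Finset.mem_Ioc]; omega), add_zero]
    · rw [if_neg h1, zero_add]
      split_ifs with h2
      · rfl
      · exact hM n (by simp only [Finset.mem_Ioc] at h2; omega)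
  rw [hA, map_add, map_add, map_sum, map_sum,
    hT _ (fun n hn => by rw [trLE_coeff, if_neg (by omega)]),
    hT' _ (fun n hn => by rw [trLE_coeff, if_neg (by omega)])]
  simp only [h]

theorem mono_bound (a : Fn) (m n : ℤ) (hn : m < n) : (mono a m).coeff n = 0 := if_neg hn.ne'

theorem coeff_mono_mul_mono (a b : Fn) (m n : ℤ) (r : ℕ) :
    (mono a m * mono b n).coeff (m + n - r) = Ring.choose m r • (a * dx^[r] b) := by
  rw [coeff_mono_mul _ _ _ (mono_bound b n), Finset.sum_eq_single (r, 0)]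
  · simp [mono_coeff]
  · rintro ⟨i, k⟩ h h'
    have := Finset.HasAntidiagonal.mem_antidiagonal.mp h
    have hk : k ≠ 0 := by rintro rfl; exact h' (by simpa using this)
    simp [mono_coeff, hk, dx_iterate_zero]
  · simp

theorem choose_mul_choose_sum (m n : ℤ) (r i : ℕ) (hi : i ≤ r) :
    Ring.choose m i * Ring.choose (m + n - i) (r - i) =
      ∑ q ∈ Finset.HasAntidiagonal.antidiagonal r, (Nat.choose q.1 i : ℤ) * (Ring.choose m q.1 * Ring.choose n q.2) := by
  have h : m + n - i = (m - i) + n := by ring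
  rw [h, Ring.add_choose_eq _ (Commute.all _ _), Finset.mul_sum]
  obtain ⟨s, rfl⟩ := Nat.exists_eq_add_of_le hi
  rw [Nat.add_sub_cancel_left]
  refine Finset.sum_of_injOn (fun q => (i + q.1, q.2)) ?_ ?_ ?_ ?_
  · rintro ⟨a, b⟩ - ⟨a', b'⟩ - h
    simpa using h
  · rintro ⟨a, b⟩ h
    simp only [Finset.mem_coe, Finset.HasAntidiagonal.mem_antidiagonal] at h ⊢
    omega
  · rintro ⟨a, b⟩ h h'
    have : a < i := by
      by_contra hc
      refine h' ⟨(a - i, b), ?_, ?_⟩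
      · simp only [Finset.mem_coe, Finset.HasAntidiagonal.mem_antidiagonal] at h ⊢
        omega
      · simp only [Prod.mk.injEq, and_true]; omega
    simp [Nat.choose_eq_zero_of_lt this]
  · rintro ⟨a, b⟩ -
    have := Ring.choose_smul_choose m (Nat.le_add_right i a)
    rw [Nat.add_sub_cancel_left, nsmul_eq_mul] at this
    dsimp only
    rw [← mul_assoc, ← this]
    simp [mul_assoc]

theorem mono_mul_mono_assoc (a b c : Fn) (m n p : ℤ) :
    mono a m * mono b n * mono c p = mono a m * (mono b n * mono c p) := by
  have h1 := coeff_mul_eq_zero (mono_bound a m) (mono_bound b n)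
  have h2 := coeff_mul_eq_zero (mono_bound b n) (mono_bound c p)
  ext1; funext N
  by_cases hN : m + n + p < N
  · rw [coeff_mul_eq_zero h1 (mono_bound c p) _ hN,
      coeff_mul_eq_zero (mono_bound a m) h2 _ (by omega)]
  obtain ⟨r, rfl⟩ : ∃ r : ℕ, N = m + n + p - r := ⟨(m + n + p - N).toNat, by omega⟩
  rw [coeff_mul_mono _ h1, add_assoc m n p, coeff_mono_mul _ _ _ h2]
  simp only [coeff_mono_mul_mono, dx_iterate_zsmul, dx_iterate_mul, Finset.mul_sum,
    Finset.smul_sum]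
  have key : ∀ q ∈ Finset.HasAntidiagonal.antidiagonal r,
      ∑ s ∈ Finset.HasAntidiagonal.antidiagonal q.1, Ring.choose m q.1 • (a * (Ring.choose n q.2 •
        (q.1.choose s.1 • (dx^[s.1] b * dx^[s.2] (dx^[q.2] c))))) =
      ∑ i ∈ Finset.HasAntidiagonal.antidiagonal r, ((Nat.choose q.1 i.1 : ℤ) *
        (Ring.choose m q.1 * Ring.choose n q.2)) • (a * (dx^[i.1] b * dx^[i.2] c)) := by
    rintro ⟨k, l⟩ hq
    have hq := Finset.HasAntidiagonal.mem_antidiagonal.mp hq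
    dsimp only at hq ⊢
    refine Finset.sum_of_injOn (fun s => (s.1, s.2 + l)) ?_ ?_ ?_ ?_
    · rintro ⟨a, b⟩ - ⟨a', b'⟩ - h
      simpa using h
    · rintro ⟨a, b⟩ h
      simp only [Finset.mem_coe, Finset.HasAntidiagonal.mem_antidiagonal] at h ⊢
      omega
    · rintro ⟨i, j⟩ h h'
      have : k < i := by
        by_contra hc
        refine h' ⟨(i, k - i), ?_, ?_⟩
        · simp only [Finset.mem_coe, Finset.HasAntidiagonal.mem_antidiagonal] at h ⊢
          omega
        · simp only [Finset.HasAntidiagonal.mem_antidiagonal] at h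
          simp only [Prod.mk.injEq, true_and]; omega
      simp [Nat.choose_eq_zero_of_lt this]
    · rintro ⟨i, j⟩ -
      dsimp only
      rw [← Function.iterate_add_apply]
      simp only [zsmul_eq_mul, nsmul_eq_mul]
      push_cast
      ring
  rw [Finset.sum_congr rfl key, Finset.sum_comm]
  refine Finset.sum_congr rfl ?_
  · rintro ⟨i, j⟩ h
    have h := Finset.HasAntidiagonal.mem_antidiagonal.mp h
    dsimp only at h ⊢
    rw [← Finset.sum_smul, ← choose_mul_choose_sum m n r i (by omega)]
    rw [show r - i = j by omega]
    simp only [zsmul_eq_mul]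
    push_cast
    ring

theorem mul_assoc' (A B C : PsDO) : A * B * C = A * (B * C) := by
  obtain ⟨a, ha⟩ := A.bounded
  obtain ⟨b, hb⟩ := B.bounded
  obtain ⟨c, hc⟩ := C.bounded
  ext1; funext N
  refine hom_ext_mono
    ((coeffHom N).comp ((AddMonoidHom.mulRight C).comp (AddMonoidHom.mulRight B)))
    ((coeffHom N).comp (AddMonoidHom.mulRight (B * C)))
    ⟨N - 1 - b - c, fun A hA => coeff_mul_eq_zero (coeff_mul_eq_zero hA hb) hc _ (by omega)⟩
    ⟨N - 1 - b - c, fun A hA => coeff_mul_eq_zero hA (coeff_mul_eq_zero hb hc) _ (by omega)⟩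
    (fun f m => ?_) A
  refine hom_ext_mono
    ((coeffHom N).comp ((AddMonoidHom.mulRight C).comp (AddMonoidHom.mulLeft (mono f m))))
    ((coeffHom N).comp ((AddMonoidHom.mulLeft (mono f m)).comp (AddMonoidHom.mulRight C)))
    ⟨N - 1 - m - c, fun B hB =>
      coeff_mul_eq_zero (coeff_mul_eq_zero (mono_bound f m) hB) hc _ (by omega)⟩
    ⟨N - 1 - m - c, fun B hB =>
      coeff_mul_eq_zero (mono_bound f m) (coeff_mul_eq_zero hB hc) _ (by omega)⟩
    (fun g n => ?_) B
  refine hom_ext_mono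
    ((coeffHom N).comp (AddMonoidHom.mulLeft (mono f m * mono g n)))
    ((coeffHom N).comp ((AddMonoidHom.mulLeft (mono f m)).comp (AddMonoidHom.mulLeft (mono g n))))
    ⟨N - 1 - m - n, fun C hC => coeff_mul_eq_zero
      (coeff_mul_eq_zero (mono_bound f m) (mono_bound g n)) hC _ (by omega)⟩
    ⟨N - 1 - m - n, fun C hC => coeff_mul_eq_zero (mono_bound f m)
      (coeff_mul_eq_zero (mono_bound g n) hC) _ (by omega)⟩
    (fun h p => ?_) C
  exact congrArg (fun X : PsDO => X.coeff N) (mono_mul_mono_assoc f g h m n p)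

instance : Ring PsDO where
  mul_assoc := mul_assoc'
  __ := (inferInstance : NonAssocRing PsDO)

end PsDO
end Bogoyavlensky

end

noncomputable section

namespace Bogoyavlensky
namespace PsDO

theorem dxPow_eq_mono (n : ℤ) : dxPow n = mono 1 n := rfl

theorem coeff_mul_dxPow (A : PsDO) (n N : ℤ) : (A * dxPow n).coeff N = A.coeff (N - n) := by
  rw [coeff_mul, mulCoeff, finsum_eq_single _ (N - n, 0)]
  · simp [dxPow]
  · rintro ⟨m, k⟩ h
    by_cases hk : N - m + k = n
    · obtain ⟨j, rfl⟩ : ∃ j, k = j + 1 := ⟨k - 1, by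
        have : k ≠ 0 := fun hk' => h (by subst hk'; simp at hk ⊢; omega)
        omega⟩
      simp only [dxPow, hk, if_true]
      rw [Function.iterate_succ_apply, dx, pd,
        MvPowerSeries.pderiv_one, dx_iterate_zero, mul_zero, smul_zero]
    · simp [dxPow, hk, dx_iterate_zero]

theorem coeff_mono_zero_mul (f : Fn) (A : PsDO) (N : ℤ) :
    (mono f 0 * A).coeff N = f * A.coeff N := by
  rw [coeff_mul, mulCoeff, finsum_eq_single _ (0, 0)]
  · simp [mono_coeff]
  · rintro ⟨m, k⟩ h
    by_cases hm : m = 0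
    · subst hm
      obtain ⟨j, rfl⟩ : ∃ j, k = j + 1 := ⟨k - 1, by
        have : k ≠ 0 := fun hk' => h (by rw [hk'])
        omega⟩
      simp [Ring.choose_zero_succ]
    · simp [mono_coeff, hm]

theorem mono_mul_dxPow (a : Fn) (m n : ℤ) : mono a m * dxPow n = mono a (m + n) := by
  ext1; funext N
  rw [coeff_mul_dxPow, mono_coeff, mono_coeff]
  simp only [sub_eq_iff_eq_add]

theorem mono_mul_mono_zero (a b : Fn) (m : ℤ) : mono a 0 * mono b m = mono (a * b) m := by
  ext1; funext N
  rw [coeff_mono_zero_mul, mono_coeff, mono_coeff, mul_ite, mul_zero]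

theorem mono_eq (a : Fn) (m : ℤ) : mono a m = mono a 0 * dxPow m := by
  rw [mono_mul_dxPow, zero_add]

theorem dxPow_mul_dxPow (m n : ℤ) : dxPow m * dxPow n = dxPow (m + n) :=
  mono_mul_dxPow 1 m n

theorem dxPow_zero : dxPow 0 = 1 := rfl

/-! ### The formal adjoint -/

theorem adjoint_support_finite (A : PsDO) (N : ℤ) : (Function.support fun k : ℕ =>
    ((Int.negOnePow (N + k) : ℤ) * Ring.choose (N + k : ℤ) k) •
      dx^[k] (A.coeff (N + k))).Finite := by
  obtain ⟨M, hM⟩ := A.bounded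
  refine (Set.finite_Iic (M - N).toNat).subset fun k hk => ?_
  have : N + k ≤ M := by
    by_contra hc
    exact hk (by simp [hM _ (not_le.mp hc), dx_iterate_zero])
  simp only [Set.mem_Iic]
  omega

theorem coeff_adjoint (A : PsDO) (N : ℤ) : A.adjoint.coeff N =
    ∑ᶠ k : ℕ, ((Int.negOnePow (N + k) : ℤ) * Ring.choose (N + k : ℤ) k) •
      dx^[k] (A.coeff (N + k)) := rfl

/-- The formal adjoint as an additive map. -/
def adjointHom : PsDO →+ PsDO :=
  AddMonoidHom.mk' adjoint fun A B => by
    ext1; funext N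
    rw [coeff_add, coeff_adjoint, coeff_adjoint, coeff_adjoint,
      ← finsum_add_distrib (adjoint_support_finite A N) (adjoint_support_finite B N)]
    refine finsum_congr fun k => ?_
    rw [coeff_add, dx_iterate_add, smul_add]

theorem coeff_adjoint_eq_zero {A : PsDO} {M : ℤ} (hM : ∀ n, M < n → A.coeff n = 0) (n : ℤ)
    (hn : M < n) : A.adjoint.coeff n = 0 := by
  rw [coeff_adjoint]
  refine finsum_eq_zero_of_forall_eq_zero fun k => ?_
  rw [hM _ (by omega), dx_iterate_zero, smul_zero]

theorem adjoint_zsmul (c : ℤ) (A : PsDO) : (c • A).adjoint = c • A.adjoint :=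
  map_zsmul adjointHom c A

theorem coeff_adjoint_sub (A : PsDO) {M : ℤ} (hM : ∀ n, M < n → A.coeff n = 0) (r : ℕ) :
    A.adjoint.coeff (M - r) = ∑ k ∈ Finset.range (r + 1),
      ((Int.negOnePow (M - r + k) : ℤ) * Ring.choose (M - r + k : ℤ) k) •
      dx^[k] (A.coeff (M - r + k)) := by
  rw [coeff_adjoint]
  refine finsum_eq_sum_of_support_subset _ fun k hk => ?_
  have : M - r + k ≤ M := by
    by_contra hc
    exact hk (by simp [hM _ (not_le.mp hc), dx_iterate_zero])
  simp only [Finset.coe_range, Set.mem_Iio]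
  omega

theorem coeff_dxPow_mul_mono_zero (m : ℤ) (b : Fn) (r : ℕ) :
    (dxPow m * mono b 0).coeff (m - r) = Ring.choose m r • dx^[r] b := by
  have := coeff_mono_mul_mono 1 b m 0 r
  rwa [add_zero, one_mul] at this

theorem dxPow_mul_mono_zero_bound (m : ℤ) (b : Fn) (n : ℤ) (hn : m < n) :
    (dxPow m * mono b 0).coeff n = 0 :=
  coeff_mul_eq_zero (mono_bound 1 m) (mono_bound b 0) n (by omega)

theorem adjoint_mono (a : Fn) (m : ℤ) :
    (mono a m).adjoint = (Int.negOnePow m : ℤ) • (dxPow m * mono a 0) := by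
  ext1; funext N
  rw [coeff_zsmul]
  by_cases hN : m < N
  · rw [coeff_adjoint_eq_zero (mono_bound a m) _ hN, dxPow_mul_mono_zero_bound _ _ _ hN, smul_zero]
  obtain ⟨r, rfl⟩ : ∃ r : ℕ, N = m - r := ⟨(m - N).toNat, by omega⟩
  rw [coeff_adjoint_sub _ (mono_bound a m), Finset.sum_eq_single r, coeff_dxPow_mul_mono_zero,
    sub_add_cancel, mono_coeff, if_pos rfl, mul_smul]
  · intro k _ hk
    rw [mono_coeff, if_neg (by omega), dx_iterate_zero, smul_zero]
  · simp

theorem adjoint_dxPow_mul_mono_zero (m : ℤ) (b : Fn) :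
    (dxPow m * mono b 0).adjoint = (Int.negOnePow m : ℤ) • mono b m := by
  have hb := dxPow_mul_mono_zero_bound m b
  ext1; funext N
  rw [coeff_zsmul]
  by_cases hN : m < N
  · rw [coeff_adjoint_eq_zero hb _ hN, mono_bound _ _ _ hN, smul_zero]
  obtain ⟨r, rfl⟩ : ∃ r : ℕ, N = m - r := ⟨(m - N).toNat, by omega⟩
  rw [coeff_adjoint_sub _ hb]
  have key : ∀ k ∈ Finset.range (r + 1),
      ((Int.negOnePow (m - r + k) : ℤ) * Ring.choose (m - r + k : ℤ) k) •
        dx^[k] ((dxPow m * mono b 0).coeff (m - r + k)) =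
      ((Int.negOnePow (m - r) : ℤ) * Ring.choose m r * ((-1) ^ k * r.choose k)) • dx^[r] b := by
    intro k hk
    have hk := Finset.mem_range.mp hk
    obtain ⟨s, rfl⟩ := Nat.exists_eq_add_of_le (Nat.le_of_lt_succ hk)
    have h1 : (m - ((k + s : ℕ) : ℤ) + k) = m - s := by push_cast; ring
    have h2 := Ring.choose_smul_choose m (Nat.le_add_left s k)
    rw [Nat.add_sub_cancel, nsmul_eq_mul] at h2
    rw [h1, coeff_dxPow_mul_mono_zero, dx_iterate_zsmul, ← Function.iterate_add_apply, smul_smul]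
    congr 1
    rw [Nat.choose_symm_add, ← h1, Int.negOnePow_add, h1]
    have h3 : ((Int.negOnePow k : ℤˣ) : ℤ) = (-1) ^ k := by
      simp [Int.negOnePow]
    push_cast at h2 ⊢
    rw [h3]
    linear_combination -((-1) ^ k * (((m - (k + s)).negOnePow : ℤˣ) : ℤ)) * h2
  rw [Finset.sum_congr rfl key, ← Finset.sum_smul, ← Finset.mul_sum,
    Int.alternating_sum_range_choose, mono_coeff]
  by_cases hr : r = 0
  · subst hr; simp
  · rw [if_neg hr, if_neg (by omega), mul_zero, zero_smul, smul_zero]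

theorem adjoint_adjoint (A : PsDO) : A.adjoint.adjoint = A := by
  obtain ⟨M, hM⟩ := A.bounded
  ext1; funext N
  refine hom_ext_mono ((coeffHom N).comp (adjointHom.comp adjointHom)) (coeffHom N)
    ⟨N - 1, fun A hA => coeff_adjoint_eq_zero (coeff_adjoint_eq_zero hA) _ (by omega)⟩
    ⟨N - 1, fun A hA => hA _ (by omega)⟩ (fun a m => ?_) A
  change (mono a m).adjoint.adjoint.coeff N = (mono a m).coeff N
  rw [adjoint_mono, adjoint_zsmul, adjoint_dxPow_mul_mono_zero, smul_smul, ← Units.val_mul,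
    Int.units_mul_self, Units.val_one, one_smul]

theorem adjoint_mul_dxPow (A : PsDO) (n : ℤ) :
    (A * dxPow n).adjoint = (Int.negOnePow n : ℤ) • (dxPow n * A.adjoint) := by
  rw [← smul_mul_assoc]
  ext1; funext N
  refine hom_ext_mono ((coeffHom N).comp (adjointHom.comp (AddMonoidHom.mulRight (dxPow n))))
    ((coeffHom N).comp ((AddMonoidHom.mulLeft ((Int.negOnePow n : ℤ) • dxPow n)).comp adjointHom))
    ⟨N - 1 - n, fun A hA => coeff_adjoint_eq_zero (coeff_mul_eq_zero hA (mono_bound 1 n)) _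
      (by omega)⟩
    ⟨N - 1 - n, fun A hA => ?_⟩ (fun a m => ?_) A
  · change ((Int.negOnePow n : ℤ) • dxPow n * A.adjoint).coeff N = 0
    rw [smul_mul_assoc, coeff_zsmul, dxPow_eq_mono, coeff_mul_eq_zero (mono_bound 1 n) (coeff_adjoint_eq_zero hA) _ (by omega), smul_zero]
  · change (mono a m * dxPow n).adjoint.coeff N =
      ((Int.negOnePow n : ℤ) • dxPow n * (mono a m).adjoint).coeff N
    rw [mono_mul_dxPow, adjoint_mono, adjoint_mono, smul_mul_assoc, mul_smul_comm, ← mul_assoc,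
      dxPow_mul_dxPow, smul_smul, Int.negOnePow_add, Units.val_mul, mul_comm, add_comm]

theorem adjoint_mono_zero_mul (f : Fn) (A : PsDO) :
    (mono f 0 * A).adjoint = A.adjoint * mono f 0 := by
  ext1; funext N
  refine hom_ext_mono ((coeffHom N).comp (adjointHom.comp (AddMonoidHom.mulLeft (mono f 0))))
    ((coeffHom N).comp ((AddMonoidHom.mulRight (mono f 0)).comp adjointHom))
    ⟨N - 1, fun A hA => coeff_adjoint_eq_zero (coeff_mul_eq_zero (mono_bound f 0) hA) _
      (by omega)⟩
    ⟨N - 1, fun A hA => coeff_mul_eq_zero (coeff_adjoint_eq_zero hA) (mono_bound f 0) _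
      (by omega)⟩ (fun a m => ?_) A
  change (mono f 0 * mono a m).adjoint.coeff N = ((mono a m).adjoint * mono f 0).coeff N
  rw [mono_mul_mono_zero, adjoint_mono, adjoint_mono, smul_mul_assoc, mul_assoc,
    mono_mul_mono_zero, mul_comm f]

theorem adjoint_mono_mul_mono (a b : Fn) (m n : ℤ) :
    (mono a m * mono b n).adjoint = (mono b n).adjoint * (mono a m).adjoint := by
  have h : mono a m * mono b n = mono a 0 * (dxPow m * mono b 0 * dxPow n) := by
    rw [mono_eq a m, mono_eq b n]; simp only [mul_assoc]
  rw [h, adjoint_mono_zero_mul, adjoint_mul_dxPow, adjoint_dxPow_mul_mono_zero, adjoint_mono,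
    adjoint_mono, mono_eq b m]
  simp only [mul_smul_comm, smul_mul_assoc, mul_assoc]
  exact smul_comm _ _ _

theorem adjoint_mul (A B : PsDO) : (A * B).adjoint = B.adjoint * A.adjoint := by
  obtain ⟨a, ha⟩ := A.bounded
  obtain ⟨b, hb⟩ := B.bounded
  ext1; funext N
  refine hom_ext_mono
    ((coeffHom N).comp (adjointHom.comp (AddMonoidHom.mulRight B)))
    ((coeffHom N).comp ((AddMonoidHom.mulLeft B.adjoint).comp adjointHom))
    ⟨N - 1 - b, fun A hA => coeff_adjoint_eq_zero (coeff_mul_eq_zero hA hb) _ (by omega)⟩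
    ⟨N - 1 - b, fun A hA => coeff_mul_eq_zero (coeff_adjoint_eq_zero hb)
      (coeff_adjoint_eq_zero hA) _ (by omega)⟩
    (fun f m => ?_) A
  refine hom_ext_mono
    ((coeffHom N).comp (adjointHom.comp (AddMonoidHom.mulLeft (mono f m))))
    ((coeffHom N).comp ((AddMonoidHom.mulRight (mono f m).adjoint).comp adjointHom))
    ⟨N - 1 - m, fun B hB => coeff_adjoint_eq_zero
      (coeff_mul_eq_zero (mono_bound f m) hB) _ (by omega)⟩
    ⟨N - 1 - m, fun B hB => coeff_mul_eq_zero (coeff_adjoint_eq_zero hB)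
      (coeff_adjoint_eq_zero (mono_bound f m)) _ (by omega)⟩
    (fun g n => ?_) B
  exact congrArg (fun X : PsDO => X.coeff N) (adjoint_mono_mul_mono f g m n)

theorem adjoint_one : (1 : PsDO).adjoint = 1 := by
  have h := adjoint_mono 1 0
  rw [← dxPow_eq_mono, dxPow_zero] at h
  simpa using h

/-! ### The inverse -/

theorem isWilsonSato_inv (W : PsDO) : W.inv.IsWilsonSato := by
  refine ⟨?_, fun n hn => if_neg (not_le.mpr hn)⟩
  change (if (0 : ℤ) ≤ 0 then ∑ k ∈ Finset.range (Int.natAbs 0 + 1), ((1 + -W).npow k).coeff 0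
    else 0) = 1
  rw [if_pos le_rfl]
  simp [npow, one_coeff]

theorem inv_mul_of_isWilsonSato {W : PsDO} (hW : W.IsWilsonSato) : W.inv * W = 1 := by
  have h1 := mul_inv_of_isWilsonSato hW
  have h2 := mul_inv_of_isWilsonSato (isWilsonSato_inv W)
  rwa [← left_inv_eq_right_inv h1 h2] at h2

/-- `((W^*)⁻¹)^* = W⁻¹` -/
theorem adjoint_inv_adjoint {W : PsDO} (hW : W.IsWilsonSato) : W.adjoint.inv.adjoint = W.inv := by
  have h := congrArg adjoint (mul_inv_of_isWilsonSato hW.adjoint)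
  rw [adjoint_mul, adjoint_adjoint, adjoint_one] at h
  exact left_inv_eq_right_inv h (mul_inv_of_isWilsonSato hW)

/-! ### Coefficientwise derivatives and differential operators -/

theorem pdiff_coeff (v : TimeVar) (A : PsDO) (n : ℤ) : (A.pdiff v).coeff n = pd v (A.coeff n) := rfl

theorem pdiff_mul (v : TimeVar) (A B : PsDO) :
    (A * B).pdiff v = A.pdiff v * B + A * B.pdiff v := by
  ext1; funext N
  rw [pdiff_coeff, coeff_add, coeff_mul, coeff_mul, coeff_mul, mulCoeff, mulCoeff, mulCoeff,
    ← finsum_add_distrib (mulCoeff_support_finite _ _ N) (mulCoeff_support_finite _ _ N)]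
  have := (MvPowerSeries.pderiv ℂ v).toLinearMap.toAddMonoidHom.map_finsum
    (mulCoeff_support_finite A B N)
  refine this.trans (finsum_congr fun p => ?_)
  change MvPowerSeries.pderiv ℂ v _ = _
  rw [map_zsmul]
  change _ • pd v _ = _
  rw [pd_mul, pd_dx_iterate, smul_add]
  rfl

theorem pdiff_dxPow (v : TimeVar) (n : ℤ) : (dxPow n).pdiff v = 0 := by
  ext1; funext N
  change pd v (if N = n then 1 else 0) = 0
  split_ifs
  · exact MvPowerSeries.pderiv_one
  · exact pd_zero v

/-- `A` is a differential operator. -/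
def IsDiff (A : PsDO) : Prop := ∀ n : ℤ, n < 0 → A.coeff n = 0

theorem IsDiff.add {A B : PsDO} (hA : A.IsDiff) (hB : B.IsDiff) : (A + B).IsDiff :=
  fun n hn => by rw [coeff_add, hA n hn, hB n hn, add_zero]

theorem IsDiff.neg {A : PsDO} (hA : A.IsDiff) : (-A).IsDiff :=
  fun n hn => by rw [coeff_neg, hA n hn, neg_zero]

theorem IsDiff.pdiff {A : PsDO} (hA : A.IsDiff) (v : TimeVar) : (A.pdiff v).IsDiff :=
  fun n hn => by rw [pdiff_coeff, hA n hn, pd_zero]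

theorem IsDiff.mul {A B : PsDO} (hA : A.IsDiff) (hB : B.IsDiff) : (A * B).IsDiff := by
  intro n hn
  rw [coeff_mul, mulCoeff]
  refine finsum_eq_zero_of_forall_eq_zero ?_
  rintro ⟨m, k⟩
  dsimp only
  by_cases hm : m < 0
  · rw [hA m hm, zero_mul, smul_zero]
  by_cases hk : n - m + k < 0
  · rw [hB _ hk, dx_iterate_zero, mul_zero, smul_zero]
  obtain ⟨m, rfl⟩ := Int.eq_ofNat_of_zero_le (not_lt.mp hm)
  rw [Ring.choose_natCast, Nat.choose_eq_zero_of_lt (by omega), Nat.cast_zero, zero_smul]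

theorem isDiff_mono (a : Fn) {m : ℤ} (hm : 0 ≤ m) : (mono a m).IsDiff :=
  fun n hn => by rw [mono_coeff, if_neg (by omega)]

theorem isDiff_one : (1 : PsDO).IsDiff := isDiff_mono 1 le_rfl

theorem isDiff_sub_trLE (A : PsDO) : (A - trLE (-1) A).IsDiff :=
  fun n hn => by rw [coeff_sub, trLE_coeff, if_pos (by omega), sub_self]

/-! ### Consequences of the evolution equations -/

section Flow

variable {ℓ : ℕ} {W : PsDO} (hW : IsSolution ℓ W)
include hW

theorem conj_mul (A : PsDO) : W * A * W.inv * W = W * A := by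
  rw [mul_assoc, inv_mul_of_isWilsonSato hW.wilsonSato, mul_one]

theorem isDiff_conj_dxPow (n : ℕ) : (W * dxPow (n * ℓ : ℕ) * W.inv).IsDiff := by
  induction n with
  | zero =>
    rw [zero_mul, Nat.cast_zero, dxPow_zero, mul_one, mul_inv_of_isWilsonSato hW.wilsonSato]
    exact isDiff_one
  | succ n ih =>
    have h : W * dxPow ((n + 1) * ℓ : ℕ) * W.inv =
        (W * dxPow (n * ℓ : ℕ) * W.inv) * (W * dxPow ℓ * W.inv) := by
      rw [← mul_assoc, ← mul_assoc, conj_mul hW, mul_assoc W (dxPow _) (dxPow _), dxPow_mul_dxPow,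
        ← Nat.cast_add, Nat.succ_mul]
    rw [h]
    exact ih.mul fun n hn => hW.reduced n (by omega)

/-- `∂W/∂x_n + W ∂_x^n = B W` with a differential operator `B`. -/
theorem exists_flow_x (n : ℕ+) : ∃ B : PsDO, B.IsDiff ∧
    W.pdiff (TimeVar.x n) + W * dxPow n = B * W := by
  refine ⟨_, isDiff_sub_trLE (W * dxPow n * W.inv), ?_⟩
  rw [sub_mul, conj_mul hW, hW.flow_x n, neg_mul]
  abel

/-- `∂W/∂y_{nℓ} - (∂W/∂y) ∂_x^{nℓ} = B W` with a differential operator `B`. -/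
theorem exists_flow_y (n : ℕ+) : ∃ B : PsDO, B.IsDiff ∧
    W.pdiff (TimeVar.y n) - W.pdiff (TimeVar.y 0) * dxPow ((n : ℕ) * ℓ : ℕ) = B * W := by
  set L := W * dxPow ((n : ℕ) * ℓ : ℕ) * W.inv with hL
  have hLW : L * W = W * dxPow ((n : ℕ) * ℓ : ℕ) := conj_mul hW _
  have h1 := congrArg (pdiff (TimeVar.y 0)) hLW
  rw [pdiff_mul _ L, pdiff_mul _ W, pdiff_dxPow, mul_zero, add_zero] at h1
  refine ⟨-(L.pdiff (TimeVar.y 0)) + -(L * W.pdiff (TimeVar.y 0) * W.inv -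
    trLE (-1) (L * W.pdiff (TimeVar.y 0) * W.inv)), (((isDiff_conj_dxPow hW n).pdiff _).neg).add
    (isDiff_sub_trLE _).neg, ?_⟩
  rw [hW.flow_y n, ← hL, ← h1, add_mul, neg_mul, neg_mul, sub_mul,
    mul_assoc (L * _) W.inv W, inv_mul_of_isWilsonSato hW.wilsonSato, mul_one]
  abel

end Flow

end PsDO
end Bogoyavlensky

end

noncomputable section

namespace Bogoyavlensky

/-! ### Differentiation of substituted power series -/

section ChainRule

variable {σ τ R S : Type*} [CommRing R] [CommRing S] [Algebra R S]

theorem _root_.MvPolynomial.pderiv_aeval_mvPowerSeries (a : σ → MvPowerSeries τ S) (w : τ)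
    (s : Finset σ) (hs : ∀ v ∉ s, MvPowerSeries.pderiv S w (a v) = 0) (p : MvPolynomial σ R) :
    MvPowerSeries.pderiv S w (MvPolynomial.aeval a p) =
      ∑ v ∈ s, MvPolynomial.aeval a (MvPolynomial.pderiv v p) * MvPowerSeries.pderiv S w (a v) := by
  classical
  induction p using MvPolynomial.induction_on with
  | C r =>
    simp only [MvPolynomial.pderiv_C, map_zero, zero_mul, Finset.sum_const_zero,
      MvPolynomial.aeval_C, IsScalarTower.algebraMap_apply R S (MvPowerSeries τ S)]
    exact MvPowerSeries.pderiv_C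
  | add p q hp hq => simp only [map_add, hp, hq, add_mul, Finset.sum_add_distrib]
  | mul_X p v hp =>
    have h : ∑ u ∈ s, (if v = u then MvPolynomial.aeval a p else 0) *
        MvPowerSeries.pderiv S w (a u) =
        MvPolynomial.aeval a p * MvPowerSeries.pderiv S w (a v) := by
      simp only [ite_mul, zero_mul, Finset.sum_ite_eq]
      split_ifs with h
      · rfl
      · rw [hs v h, mul_zero]
    rw [map_mul, MvPolynomial.aeval_X, Derivation.leibniz, hp, smul_eq_mul, smul_eq_mul,
      Finset.mul_sum, ← h, ← Finset.sum_add_distrib]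
    refine Finset.sum_congr rfl fun u _ => ?_
    rw [Derivation.leibniz, MvPolynomial.pderiv_X, map_add]
    by_cases hu : v = u
    · subst hu
      simp
      ring
    · simp [hu]
      ring

open scoped MvPowerSeries.WithPiTopology in
theorem continuous_pderiv [TopologicalSpace S] [IsTopologicalRing S] (w : τ) :
    Continuous (MvPowerSeries.pderiv S w) :=
  continuous_pi fun d =>
    (MvPowerSeries.WithPiTopology.continuous_coeff S (d + Finsupp.single w 1)).mul
      (continuous_const (y := (d w + 1 : S)))

open scoped MvPowerSeries.WithPiTopology in
/-- The chain rule for substitutions of which finitely many terms depend on the variable. -/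
theorem _root_.MvPowerSeries.pderiv_subst {a : σ → MvPowerSeries τ S}
    (ha : MvPowerSeries.HasSubst a) (w : τ) (s : Finset σ)
    (hs : ∀ v ∉ s, MvPowerSeries.pderiv S w (a v) = 0) (f : MvPowerSeries σ R) :
    MvPowerSeries.pderiv S w (MvPowerSeries.subst a f) =
      ∑ v ∈ s, MvPowerSeries.subst a (MvPowerSeries.pderiv R v f) *
        MvPowerSeries.pderiv S w (a v) := by
  let : UniformSpace R := ⊥
  let : UniformSpace S := ⊥
  have hc := MvPowerSeries.continuous_subst (R := R) ha
  have h1 : Continuous fun f : MvPowerSeries σ R =>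
      MvPowerSeries.pderiv S w (MvPowerSeries.subst a f) := (continuous_pderiv w).comp hc
  have h2 : Continuous fun f : MvPowerSeries σ R =>
      ∑ v ∈ s, MvPowerSeries.subst a (MvPowerSeries.pderiv R v f) *
        MvPowerSeries.pderiv S w (a v) :=
    continuous_finsetSum _ fun v _ => (hc.comp (continuous_pderiv v)).mul continuous_const
  refine congrFun (MvPowerSeries.WithPiTopology.denseRange_toMvPowerSeries.equalizer h1 h2 ?_) f
  funext p
  simp only [Function.comp_apply, MvPowerSeries.pderiv_coe, MvPowerSeries.subst_coe]
  exact MvPolynomial.pderiv_aeval_mvPowerSeries a w s hs p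

end ChainRule

/-! ### Exponentials of linear forms -/

section Exponential

variable {σ R : Type} [CommRing R] [Algebra ℂ R]

theorem isAddTorsionFree_of_complex (R : Type*) [AddCommGroup R] [Module ℂ R] :
    IsAddTorsionFree R where
  nsmul_right_injective n hn f g hfg := by
    simp only [← Nat.cast_smul_eq_nsmul ℂ] at hfg
    exact smul_right_injective R (Nat.cast_ne_zero.mpr hn) hfg

theorem pderiv_fexp {f : MvPowerSeries σ R} (hf : MvPowerSeries.constantCoeff f = 0) (v : σ) :
    MvPowerSeries.pderiv R v (fexp f) = fexp f * MvPowerSeries.pderiv R v f := by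
  have h := MvPowerSeries.pderiv_subst (R := ℂ) (PowerSeries.HasSubst.of_constantCoeff_zero hf).const v
    Finset.univ (fun u hu => absurd (Finset.mem_univ u) hu) (PowerSeries.exp ℂ)
  rw [Finset.univ_unique, Finset.sum_singleton] at h
  refine h.trans ?_
  have h1 : MvPowerSeries.pderiv ℂ (default : Unit) (PowerSeries.exp ℂ) = PowerSeries.exp ℂ :=
    PowerSeries.derivative_exp ℂ
  rw [h1]
  rfl

theorem constantCoeff_fexp {f : MvPowerSeries σ R} (hf : MvPowerSeries.constantCoeff f = 0) :
    MvPowerSeries.constantCoeff (fexp f) = 1 := by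
  rw [fexp, PowerSeries.constantCoeff_subst (PowerSeries.HasSubst.of_constantCoeff_zero hf),
    finsum_eq_single _ 0]
  · simp
  · intro n hn
    rw [map_pow, hf, zero_pow hn, smul_zero]

theorem fexp_mul_fexp_neg {f : MvPowerSeries σ R} (hf : MvPowerSeries.constantCoeff f = 0) :
    fexp f * fexp (-f) = 1 := by
  have : IsAddTorsionFree R := isAddTorsionFree_of_complex R
  have hf' : MvPowerSeries.constantCoeff (-f) = 0 := by rw [map_neg, hf, neg_zero]
  refine MvPowerSeries.pderiv.ext (fun v => ?_) ?_
  · rw [Derivation.leibniz, pderiv_fexp hf, pderiv_fexp hf', map_neg, MvPowerSeries.pderiv_one,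
      smul_eq_mul, smul_eq_mul]
    ring
  · rw [map_mul, constantCoeff_fexp hf, constantCoeff_fexp hf', map_one, mul_one]

end Exponential

section LinForm

variable {σ R : Type} [CommRing R]

theorem coeff_linForm_single {u : ℕ+ → σ} (hu : Function.Injective u) (c : ℕ+ → R) (n : ℕ+) :
    MvPowerSeries.coeff (Finsupp.single (u n) 1) (linForm u c) = c n := by
  change (∑ᶠ m : ℕ+, _) = _
  rw [finsum_eq_single _ n, if_pos rfl]
  intro m hm
  exact if_neg fun h => hm (hu (Finsupp.single_left_injective one_ne_zero h)).symm

theorem coeff_linForm_of_ne {u : ℕ+ → σ} {c : ℕ+ → R} {d : σ →₀ ℕ}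
    (hd : ∀ n, d ≠ Finsupp.single (u n) 1) : MvPowerSeries.coeff d (linForm u c) = 0 :=
  finsum_eq_zero_of_forall_eq_zero fun n => if_neg (hd n)

theorem pderiv_linForm_self {u : ℕ+ → σ} (hu : Function.Injective u) (c : ℕ+ → R) (n : ℕ+) :
    MvPowerSeries.pderiv R (u n) (linForm u c) = MvPowerSeries.C (c n) := by
  classical
  ext d
  rw [MvPowerSeries.coeff_pderiv, MvPowerSeries.coeff_C]
  split_ifs with h
  · subst h
    rw [zero_add, coeff_linForm_single hu]
    simp
  · rw [coeff_linForm_of_ne, zero_mul]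
    intro m hm
    have h1 := congrArg Finsupp.degree hm
    rw [map_add, Finsupp.degree_single, Finsupp.degree_single, add_eq_right] at h1
    exact h ((Finsupp.degree_eq_zero_iff d).mp h1)

theorem pderiv_linForm_of_ne {u : ℕ+ → σ} (c : ℕ+ → R) {v : σ} (hv : ∀ n, u n ≠ v) :
    MvPowerSeries.pderiv R v (linForm u c) = 0 := by
  ext d
  rw [MvPowerSeries.coeff_pderiv, coeff_linForm_of_ne, zero_mul, map_zero]
  intro m hm
  have h1 := DFunLike.congr_fun hm v
  rw [Finsupp.add_apply, Finsupp.single_eq_same, Finsupp.single_eq_of_ne (hv m).symm] at h1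
  omega

end LinForm

/-! ### Coefficients with respect to `λ` -/

section LamCoeff

variable {σ : Type}

/-- The coefficient of `λ^{-k}`. -/
def lamCoeff (k : ℤ) : MvPowerSeries σ Lau →+ MvPowerSeries σ ℂ where
  toFun F := fun d => (MvPowerSeries.coeff d F).coeff k
  map_zero' := rfl
  map_add' _ _ := rfl

theorem coeff_lamCoeff (k : ℤ) (F : MvPowerSeries σ Lau) (d : σ →₀ ℕ) :
    MvPowerSeries.coeff d (lamCoeff k F) = (MvPowerSeries.coeff d F).coeff k := rfl

theorem residue_eq_lamCoeff (F : MvPowerSeries σ Lau) : residue F = lamCoeff 1 F := rfl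

theorem lamCoeff_ext {F G : MvPowerSeries σ Lau} (h : ∀ k, lamCoeff k F = lamCoeff k G) :
    F = G := by
  ext d k
  rw [← coeff_lamCoeff, h, coeff_lamCoeff]

theorem lamCoeff_pderiv (k : ℤ) (v : σ) (F : MvPowerSeries σ Lau) :
    lamCoeff k (MvPowerSeries.pderiv Lau v F) = MvPowerSeries.pderiv ℂ v (lamCoeff k F) := by
  ext d
  rw [coeff_lamCoeff, MvPowerSeries.coeff_pderiv, MvPowerSeries.coeff_pderiv, coeff_lamCoeff,
    ← Nat.cast_succ, ← Nat.cast_succ, mul_comm, ← nsmul_eq_mul, mul_comm, ← nsmul_eq_mul]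
  rfl

theorem lamCoeff_lam_mul (k n : ℤ) (F : MvPowerSeries σ Lau) :
    lamCoeff k (MvPowerSeries.C (lam n) * F) = lamCoeff (k + n) F := by
  ext d
  rw [coeff_lamCoeff, coeff_lamCoeff, MvPowerSeries.coeff_C_mul, lam, HahnSeries.coeff_single_mul,
    one_mul, sub_neg_eq_add]

theorem lam_mul_lam (m n : ℤ) : lam m * lam n = lam (m + n) := by
  rw [lam, lam, lam, HahnSeries.single_mul_single, one_mul, neg_add]

theorem lam_zero : lam 0 = 1 := rfl

theorem lamCoeff_constLam_mul (k : ℤ) (f : Fn) (F : MvPowerSeries TimeVar Lau) :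
    lamCoeff k (constLam f * F) = f * lamCoeff k F := by
  classical
  ext d
  rw [coeff_lamCoeff, MvPowerSeries.coeff_mul, MvPowerSeries.coeff_mul]
  have := map_sum (HahnSeries.coeff.addMonoidHom k : Lau →+ ℂ)
    (fun p : (TimeVar →₀ ℕ) × (TimeVar →₀ ℕ) => MvPowerSeries.coeff p.1 (constLam f) *
    MvPowerSeries.coeff p.2 F) (Finset.HasAntidiagonal.antidiagonal d)
  refine this.trans (Finset.sum_congr rfl fun p _ => ?_)
  rw [constLam, MvPowerSeries.coeff_map]
  exact HahnSeries.coeff_single_zero_mul ..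

theorem _root_.HahnSeries.coeff_mul_of_bounded {x y : Lau} {M N : ℤ}
    (hx : ∀ k < M, x.coeff k = 0) (hy : ∀ k < N, y.coeff k = 0) (k : ℤ) :
    (x * y).coeff k = ∑ i ∈ Finset.Icc M (k - N), x.coeff i * y.coeff (k - i) := by
  rw [HahnSeries.coeff_mul]
  refine Finset.sum_of_injOn Prod.fst ?_ ?_ ?_ ?_
  · rintro ⟨i, j⟩ hi ⟨i', j'⟩ hi' h
    simp only [Finset.mem_coe, Finset.mem_antidiagonal, HahnSeries.mem_support] at hi hi' h
    simp only [Prod.mk.injEq]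
    omega
  · rintro ⟨i, j⟩ h
    simp only [Finset.mem_coe, Finset.mem_antidiagonal, HahnSeries.mem_support] at h
    have h1 : M ≤ i := not_lt.mp fun hc => h.1 (hx i hc)
    have h2 : N ≤ j := not_lt.mp fun hc => h.2.1 (hy j hc)
    simp only [Finset.coe_Icc, Set.mem_Icc]
    omega
  · intro i _ hi
    by_contra hc
    refine hi ⟨(i, k - i), ?_, rfl⟩
    simp only [Finset.mem_coe, Finset.mem_antidiagonal, HahnSeries.mem_support]
    exact ⟨left_ne_zero_of_mul hc, right_ne_zero_of_mul hc, by ring⟩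
  · rintro ⟨i, j⟩ h
    simp only [Finset.mem_antidiagonal] at h
    rw [← h.2.2, add_sub_cancel_left]

theorem lamCoeff_mul_of_bounded {F G : MvPowerSeries σ Lau} {M N : ℤ}
    (hF : ∀ k < M, lamCoeff k F = 0) (hG : ∀ k < N, lamCoeff k G = 0) (k : ℤ) :
    lamCoeff k (F * G) = ∑ i ∈ Finset.Icc M (k - N), lamCoeff i F * lamCoeff (k - i) G := by
  classical
  ext d
  rw [coeff_lamCoeff, MvPowerSeries.coeff_mul, map_sum]
  simp only [MvPowerSeries.coeff_mul]
  rw [Finset.sum_comm]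
  refine (map_sum (HahnSeries.coeff.addMonoidHom k : Lau →+ ℂ)
    (fun p : (σ →₀ ℕ) × (σ →₀ ℕ) => MvPowerSeries.coeff p.1 F *
    MvPowerSeries.coeff p.2 G) (Finset.HasAntidiagonal.antidiagonal d)).trans
    (Finset.sum_congr rfl fun p _ => ?_)
  refine HahnSeries.coeff_mul_of_bounded (fun i hi => ?_) (fun i hi => ?_) k
  · rw [← coeff_lamCoeff, hF i hi, map_zero]
  · rw [← coeff_lamCoeff, hG i hi, map_zero]

end LamCoeff

end Bogoyavlensky

end

noncomputable section

namespace Bogoyavlensky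

/-! ### Symbols of pseudo-differential operators -/

theorem lamCoeff_symbol (s : ℤˣ) (A : PsDO) (k : ℤ) :
    lamCoeff k (symbol s A) = ((s ^ k : ℤˣ) : ℤ) • A.coeff (-k) := rfl

theorem lamCoeff_symbol_one (A : PsDO) (k : ℤ) :
    lamCoeff k (symbol 1 A) = A.coeff (-k) := by
  rw [lamCoeff_symbol, one_zpow, Units.val_one, one_smul]

theorem symbol_add (s : ℤˣ) (A B : PsDO) : symbol s (A + B) = symbol s A + symbol s B :=
  lamCoeff_ext fun k => by
    rw [map_add, lamCoeff_symbol, lamCoeff_symbol, lamCoeff_symbol, PsDO.coeff_add, smul_add]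

/-- The symbol as an additive map. -/
def symbolHom (s : ℤˣ) : PsDO →+ MvPowerSeries TimeVar Lau :=
  AddMonoidHom.mk' (symbol s) (symbol_add s)

theorem pderiv_symbol (s : ℤˣ) (v : TimeVar) (A : PsDO) :
    MvPowerSeries.pderiv Lau v (symbol s A) = symbol s (A.pdiff v) :=
  lamCoeff_ext fun k => by
    rw [lamCoeff_pderiv, lamCoeff_symbol, lamCoeff_symbol, map_zsmul]
    rfl

theorem lam_mul_symbol_one (n : ℤ) (A : PsDO) :
    MvPowerSeries.C (lam n) * symbol 1 A = symbol 1 (A * PsDO.dxPow n) :=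
  lamCoeff_ext fun k => by
    rw [lamCoeff_lam_mul, lamCoeff_symbol_one, lamCoeff_symbol_one, PsDO.coeff_mul_dxPow, neg_add,
      sub_eq_add_neg]

theorem constLam_mul_symbol (s : ℤˣ) (f : Fn) (A : PsDO) :
    constLam f * symbol s A = symbol s (PsDO.mono f 0 * A) :=
  lamCoeff_ext fun k => by
    rw [lamCoeff_constLam_mul, lamCoeff_symbol, lamCoeff_symbol, PsDO.coeff_mono_zero_mul,
      mul_smul_comm]

theorem lamCoeff_symbol_eq_zero (s : ℤˣ) {A : PsDO} {M : ℤ} (hM : ∀ n, M < n → A.coeff n = 0)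
    (k : ℤ) (hk : k < -M) : lamCoeff k (symbol s A) = 0 := by
  rw [lamCoeff_symbol, hM _ (by omega), smul_zero]

theorem PsDO.dxPow_coeff (m n : ℤ) : (PsDO.dxPow m).coeff n = if n = m then 1 else 0 := rfl

theorem residue_symbol_mul_mono (a b : Fn) (m n : ℤ) :
    residue (symbol 1 (PsDO.mono a m) * symbol (-1) (PsDO.mono b n)) =
      (PsDO.mono a m * (PsDO.mono b n).adjoint).coeff (-1) := by
  rw [residue_eq_lamCoeff, lamCoeff_mul_of_bounded
    (lamCoeff_symbol_eq_zero 1 (PsDO.mono_bound a m))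
    (lamCoeff_symbol_eq_zero (-1) (PsDO.mono_bound b n)), PsDO.adjoint_mono, PsDO.mono_eq a m,
    mul_smul_comm, PsDO.coeff_zsmul, mul_assoc, ← mul_assoc (PsDO.dxPow m),
    PsDO.dxPow_mul_dxPow, PsDO.coeff_mono_zero_mul]
  simp only [lamCoeff_symbol, PsDO.coeff_mono_zero_mul, PsDO.dxPow_coeff, PsDO.mono_coeff]
  have hs : ∀ j : ℤ, (((-1 : ℤˣ) ^ j : ℤˣ) : ℤ) = (Int.negOnePow j : ℤ) := fun j => rfl
  by_cases h : m + n = -1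
  · rw [Finset.sum_eq_single (-m)]
    · have := PsDO.coeff_dxPow_mul_mono_zero (m + n) b 0
      rw [Nat.cast_zero, sub_zero, Ring.choose_zero_right, one_smul, h] at this
      rw [h, this]
      have h1 : -(1 - -m) = n := by omega
      have h2 : (1 - -m) = -n := by omega
      rw [hs, h1, h2, Int.negOnePow_neg, one_zpow, neg_neg, if_pos rfl, if_pos rfl, mul_one,
        Units.val_one, one_smul, mul_smul_comm, Function.iterate_zero_apply]
    · intro i _ hi
      rw [if_neg (by omega), mul_zero, smul_zero, zero_mul]
    · intro hc
      exact absurd hc (by simp only [Finset.mem_Icc, not_not]; omega)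
  · have h0 : (PsDO.dxPow (m + n) * PsDO.mono b 0).coeff (-1) = 0 := by
      by_cases hmn : m + n < -1
      · exact PsDO.dxPow_mul_mono_zero_bound _ _ _ hmn
      · obtain ⟨r, hr⟩ := Int.eq_ofNat_of_zero_le (show 0 ≤ m + n by omega)
        have := PsDO.coeff_dxPow_mul_mono_zero (m + n) b (r + 1)
        rw [hr, Ring.choose_natCast, Nat.choose_succ_self, Nat.cast_zero, zero_smul] at this
        rw [hr, ← this]
        congr 1
        push_cast
        ring
    rw [h0, mul_zero, smul_zero]
    refine Finset.sum_eq_zero fun i _ => ?_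
    by_cases hi : -i = m
    · rw [if_neg (show ¬ -(1 - i) = n by omega), smul_zero, mul_zero]
    · rw [if_neg hi, mul_zero, smul_zero, zero_mul]

/-- The residue with respect to `λ` as a residue of a pseudo-differential operator. -/
theorem residue_symbol_mul (A B : PsDO) :
    residue (symbol 1 A * symbol (-1) B) = (A * B.adjoint).coeff (-1) := by
  obtain ⟨a, ha⟩ := A.bounded
  obtain ⟨b, hb⟩ := B.bounded
  refine PsDO.hom_ext_mono
    ((lamCoeff 1).comp ((AddMonoidHom.mulRight (symbol (-1) B)).comp (symbolHom 1)))
    ((PsDO.coeffHom (-1)).comp (AddMonoidHom.mulRight B.adjoint))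
    ⟨-2 - b, fun A hA => ?_⟩
    ⟨-2 - b, fun A hA => PsDO.coeff_mul_eq_zero hA (PsDO.coeff_adjoint_eq_zero hb) _ (by omega)⟩
    (fun f m => ?_) A
  · refine (lamCoeff_mul_of_bounded (lamCoeff_symbol_eq_zero 1 hA)
      (lamCoeff_symbol_eq_zero (-1) hb) 1).trans ?_
    rw [Finset.Icc_eq_empty (by omega), Finset.sum_empty]
  refine PsDO.hom_ext_mono
    ((lamCoeff 1).comp ((AddMonoidHom.mulLeft (symbol 1 (PsDO.mono f m))).comp (symbolHom (-1))))
    ((PsDO.coeffHom (-1)).comp ((AddMonoidHom.mulLeft (PsDO.mono f m)).comp PsDO.adjointHom))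
    ⟨-2 - m, fun B hB => ?_⟩
    ⟨-2 - m, fun B hB => PsDO.coeff_mul_eq_zero (PsDO.mono_bound f m)
      (PsDO.coeff_adjoint_eq_zero hB) _ (by omega)⟩
    (fun g n => residue_symbol_mul_mono f g m n) B
  refine (lamCoeff_mul_of_bounded (lamCoeff_symbol_eq_zero 1 (PsDO.mono_bound f m))
    (lamCoeff_symbol_eq_zero (-1) hB) 1).trans ?_
  rw [Finset.Icc_eq_empty (by omega), Finset.sum_empty]

/-! ### Baker-Akhiezer functions -/

theorem timeVar_x_injective : Function.Injective TimeVar.x := fun _ _ h => TimeVar.x.inj h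

theorem constantCoeff_xi : MvPowerSeries.constantCoeff xi = 0 := coeff_linForm_zero _ _

theorem constantCoeff_neg_xi : MvPowerSeries.constantCoeff (-xi) = 0 := by
  rw [map_neg, constantCoeff_xi, neg_zero]

theorem fexp_xi_mul_fexp_neg_xi : fexp xi * fexp (-xi) = 1 := fexp_mul_fexp_neg constantCoeff_xi

theorem pderiv_x_xi (n : ℕ+) :
    MvPowerSeries.pderiv Lau (TimeVar.x n) xi = MvPowerSeries.C (lam n) :=
  pderiv_linForm_self timeVar_x_injective _ n

theorem pderiv_y_xi (k : ℕ) : MvPowerSeries.pderiv Lau (TimeVar.y k) xi = 0 :=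
  pderiv_linForm_of_ne _ fun _ h => TimeVar.noConfusion h

theorem onExp_one (A : PsDO) : onExp 1 A = symbol 1 A * fexp xi := by
  rw [onExp, Units.val_one, one_smul]

theorem onExp_neg_one (A : PsDO) : onExp (-1) A = symbol (-1) A * fexp (-xi) := by
  rw [onExp, Units.val_neg, Units.val_one, neg_smul, one_smul]

theorem onExp_add (s : ℤˣ) (A B : PsDO) : onExp s (A + B) = onExp s A + onExp s B := by
  rw [onExp, onExp, onExp, symbol_add, add_mul]

theorem onExp_sub (s : ℤˣ) (A B : PsDO) : onExp s (A - B) = onExp s A - onExp s B := by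
  rw [eq_sub_iff_add_eq, ← onExp_add, sub_add_cancel]

theorem lam_mul_onExp (n : ℤ) (A : PsDO) :
    MvPowerSeries.C (lam n) * onExp 1 A = onExp 1 (A * PsDO.dxPow n) := by
  rw [onExp, onExp, ← mul_assoc, lam_mul_symbol_one]

theorem constLam_mul_onExp (s : ℤˣ) (f : Fn) (A : PsDO) :
    constLam f * onExp s A = onExp s (PsDO.mono f 0 * A) := by
  rw [onExp, onExp, ← mul_assoc, constLam_mul_symbol]

theorem pderiv_x_onExp (n : ℕ+) (A : PsDO) :
    MvPowerSeries.pderiv Lau (TimeVar.x n) (onExp 1 A) =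
      onExp 1 (A.pdiff (TimeVar.x n) + A * PsDO.dxPow n) := by
  rw [onExp_add, ← lam_mul_onExp, onExp_one, onExp_one, Derivation.leibniz, pderiv_symbol,
    pderiv_fexp constantCoeff_xi, pderiv_x_xi, smul_eq_mul, smul_eq_mul]
  ring

theorem pderiv_y_onExp (k : ℕ) (A : PsDO) :
    MvPowerSeries.pderiv Lau (TimeVar.y k) (onExp 1 A) = onExp 1 (A.pdiff (TimeVar.y k)) := by
  rw [onExp_one, onExp_one, Derivation.leibniz, pderiv_symbol,
    pderiv_fexp constantCoeff_xi, pderiv_y_xi, smul_eq_mul, smul_eq_mul]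
  ring

theorem residue_onExp_mul (A B : PsDO) :
    residue (onExp 1 A * onExp (-1) B) = (A * B.adjoint).coeff (-1) := by
  rw [← residue_symbol_mul, onExp_one, onExp_neg_one, mul_mul_mul_comm, fexp_xi_mul_fexp_neg_xi,
    mul_one]

/-- The derivation `∂/∂y_{nℓ} - λ^{nℓ} ∂/∂y`. -/
def deltaY (ℓ : ℕ) (n : ℕ+) :
    Derivation Lau (MvPowerSeries TimeVar Lau) (MvPowerSeries TimeVar Lau) :=
  MvPowerSeries.pderiv Lau (TimeVar.y n) -
    (MvPowerSeries.C (lam ((n : ℕ) * ℓ : ℕ)) : MvPowerSeries TimeVar Lau) •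
      MvPowerSeries.pderiv Lau (TimeVar.y 0)

theorem deltaY_apply (ℓ : ℕ) (n : ℕ+) (F : MvPowerSeries TimeVar Lau) :
    deltaY ℓ n F = MvPowerSeries.pderiv Lau (TimeVar.y n) F -
      MvPowerSeries.C (lam ((n : ℕ) * ℓ : ℕ)) * MvPowerSeries.pderiv Lau (TimeVar.y 0) F := rfl

/-- The orbit of `Ψ = W e^ξ` under differential operators in `x`. -/
def waveSet (W : PsDO) : Set (MvPowerSeries TimeVar Lau) :=
  {P | ∃ C : PsDO, C.IsDiff ∧ P = onExp 1 (C * W)}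

/-- The annihilator of `waveSet` under the residue pairing. -/
def dualWaveSet (W : PsDO) : Set (MvPowerSeries TimeVar Lau) :=
  {Q | ∀ P ∈ waveSet W, residue (P * Q) = 0}

section WaveSet

variable {ℓ : ℕ} {W : PsDO}

theorem bakerAkhiezer_mem_waveSet (W : PsDO) : bakerAkhiezer W ∈ waveSet W :=
  ⟨1, PsDO.isDiff_one, by rw [one_mul]; rfl⟩

theorem constLam_mul_mem_waveSet (f : Fn) {P : MvPowerSeries TimeVar Lau} (hP : P ∈ waveSet W) :
    constLam f * P ∈ waveSet W := by
  obtain ⟨C, hC, rfl⟩ := hP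
  exact ⟨PsDO.mono f 0 * C, (PsDO.isDiff_mono f le_rfl).mul hC, by
    rw [constLam_mul_onExp, mul_assoc]⟩

theorem lam_mul_mem_waveSet (hW : IsSolution ℓ W) (n : ℕ) {P : MvPowerSeries TimeVar Lau}
    (hP : P ∈ waveSet W) : MvPowerSeries.C (lam (n * ℓ : ℕ)) * P ∈ waveSet W := by
  obtain ⟨C, hC, rfl⟩ := hP
  exact ⟨C * (W * PsDO.dxPow (n * ℓ : ℕ) * W.inv), hC.mul (PsDO.isDiff_conj_dxPow hW n), by
    rw [lam_mul_onExp, mul_assoc C _ W, PsDO.conj_mul hW, mul_assoc]⟩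

theorem pderiv_x_mem_waveSet (hW : IsSolution ℓ W) (n : ℕ+) {P : MvPowerSeries TimeVar Lau}
    (hP : P ∈ waveSet W) : MvPowerSeries.pderiv Lau (TimeVar.x n) P ∈ waveSet W := by
  obtain ⟨C, hC, rfl⟩ := hP
  obtain ⟨B, hB, hBW⟩ := PsDO.exists_flow_x hW n
  refine ⟨C.pdiff (TimeVar.x n) + C * B, (hC.pdiff _).add (hC.mul hB), ?_⟩
  rw [pderiv_x_onExp, PsDO.pdiff_mul, add_mul, mul_assoc C B, ← hBW, mul_add, add_assoc,
    mul_assoc C W]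

theorem deltaY_mem_waveSet (hW : IsSolution ℓ W) (n : ℕ+) {P : MvPowerSeries TimeVar Lau}
    (hP : P ∈ waveSet W) : deltaY ℓ n P ∈ waveSet W := by
  obtain ⟨C, hC, rfl⟩ := hP
  obtain ⟨B, hB, hBW⟩ := PsDO.exists_flow_y hW n
  refine ⟨C.pdiff (TimeVar.y n) - C.pdiff (TimeVar.y 0) * (W * PsDO.dxPow ((n : ℕ) * ℓ : ℕ) * W.inv)
    + C * B, ?_, ?_⟩
  · rw [sub_eq_add_neg]
    exact ((hC.pdiff _).add ((hC.pdiff _).mul (PsDO.isDiff_conj_dxPow hW n)).neg).add (hC.mul hB)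
  · rw [deltaY_apply, pderiv_y_onExp, pderiv_y_onExp, lam_mul_onExp, ← onExp_sub, PsDO.pdiff_mul,
      PsDO.pdiff_mul, add_mul _ (C * B), sub_mul, mul_assoc C B, ← hBW, mul_assoc _ _ W, PsDO.conj_mul hW]
    congr 1
    noncomm_ring

theorem constLam_mul_mem_dualWaveSet (f : Fn) {Q : MvPowerSeries TimeVar Lau}
    (hQ : Q ∈ dualWaveSet W) : constLam f * Q ∈ dualWaveSet W := by
  intro P hP
  rw [mul_left_comm, ← mul_assoc]
  exact hQ _ (constLam_mul_mem_waveSet f hP)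

theorem residue_add {σ : Type} (F G : MvPowerSeries σ Lau) :
    residue (F + G) = residue F + residue G := map_add (lamCoeff 1) F G

theorem residue_sub {σ : Type} (F G : MvPowerSeries σ Lau) :
    residue (F - G) = residue F - residue G := map_sub (lamCoeff 1) F G

theorem residue_pderiv {σ : Type} (v : σ) (F : MvPowerSeries σ Lau) :
    residue (MvPowerSeries.pderiv Lau v F) = MvPowerSeries.pderiv ℂ v (residue F) :=
  lamCoeff_pderiv 1 v F

theorem pderiv_x_mem_dualWaveSet (hW : IsSolution ℓ W) (n : ℕ+) {Q : MvPowerSeries TimeVar Lau}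
    (hQ : Q ∈ dualWaveSet W) : MvPowerSeries.pderiv Lau (TimeVar.x n) Q ∈ dualWaveSet W := by
  intro P hP
  have h1 := residue_pderiv (TimeVar.x n) (P * Q)
  rwa [hQ P hP, map_zero, Derivation.leibniz, residue_add, smul_eq_mul, smul_eq_mul, mul_comm Q,
    hQ _ (pderiv_x_mem_waveSet hW n hP), add_zero] at h1

theorem deltaY_mem_dualWaveSet (hW : IsSolution ℓ W) (n : ℕ+) {Q : MvPowerSeries TimeVar Lau}
    (hQ : Q ∈ dualWaveSet W) : deltaY ℓ n Q ∈ dualWaveSet W := by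
  intro P hP
  have h1 : residue (deltaY ℓ n (P * Q)) = 0 := by
    have h2 : MvPowerSeries.C (lam ((n : ℕ) * ℓ : ℕ)) *
        MvPowerSeries.pderiv Lau (TimeVar.y 0) (P * Q) = MvPowerSeries.pderiv Lau (TimeVar.y 0)
          (MvPowerSeries.C (lam ((n : ℕ) * ℓ : ℕ)) * P * Q) := by
      rw [mul_assoc, Derivation.leibniz _ (MvPowerSeries.C _), MvPowerSeries.pderiv_C, smul_zero,
        add_zero, smul_eq_mul]
    rw [deltaY_apply, h2, residue_sub, residue_pderiv, residue_pderiv, hQ P hP,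
      hQ _ (lam_mul_mem_waveSet hW n hP), map_zero, map_zero, sub_zero]
  rwa [Derivation.leibniz, residue_add, smul_eq_mul, smul_eq_mul, mul_comm Q,
    hQ _ (deltaY_mem_waveSet hW n hP), add_zero] at h1

theorem dualBakerAkhiezer_mem_dualWaveSet (hW : W.IsWilsonSato) :
    dualBakerAkhiezer W ∈ dualWaveSet W := by
  rintro P ⟨C, hC, rfl⟩
  rw [dualBakerAkhiezer, residue_onExp_mul, PsDO.adjoint_inv_adjoint hW, mul_assoc,
    PsDO.mul_inv_of_isWilsonSato hW, mul_one]
  exact hC _ (by norm_num)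

end WaveSet

end Bogoyavlensky

end

noncomputable section

namespace Bogoyavlensky

/-! ### The bilinear identity -/

theorem _root_.Finsupp.induction_add_single {σ : Type*} {p : (σ →₀ ℕ) → Prop} (h0 : p 0)
    (h : ∀ d w, p d → p (d + Finsupp.single w 1)) (d : σ →₀ ℕ) : p d := by
  induction d using Finsupp.induction with
  | zero => exact h0
  | single_add a n f _ _ hf =>
    rw [add_comm]
    clear * - h hf
    induction n with
    | zero => simpa using hf
    | succ n ih =>
      rw [Finsupp.single_add, ← add_assoc]
      exact h _ _ ih

theorem coeff_add_single_of_pderiv {σ R : Type*} [CommRing R] [Algebra ℂ R]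
    {F : MvPowerSeries σ R} {d : σ →₀ ℕ} {w : σ}
    (h : MvPowerSeries.coeff d (MvPowerSeries.pderiv R w F) = 0) :
    MvPowerSeries.coeff (d + Finsupp.single w 1) F = 0 := by
  have := isAddTorsionFree_of_complex R
  rw [MvPowerSeries.coeff_pderiv, ← Nat.cast_succ, mul_comm, ← nsmul_eq_mul] at h
  exact (smul_eq_zero_iff_right (Nat.succ_ne_zero _)).mp h

/-- The variables `u`, `v` may be used for the arguments `(u, y - η(v, λ), y̌ + v)`. -/
structure IsShiftPair (u v : ℕ+ → BilVar) : Prop where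
  inj_left : Function.Injective u
  inj_right : Function.Injective v
  ne : ∀ m n, u m ≠ v n
  left_ne_y : ∀ n k, u n ≠ BilVar.y k
  right_ne_y : ∀ n k, v n ≠ BilVar.y k

section Shift

variable (ℓ : ℕ) {u v : ℕ+ → BilVar} (h : IsShiftPair u v)
include h

theorem constantCoeff_subst_shiftArgs (P : MvPowerSeries TimeVar Lau) :
    MvPowerSeries.constantCoeff (MvPowerSeries.subst (shiftArgs ℓ u v) P) =
      MvPowerSeries.constantCoeff P := by
  have ha := hasSubst_shiftArgs ℓ h.inj_left h.inj_right
  rw [MvPowerSeries.constantCoeff_subst ha, finsum_eq_single _ 0]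
  · simp
  · intro d hd
    obtain ⟨t, ht⟩ := Finsupp.ne_iff.mp hd
    rw [Finsupp.prod, map_prod, Finset.prod_eq_zero (Finsupp.mem_support_iff.mpr ht), smul_zero]
    rw [map_pow]
    have h0 : MvPowerSeries.constantCoeff (shiftArgs ℓ u v t) = 0 := by
      rcases t with n | (_ | k) <;> simp [shiftArgs, eta, coeff_linForm_zero]
    rw [h0, zero_pow ht]

theorem pderiv_left_subst (n : ℕ+) (P : MvPowerSeries TimeVar Lau) :
    MvPowerSeries.pderiv Lau (u n) (MvPowerSeries.subst (shiftArgs ℓ u v) P) =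
      MvPowerSeries.subst (shiftArgs ℓ u v) (MvPowerSeries.pderiv Lau (TimeVar.x n) P) := by
  rw [MvPowerSeries.pderiv_subst (hasSubst_shiftArgs ℓ h.inj_left h.inj_right) _ {TimeVar.x n},
    Finset.sum_singleton, shiftArgs, MvPowerSeries.pderiv_X_self, mul_one]
  rintro (m | (_ | k)) hm
  · exact MvPowerSeries.pderiv_X_of_ne fun hc => hm (by rw [h.inj_left hc]; simp)
  · rw [shiftArgs, map_sub, MvPowerSeries.pderiv_X_of_ne (h.left_ne_y _ _).symm, eta,
      pderiv_linForm_of_ne _ fun m => (h.ne n m).symm, sub_zero]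
  · rw [shiftArgs, map_add, MvPowerSeries.pderiv_X_of_ne (h.left_ne_y _ _).symm,
      MvPowerSeries.pderiv_X_of_ne (h.ne _ _).symm, add_zero]

theorem pderiv_right_subst (n : ℕ+) (P : MvPowerSeries TimeVar Lau) :
    MvPowerSeries.pderiv Lau (v n) (MvPowerSeries.subst (shiftArgs ℓ u v) P) =
      MvPowerSeries.subst (shiftArgs ℓ u v) (deltaY ℓ n P) := by
  classical
  have ha := hasSubst_shiftArgs ℓ h.inj_left h.inj_right
  obtain ⟨k, rfl⟩ : ∃ k : ℕ, n = k.succPNat := ⟨n.natPred, (PNat.succPNat_natPred n).symm⟩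
  rw [MvPowerSeries.pderiv_subst ha _ {TimeVar.y 0, TimeVar.y (k + 1)}, Finset.sum_pair (by simp),
    deltaY_apply, MvPowerSeries.subst_sub ha, MvPowerSeries.subst_mul ha]
  · have hC : MvPowerSeries.subst (shiftArgs ℓ u v)
        (MvPowerSeries.C (lam ((k.succPNat : ℕ) * ℓ : ℕ)) : MvPowerSeries TimeVar Lau) =
        MvPowerSeries.C (lam ((k.succPNat : ℕ) * ℓ : ℕ)) := MvPowerSeries.subst_C _
    rw [hC, shiftArgs, shiftArgs, map_sub, map_add, MvPowerSeries.pderiv_X_self, eta,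
      pderiv_linForm_self h.inj_right, MvPowerSeries.pderiv_X_of_ne (h.right_ne_y _ _).symm,
      MvPowerSeries.pderiv_X_of_ne (h.right_ne_y _ _).symm, Nat.succPNat_coe]
    ring
  · rintro (m | (_ | j)) hm
    · exact MvPowerSeries.pderiv_X_of_ne (h.ne _ _)
    · simp at hm
    · rw [shiftArgs, map_add, MvPowerSeries.pderiv_X_of_ne (h.right_ne_y _ _).symm,
        MvPowerSeries.pderiv_X_of_ne, add_zero]
      intro hc
      have := Nat.succPNat_injective (h.inj_right hc)
      simp [this] at hm

theorem pderiv_y_subst (k : ℕ) (P : MvPowerSeries TimeVar Lau) :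
    MvPowerSeries.pderiv Lau (BilVar.y k) (MvPowerSeries.subst (shiftArgs ℓ u v) P) =
      MvPowerSeries.subst (shiftArgs ℓ u v) (MvPowerSeries.pderiv Lau (TimeVar.y k) P) := by
  have hy : ∀ i j, i ≠ j → BilVar.y i ≠ BilVar.y j := fun i j hij hc => hij (BilVar.y.inj hc)
  rw [MvPowerSeries.pderiv_subst (hasSubst_shiftArgs ℓ h.inj_left h.inj_right) _ {TimeVar.y k},
    Finset.sum_singleton]
  · rcases k with _ | k
    · rw [shiftArgs, map_sub, MvPowerSeries.pderiv_X_self, eta,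
        pderiv_linForm_of_ne _ fun m => h.right_ne_y m _, sub_zero, mul_one]
    · rw [shiftArgs, map_add, MvPowerSeries.pderiv_X_self,
        MvPowerSeries.pderiv_X_of_ne (h.right_ne_y _ _), add_zero, mul_one]
  · rintro (m | (_ | j)) hm
    · exact MvPowerSeries.pderiv_X_of_ne (h.left_ne_y _ _)
    · rw [shiftArgs, map_sub, MvPowerSeries.pderiv_X_of_ne (hy _ _ (by rintro rfl; simp at hm)),
        eta, pderiv_linForm_of_ne _ fun m => h.right_ne_y m _, sub_zero]
    · rw [shiftArgs, map_add, MvPowerSeries.pderiv_X_of_ne (hy _ _ (by rintro rfl; simp at hm)),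
        MvPowerSeries.pderiv_X_of_ne (h.right_ne_y _ _), add_zero]

theorem pderiv_subst_of_ne {w : BilVar} (hu : ∀ n, u n ≠ w) (hv : ∀ n, v n ≠ w)
    (hy : ∀ k, BilVar.y k ≠ w) (P : MvPowerSeries TimeVar Lau) :
    MvPowerSeries.pderiv Lau w (MvPowerSeries.subst (shiftArgs ℓ u v) P) = 0 := by
  rw [MvPowerSeries.pderiv_subst (hasSubst_shiftArgs ℓ h.inj_left h.inj_right) _ ∅,
    Finset.sum_empty]
  rintro (m | (_ | j)) -
  · exact MvPowerSeries.pderiv_X_of_ne (hu _)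
  · rw [shiftArgs, map_sub, MvPowerSeries.pderiv_X_of_ne (hy _), eta,
      pderiv_linForm_of_ne _ hv, sub_zero]
  · rw [shiftArgs, map_add, MvPowerSeries.pderiv_X_of_ne (hy _),
      MvPowerSeries.pderiv_X_of_ne (hv _), add_zero]

end Shift

theorem isShiftPair_x'_b : IsShiftPair BilVar.x' BilVar.b := by
  constructor <;> intros <;> simp_all [Function.Injective]

theorem isShiftPair_x_c : IsShiftPair BilVar.x BilVar.c := by
  constructor <;> intros <;> simp_all [Function.Injective]

/-- On exponents involving only `y_{kℓ}`, the substitutions act trivially. -/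
theorem coeff_subst_mul_subst_y (ℓ : ℕ) {u v u' v' : ℕ+ → BilVar} (h : IsShiftPair u v)
    (h' : IsShiftPair u' v') (e : ℕ →₀ ℕ) (P Q : MvPowerSeries TimeVar Lau) :
    MvPowerSeries.coeff (e.mapDomain BilVar.y) (MvPowerSeries.subst (shiftArgs ℓ u v) P *
      MvPowerSeries.subst (shiftArgs ℓ u' v') Q) =
    MvPowerSeries.coeff (e.mapDomain TimeVar.y) (P * Q) := by
  have := isAddTorsionFree_of_complex Lau
  induction e using Finsupp.induction_add_single generalizing P Q with
  | h0 =>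
    rw [Finsupp.mapDomain_zero, Finsupp.mapDomain_zero, MvPowerSeries.coeff_zero_eq_constantCoeff,
      MvPowerSeries.coeff_zero_eq_constantCoeff, map_mul, map_mul,
      constantCoeff_subst_shiftArgs ℓ h, constantCoeff_subst_shiftArgs ℓ h']
  | h e k ih =>
    have h1 := congrArg (MvPowerSeries.coeff (e.mapDomain BilVar.y))
      (Derivation.leibniz (MvPowerSeries.pderiv Lau (BilVar.y k))
        (MvPowerSeries.subst (shiftArgs ℓ u v) P) (MvPowerSeries.subst (shiftArgs ℓ u' v') Q))
    have h2 := congrArg (MvPowerSeries.coeff (e.mapDomain TimeVar.y))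
      (Derivation.leibniz (MvPowerSeries.pderiv Lau (TimeVar.y k)) P Q)
    rw [smul_eq_mul, smul_eq_mul] at h2
    rw [pderiv_y_subst ℓ h, pderiv_y_subst ℓ h', smul_eq_mul, smul_eq_mul, map_add, ih,
      mul_comm (MvPowerSeries.subst (shiftArgs ℓ u' v') Q)
        (MvPowerSeries.subst _ (MvPowerSeries.pderiv _ _ _)), ih,
      mul_comm (MvPowerSeries.pderiv _ _ P) Q, ← map_add,
      ← h2, MvPowerSeries.coeff_pderiv, MvPowerSeries.coeff_pderiv,
      Finsupp.mapDomain_apply (fun _ _ hij => BilVar.y.inj hij),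
      Finsupp.mapDomain_apply (fun _ _ hij => TimeVar.y.inj hij), ← Nat.cast_succ,
      mul_comm _ (((e k).succ : ℕ) : Lau), mul_comm _ (((e k).succ : ℕ) : Lau),
      ← nsmul_eq_mul, ← nsmul_eq_mul] at h1
    rw [Finsupp.mapDomain_add, Finsupp.mapDomain_single, Finsupp.mapDomain_add,
      Finsupp.mapDomain_single]
    exact nsmul_right_injective (Nat.succ_ne_zero _) h1

/-- The bilinear identity for the orbits of the Baker-Akhiezer functions. -/
theorem residue_subst_mul_subst {ℓ : ℕ} {W : PsDO} (hW : IsSolution ℓ W)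
    {P Q : MvPowerSeries TimeVar Lau} (hP : P ∈ waveSet W) (hQ : Q ∈ dualWaveSet W) :
    residue (MvPowerSeries.subst (shiftArgs ℓ BilVar.x' BilVar.b) P *
      MvPowerSeries.subst (shiftArgs ℓ BilVar.x BilVar.c) Q) = 0 := by
  suffices H : ∀ d : BilVar →₀ ℕ, ∀ e : ℕ →₀ ℕ, ∀ P ∈ waveSet W, ∀ Q ∈ dualWaveSet W,
      MvPowerSeries.coeff (d + e.mapDomain BilVar.y)
        (residue (MvPowerSeries.subst (shiftArgs ℓ BilVar.x' BilVar.b) P *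
          MvPowerSeries.subst (shiftArgs ℓ BilVar.x BilVar.c) Q)) = 0 by
    ext d
    simpa using H d 0 P hP Q hQ
  clear hP hQ P Q
  intro d
  induction d using Finsupp.induction_add_single with
  | h0 =>
    intro e P hP Q hQ
    rw [zero_add, residue_eq_lamCoeff, coeff_lamCoeff,
      coeff_subst_mul_subst_y ℓ isShiftPair_x'_b isShiftPair_x_c, ← coeff_lamCoeff,
      ← residue_eq_lamCoeff, hQ P hP, map_zero]
  | h d w ih =>
    intro e P hP Q hQ
    rcases w with n | n | k | n | n
    all_goals rw [add_right_comm]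
    · refine coeff_add_single_of_pderiv ?_
      rw [← residue_pderiv, Derivation.leibniz, pderiv_left_subst ℓ isShiftPair_x'_b,
        pderiv_subst_of_ne ℓ isShiftPair_x_c (by simp) (by simp) (by simp), smul_zero, zero_add,
        smul_eq_mul, mul_comm]
      exact ih e _ (pderiv_x_mem_waveSet hW n hP) _ hQ
    · refine coeff_add_single_of_pderiv ?_
      rw [← residue_pderiv, Derivation.leibniz, pderiv_left_subst ℓ isShiftPair_x_c,
        pderiv_subst_of_ne ℓ isShiftPair_x'_b (by simp) (by simp) (by simp), smul_zero, add_zero,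
        smul_eq_mul]
      exact ih e _ hP _ (pderiv_x_mem_dualWaveSet hW n hQ)
    · rw [add_assoc, ← Finsupp.mapDomain_single, ← Finsupp.mapDomain_add]
      exact ih _ P hP Q hQ
    · refine coeff_add_single_of_pderiv ?_
      rw [← residue_pderiv, Derivation.leibniz, pderiv_right_subst ℓ isShiftPair_x'_b,
        pderiv_subst_of_ne ℓ isShiftPair_x_c (by simp) (by simp) (by simp), smul_zero, zero_add,
        smul_eq_mul, mul_comm]
      exact ih e _ (deltaY_mem_waveSet hW n hP) _ hQ
    · refine coeff_add_single_of_pderiv ?_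
      rw [← residue_pderiv, Derivation.leibniz, pderiv_right_subst ℓ isShiftPair_x_c,
        pderiv_subst_of_ne ℓ isShiftPair_x'_b (by simp) (by simp) (by simp), smul_zero, add_zero,
        smul_eq_mul]
      exact ih e _ hP _ (deltaY_mem_dualWaveSet hW n hQ)

end Bogoyavlensky

end

noncomputable section

namespace Bogoyavlensky

/-! ### Elementary Schur polynomials -/

section Schur

theorem _root_.PowerSeries.eq_of_derivative_eq_mul {A : Type*} [CommRing A] [IsAddTorsionFree A]
    {F G g : PowerSeries A} (hF : PowerSeries.derivative A F = F * g)
    (hG : PowerSeries.derivative A G = G * g)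
    (h0 : PowerSeries.coeff 0 F = PowerSeries.coeff 0 G) : F = G := by
  ext n
  induction n using Nat.strong_induction_on with
  | _ n ih =>
    rcases n with _ | n
    · exact h0
    have h1 : PowerSeries.coeff n (F * g) = PowerSeries.coeff n (G * g) := by
      rw [PowerSeries.coeff_mul, PowerSeries.coeff_mul]
      refine Finset.sum_congr rfl fun p hp => ?_
      have := Finset.HasAntidiagonal.mem_antidiagonal.mp hp
      rw [ih p.1 (by omega)]
    rw [← hF, ← hG, PowerSeries.coeff_derivative, PowerSeries.coeff_derivative, ← Nat.cast_succ,
      mul_comm, ← nsmul_eq_mul, mul_comm, ← nsmul_eq_mul] at h1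
    exact nsmul_right_injective (Nat.succ_ne_zero n) h1

variable {A : Type} [CommRing A] [Algebra ℂ A]

/-- `∑_n p_n(u) λ^n` -/
def schurSeries (u : ℕ+ → A) : PowerSeries A :=
  PowerSeries.mk fun n => MvPolynomial.aeval u (schur n)

/-- `∑_n (n + 1) u_{n+1} λ^n` -/
def schurLogDeriv (u : ℕ+ → A) : PowerSeries A :=
  PowerSeries.mk fun n => u n.succPNat * (n + 1)

theorem coeff_schurSeries (u : ℕ+ → A) (n : ℕ) :
    PowerSeries.coeff n (schurSeries u) = MvPolynomial.aeval u (schur n) :=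
  PowerSeries.coeff_mk _ _

theorem coeff_schurLogDeriv {A : Type} [CommRing A] (u : ℕ+ → A) (n : ℕ) :
    PowerSeries.coeff n (schurLogDeriv u) = u n.succPNat * (n + 1) :=
  PowerSeries.coeff_mk _ _

theorem schur_zero : schur 0 = 1 := by
  have h := constantCoeff_fexp (σ := Unit) (R := MvPolynomial ℕ+ ℂ)
    (f := PowerSeries.mk fun k => if h : 0 < k then MvPolynomial.X (⟨k, h⟩ : ℕ+) else 0)
    (by
      change PowerSeries.constantCoeff _ = 0
      rw [← PowerSeries.coeff_zero_eq_constantCoeff_apply, PowerSeries.coeff_mk, dif_neg (by simp)])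
  rw [schur, PowerSeries.coeff_zero_eq_constantCoeff_apply]
  exact h

theorem aeval_schur_zero (u : ℕ+ → A) : MvPolynomial.aeval u (schur 0) = 1 := by
  rw [schur_zero, map_one]

theorem schur_succ (n : ℕ) : schur (n + 1) * (n + 1) =
    ∑ p ∈ Finset.HasAntidiagonal.antidiagonal n,
      schur p.1 * (MvPolynomial.X p.2.succPNat * ((p.2 : MvPolynomial ℕ+ ℂ) + 1)) := by
  have h := pderiv_fexp (σ := Unit) (R := MvPolynomial ℕ+ ℂ)
    (f := PowerSeries.mk fun k => if h : 0 < k then MvPolynomial.X (⟨k, h⟩ : ℕ+) else 0)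
    (by
      change PowerSeries.constantCoeff _ = 0
      rw [← PowerSeries.coeff_zero_eq_constantCoeff_apply, PowerSeries.coeff_mk, dif_neg (by simp)])
    ()
  have h1 := (PowerSeries.coeff_derivative _ n).symm.trans (congrArg (PowerSeries.coeff n) h)
  refine h1.trans ((PowerSeries.coeff_mul n _ _).trans (Finset.sum_congr rfl fun p _ => ?_))
  refine congrArg (schur p.1 * ·) ((PowerSeries.coeff_derivative _ p.2).trans ?_)
  rw [PowerSeries.coeff_mk, dif_pos (Nat.succ_pos _)]
  rfl

theorem derivative_schurSeries (u : ℕ+ → A) :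
    PowerSeries.derivative A (schurSeries u) = schurSeries u * schurLogDeriv u := by
  ext n
  have h := congrArg (MvPolynomial.aeval u) (schur_succ n)
  simp only [map_mul, map_sum, map_add, map_natCast, map_one, MvPolynomial.aeval_X] at h
  simpa only [PowerSeries.coeff_derivative, PowerSeries.coeff_mul, coeff_schurSeries,
    coeff_schurLogDeriv] using h

theorem schurSeries_add (u v : ℕ+ → A) :
    schurSeries (fun n => u n + v n) = schurSeries u * schurSeries v := by
  have := isAddTorsionFree_of_complex A
  refine PowerSeries.eq_of_derivative_eq_mul (derivative_schurSeries _) ?_ ?_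
  · have h : schurLogDeriv (fun n => u n + v n) = schurLogDeriv u + schurLogDeriv v := by
      ext n
      rw [map_add, coeff_schurLogDeriv, coeff_schurLogDeriv, coeff_schurLogDeriv, add_mul]
    rw [Derivation.leibniz, derivative_schurSeries, derivative_schurSeries, h, smul_eq_mul,
      smul_eq_mul]
    ring
  · simp [PowerSeries.coeff_mul, coeff_schurSeries, schur_zero]

/-- Addition formula for the elementary Schur polynomials. -/
theorem aeval_add_schur (u v : ℕ+ → A) (n : ℕ) :
    MvPolynomial.aeval (fun n => u n + v n) (schur n) =
      ∑ p ∈ Finset.HasAntidiagonal.antidiagonal n,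
        MvPolynomial.aeval u (schur p.1) * MvPolynomial.aeval v (schur p.2) := by
  have h := congrArg (PowerSeries.coeff n) (schurSeries_add u v)
  simpa only [PowerSeries.coeff_mul, coeff_schurSeries] using h

theorem derivation_aeval_schur {S : Type*} [CommRing S] [Algebra S A] (D : Derivation S A A)
    (u : ℕ+ → A) (n : ℕ+) (c : A) (hn : D (u n) = c) (hne : ∀ k, k ≠ n → D (u k) = 0) (m : ℕ) :
    D (MvPolynomial.aeval u (schur m)) =
      if (n : ℕ) ≤ m then c * MvPolynomial.aeval u (schur (m - n)) else 0 := by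
  have := isAddTorsionFree_of_complex A
  set F := schurSeries u with hF
  set DF : PowerSeries A := PowerSeries.mk fun i => D (MvPolynomial.aeval u (schur i)) with hDF
  have hcD : ∀ i, PowerSeries.coeff i DF = D (MvPolynomial.aeval u (schur i)) :=
    fun i => PowerSeries.coeff_mk _ _
  obtain ⟨j, rfl⟩ : ∃ j : ℕ, n = j.succPNat := ⟨n.natPred, (PNat.succPNat_natPred n).symm⟩
  have hDg : ∀ i, D (PowerSeries.coeff i (schurLogDeriv u)) =
      PowerSeries.coeff i (PowerSeries.X ^ j * PowerSeries.C (c * (j + 1)) : PowerSeries A) := by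
    intro i
    rw [coeff_schurLogDeriv, PowerSeries.coeff_X_pow_mul', PowerSeries.coeff_C, Derivation.leibniz,
      map_add, Derivation.map_natCast, Derivation.map_one_eq_zero, add_zero, smul_zero, zero_add,
      smul_eq_mul]
    by_cases hi : i = j
    · subst hi
      rw [hn, if_pos le_rfl, if_pos (by omega), mul_comm]
    · rw [hne _ fun hc => hi (Nat.succPNat_injective hc), mul_zero]
      split_ifs with h1 h2
      · omega
      · rfl
      · rfl
  have hd : PowerSeries.derivative A DF =
      DF * schurLogDeriv u + F * (PowerSeries.X ^ j * PowerSeries.C (c * (j + 1))) := by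
    ext i
    have h1 := congrArg D (congrArg (PowerSeries.coeff i) (derivative_schurSeries u))
    rw [PowerSeries.coeff_derivative, PowerSeries.coeff_mul, map_sum, Derivation.leibniz,
      map_add, Derivation.map_natCast, Derivation.map_one_eq_zero, add_zero, smul_zero, zero_add,
      smul_eq_mul, coeff_schurSeries] at h1
    rw [PowerSeries.coeff_derivative, hcD, mul_comm, h1, map_add, PowerSeries.coeff_mul,
      PowerSeries.coeff_mul, ← Finset.sum_add_distrib]
    refine Finset.sum_congr rfl fun p _ => ?_
    rw [Derivation.leibniz, hDg, hcD, coeff_schurSeries, smul_eq_mul, smul_eq_mul]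
    ring
  have hG : DF - PowerSeries.X ^ (j + 1) * (PowerSeries.C c * F) = 0 := by
    refine PowerSeries.eq_of_derivative_eq_mul (g := schurLogDeriv u) ?_ ?_ ?_
    · rw [map_sub, hd, Derivation.leibniz, Derivation.leibniz, Derivation.leibniz_pow, hF,
        derivative_schurSeries, PowerSeries.derivative_C, PowerSeries.derivative_X, map_mul,
        map_add, map_natCast, map_one]
      simp only [smul_eq_mul, nsmul_eq_mul, Nat.add_sub_cancel]
      push_cast
      ring
    · rw [map_zero, zero_mul]
    · rw [map_sub, hcD, schur_zero, map_one, Derivation.map_one_eq_zero,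
        PowerSeries.coeff_X_pow_mul', if_neg (by omega), sub_zero, map_zero]
  have hm := congrArg (PowerSeries.coeff m) hG
  rw [map_sub, hcD, PowerSeries.coeff_X_pow_mul', map_zero, sub_eq_zero] at hm
  rw [hm, PowerSeries.coeff_C_mul, coeff_schurSeries]
  rfl

theorem aeval_schur_mem {u : ℕ+ → A} {J : Ideal A} (hu : ∀ n, u n ∈ J) {n : ℕ} (hn : n ≠ 0) :
    MvPolynomial.aeval u (schur n) ∈ J := by
  obtain ⟨n, rfl⟩ := Nat.exists_eq_succ_of_ne_zero hn
  have h := congrArg (MvPolynomial.aeval u) (schur_succ n)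
  simp only [map_mul, map_sum, map_add, map_natCast, map_one, MvPolynomial.aeval_X] at h
  have h1 : MvPolynomial.aeval u (schur (n + 1)) * (n + 1) ∈ J := by
    rw [h]
    exact J.sum_mem fun p _ => J.mul_mem_left _ (J.mul_mem_right _ (hu _))
  have h2 : MvPolynomial.aeval u (schur (n + 1)) =
      algebraMap ℂ A ((n + 1 : ℂ)⁻¹) * (MvPolynomial.aeval u (schur (n + 1)) * (n + 1)) := by
    have h3 : algebraMap ℂ A ((n + 1 : ℂ)⁻¹) * (n + 1) = 1 := by
      have : ((n : A) + 1) = algebraMap ℂ A (n + 1) := by simp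
      rw [this, ← map_mul, inv_mul_cancel₀ (Nat.cast_add_one_ne_zero n), map_one]
    linear_combination (-MvPolynomial.aeval u (schur (n + 1))) * h3
  rw [Nat.succ_eq_add_one, h2]
  exact J.mul_mem_left _ h1

end Schur

/-! ### Constant coefficient differential operators over a ring -/

section ApplyDiff

variable {σ R : Type} [CommRing R]

/-- The iterated partial derivative `∏_i ∂_i^{d_i} f` over a ring `R`. -/
def multiDerivR (d : σ →₀ ℕ) (f : MvPowerSeries σ R) : MvPowerSeries σ R :=
  fun e => ((d.prod fun i k => (e i + k).descFactorial k : ℕ) : R) * MvPowerSeries.coeff (e + d) f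

theorem coeff_multiDerivR (d e : σ →₀ ℕ) (f : MvPowerSeries σ R) :
    MvPowerSeries.coeff e (multiDerivR d f) =
      ((d.prod fun i k => (e i + k).descFactorial k : ℕ) : R) * MvPowerSeries.coeff (e + d) f := rfl

/-- The action `Q(∂) f` of a constant coefficient differential operator over a ring `R`. -/
def applyDiffR (Q : MvPolynomial σ R) (f : MvPowerSeries σ R) : MvPowerSeries σ R :=
  ∑ d ∈ Q.support, MvPolynomial.coeff d Q • multiDerivR d f

theorem multiDerivR_zero (f : MvPowerSeries σ R) : multiDerivR 0 f = f := by
  ext e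
  rw [coeff_multiDerivR, Finsupp.prod_zero_index, Nat.cast_one, one_mul, add_zero]

theorem multiDerivR_add (d : σ →₀ ℕ) (f g : MvPowerSeries σ R) :
    multiDerivR d (f + g) = multiDerivR d f + multiDerivR d g := by
  ext e
  simp only [coeff_multiDerivR, map_add, mul_add]

theorem multiDerivR_smul (d : σ →₀ ℕ) (r : R) (f : MvPowerSeries σ R) :
    multiDerivR d (r • f) = r • multiDerivR d f := by
  ext e
  simp only [coeff_multiDerivR, MvPowerSeries.coeff_smul, mul_left_comm]

theorem multiDerivR_add_single (d : σ →₀ ℕ) (i : σ) (f : MvPowerSeries σ R) :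
    multiDerivR (d + Finsupp.single i 1) f = multiDerivR d (MvPowerSeries.pderiv R i f) := by
  classical
  ext e
  rw [coeff_multiDerivR, coeff_multiDerivR, MvPowerSeries.coeff_pderiv, add_assoc]
  have h : (d + Finsupp.single i 1).prod (fun j k => (e j + k).descFactorial k) =
      (e i + d i + 1) * d.prod fun j k => (e j + k).descFactorial k := by
    rw [Finsupp.prod_of_support_subset (s := insert i d.support) _ _ _ (by simp),
      Finsupp.prod_of_support_subset d (s := insert i d.support) (Finset.subset_insert _ _) _
        (by simp), ← Finset.mul_prod_erase _ _ (Finset.mem_insert_self i _),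
      ← Finset.mul_prod_erase (insert i d.support) (fun j => (e j + d j).descFactorial (d j))
        (Finset.mem_insert_self i _), ← mul_assoc]
    · congr 1
      · simp only [Finsupp.add_apply, Finsupp.single_eq_same, ← add_assoc]
        exact Nat.succ_descFactorial_succ _ _
      · refine Finset.prod_congr rfl fun j hj => ?_
        rw [Finsupp.add_apply, Finsupp.single_eq_of_ne (Finset.ne_of_mem_erase hj), add_zero]
    · intro j hj
      rw [Finsupp.mem_support_iff, Finsupp.add_apply] at hj
      by_cases hji : j = i
      · exact Finset.mem_insert.mpr (Or.inl hji)
      · rw [Finsupp.single_eq_of_ne hji, add_zero] at hj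
        exact Finset.mem_insert.mpr (Or.inr (Finsupp.mem_support_iff.mpr hj))
  rw [h, Finsupp.add_apply]
  push_cast
  ring

theorem applyDiffR_of_subset {Q : MvPolynomial σ R} {s : Finset (σ →₀ ℕ)} (hs : Q.support ⊆ s)
    (f : MvPowerSeries σ R) :
    applyDiffR Q f = ∑ d ∈ s, MvPolynomial.coeff d Q • multiDerivR d f :=
  Finset.sum_subset hs fun d _ hd => by
    rw [MvPolynomial.notMem_support_iff.mp hd, zero_smul]

theorem applyDiffR_add (P Q : MvPolynomial σ R) (f : MvPowerSeries σ R) :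
    applyDiffR (P + Q) f = applyDiffR P f + applyDiffR Q f := by
  classical
  rw [applyDiffR_of_subset (s := P.support ∪ Q.support) MvPolynomial.support_add,
    applyDiffR_of_subset (s := P.support ∪ Q.support) Finset.subset_union_left,
    applyDiffR_of_subset (s := P.support ∪ Q.support) Finset.subset_union_right,
    ← Finset.sum_add_distrib]
  simp only [MvPolynomial.coeff_add, add_smul]

theorem applyDiffR_monomial (d : σ →₀ ℕ) (r : R) (f : MvPowerSeries σ R) :
    applyDiffR (MvPolynomial.monomial d r) f = r • multiDerivR d f := by
  classical
  rw [applyDiffR_of_subset MvPolynomial.support_monomial_subset, Finset.sum_singleton,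
    MvPolynomial.coeff_monomial, if_pos rfl]

/-- `f ↦ Q(∂) f`, as an additive map in `Q`. -/
def applyDiffHom (f : MvPowerSeries σ R) : MvPolynomial σ R →+ MvPowerSeries σ R :=
  AddMonoidHom.mk' (fun Q => applyDiffR Q f) fun P Q => applyDiffR_add P Q f

theorem applyDiffR_sub (P Q : MvPolynomial σ R) (f : MvPowerSeries σ R) :
    applyDiffR (P - Q) f = applyDiffR P f - applyDiffR Q f := map_sub (applyDiffHom f) P Q

theorem applyDiffR_sum {ι : Type*} (s : Finset ι) (P : ι → MvPolynomial σ R)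
    (f : MvPowerSeries σ R) : applyDiffR (∑ i ∈ s, P i) f = ∑ i ∈ s, applyDiffR (P i) f :=
  map_sum (applyDiffHom f) P s

theorem applyDiffR_add_right (Q : MvPolynomial σ R) (f g : MvPowerSeries σ R) :
    applyDiffR Q (f + g) = applyDiffR Q f + applyDiffR Q g := by
  simp only [applyDiffR, multiDerivR_add, smul_add, Finset.sum_add_distrib]

theorem applyDiffR_smul_right (Q : MvPolynomial σ R) (r : R) (f : MvPowerSeries σ R) :
    applyDiffR Q (r • f) = r • applyDiffR Q f := by
  simp only [applyDiffR, multiDerivR_smul, Finset.smul_sum, smul_comm r]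

theorem applyDiffR_C (r : R) (f : MvPowerSeries σ R) :
    applyDiffR (MvPolynomial.C r) f = r • f := by
  rw [← MvPolynomial.monomial_zero', applyDiffR_monomial, multiDerivR_zero]

theorem applyDiffR_mul_X (Q : MvPolynomial σ R) (i : σ) (f : MvPowerSeries σ R) :
    applyDiffR (Q * MvPolynomial.X i) f = applyDiffR Q (MvPowerSeries.pderiv R i f) := by
  induction Q using MvPolynomial.induction_on' with
  | monomial d r =>
    rw [MvPolynomial.X, MvPolynomial.monomial_mul, mul_one, applyDiffR_monomial,
      applyDiffR_monomial, multiDerivR_add_single]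
  | add P Q hP hQ => rw [add_mul, applyDiffR_add, applyDiffR_add, hP, hQ]

theorem applyDiffR_mul_C (Q : MvPolynomial σ R) (r : R) (f : MvPowerSeries σ R) :
    applyDiffR (Q * MvPolynomial.C r) f = r • applyDiffR Q f := by
  induction Q using MvPolynomial.induction_on' with
  | monomial d c =>
    rw [mul_comm, MvPolynomial.C_mul_monomial, applyDiffR_monomial, applyDiffR_monomial, mul_smul]
  | add P Q hP hQ => rw [add_mul, applyDiffR_add, applyDiffR_add, hP, hQ, smul_add]

end ApplyDiff

/-! ### Hirota operators over a ring -/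

section Hirota

variable {σ R : Type} [CommRing R]

theorem hasSubst_X_comp {ι : Type} {u : ι → σ} (hu : Function.Injective u) :
    MvPowerSeries.HasSubst fun i => (MvPowerSeries.X (u i) : MvPowerSeries σ R) := by
  classical
  constructor
  · intro i
    simp
  · intro d
    refine Set.Subsingleton.finite fun i hi j hj => ?_
    simp only [MvPowerSeries.coeff_X, ne_eq, ite_eq_right_iff,
      not_forall] at hi hj
    exact hu (Finsupp.single_left_injective one_ne_zero (hi.1.symm.trans hj.1))

theorem hasSubst_elim_X : MvPowerSeries.HasSubst
    (Sum.elim MvPowerSeries.X MvPowerSeries.X : σ ⊕ σ → MvPowerSeries σ R) := by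
  classical
  have h := (hasSubst_X_comp (R := R) (Function.injective_id (α := σ)))
  constructor
  · rintro (i | i) <;> simp
  · intro d
    refine (((h.coeff_zero d).image Sum.inl).union ((h.coeff_zero d).image Sum.inr)).subset ?_
    rintro (i | i) hi
    · exact Or.inl ⟨i, hi, rfl⟩
    · exact Or.inr ⟨i, hi, rfl⟩

/-- `f(v')` -/
def leftCopy (f : MvPowerSeries σ R) : MvPowerSeries (σ ⊕ σ) R :=
  MvPowerSeries.subst (fun v => (MvPowerSeries.X (Sum.inl v) : MvPowerSeries (σ ⊕ σ) R)) f

/-- `f(v'')` -/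
def rightCopy (f : MvPowerSeries σ R) : MvPowerSeries (σ ⊕ σ) R :=
  MvPowerSeries.subst (fun v => (MvPowerSeries.X (Sum.inr v) : MvPowerSeries (σ ⊕ σ) R)) f

/-- The restriction to `v' = v'' = v`. -/
def diagonal (F : MvPowerSeries (σ ⊕ σ) R) : MvPowerSeries σ R :=
  MvPowerSeries.subst (Sum.elim MvPowerSeries.X MvPowerSeries.X : σ ⊕ σ → MvPowerSeries σ R) F

theorem hasSubst_inl :
    MvPowerSeries.HasSubst fun v : σ => (MvPowerSeries.X (Sum.inl v) : MvPowerSeries (σ ⊕ σ) R) :=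
  hasSubst_X_comp Sum.inl_injective

theorem hasSubst_inr :
    MvPowerSeries.HasSubst fun v : σ => (MvPowerSeries.X (Sum.inr v) : MvPowerSeries (σ ⊕ σ) R) :=
  hasSubst_X_comp Sum.inr_injective

theorem leftCopy_add (f g : MvPowerSeries σ R) : leftCopy (f + g) = leftCopy f + leftCopy g :=
  MvPowerSeries.subst_add hasSubst_inl f g

theorem rightCopy_add (f g : MvPowerSeries σ R) : rightCopy (f + g) = rightCopy f + rightCopy g :=
  MvPowerSeries.subst_add hasSubst_inr f g

theorem leftCopy_smul (r : R) (f : MvPowerSeries σ R) : leftCopy (r • f) = r • leftCopy f :=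
  MvPowerSeries.subst_smul hasSubst_inl r f

theorem rightCopy_smul (r : R) (f : MvPowerSeries σ R) : rightCopy (r • f) = r • rightCopy f :=
  MvPowerSeries.subst_smul hasSubst_inr r f

theorem diagonal_add (F G : MvPowerSeries (σ ⊕ σ) R) :
    diagonal (F + G) = diagonal F + diagonal G := MvPowerSeries.subst_add hasSubst_elim_X F G

theorem diagonal_sub (F G : MvPowerSeries (σ ⊕ σ) R) :
    diagonal (F - G) = diagonal F - diagonal G := MvPowerSeries.subst_sub hasSubst_elim_X F G

theorem diagonal_smul (r : R) (F : MvPowerSeries (σ ⊕ σ) R) :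
    diagonal (r • F) = r • diagonal F := MvPowerSeries.subst_smul hasSubst_elim_X r F

theorem diagonal_leftCopy_mul_rightCopy (f g : MvPowerSeries σ R) :
    diagonal (leftCopy f * rightCopy g) = f * g := by
  rw [diagonal, MvPowerSeries.subst_mul hasSubst_elim_X, leftCopy, rightCopy,
    MvPowerSeries.subst_comp_subst_apply hasSubst_inl hasSubst_elim_X,
    MvPowerSeries.subst_comp_subst_apply hasSubst_inr hasSubst_elim_X]
  simp only [MvPowerSeries.subst_X hasSubst_elim_X, Sum.elim_inl, Sum.elim_inr]
  have h : ∀ f : MvPowerSeries σ R, MvPowerSeries.subst (fun v => MvPowerSeries.X v) f = f :=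
    fun f => congrFun MvPowerSeries.subst_self f
  rw [h, h]

theorem pderiv_inl_leftCopy (v : σ) (f : MvPowerSeries σ R) :
    MvPowerSeries.pderiv R (Sum.inl v) (leftCopy f) = leftCopy (MvPowerSeries.pderiv R v f) := by
  rw [leftCopy, MvPowerSeries.pderiv_subst hasSubst_inl _ {v}, Finset.sum_singleton,
    MvPowerSeries.pderiv_X_self, mul_one, leftCopy]
  intro w hw
  exact MvPowerSeries.pderiv_X_of_ne fun h => hw (by simp [Sum.inl_injective h])

theorem pderiv_inr_rightCopy (v : σ) (f : MvPowerSeries σ R) :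
    MvPowerSeries.pderiv R (Sum.inr v) (rightCopy f) = rightCopy (MvPowerSeries.pderiv R v f) := by
  rw [rightCopy, MvPowerSeries.pderiv_subst hasSubst_inr _ {v}, Finset.sum_singleton,
    MvPowerSeries.pderiv_X_self, mul_one, rightCopy]
  intro w hw
  exact MvPowerSeries.pderiv_X_of_ne fun h => hw (by simp [Sum.inr_injective h])

theorem pderiv_inr_leftCopy (v : σ) (f : MvPowerSeries σ R) :
    MvPowerSeries.pderiv R (Sum.inr v) (leftCopy f) = 0 := by
  rw [leftCopy, MvPowerSeries.pderiv_subst hasSubst_inl _ ∅, Finset.sum_empty]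
  intro w _
  exact MvPowerSeries.pderiv_X_of_ne Sum.inl_ne_inr

theorem pderiv_inl_rightCopy (v : σ) (f : MvPowerSeries σ R) :
    MvPowerSeries.pderiv R (Sum.inl v) (rightCopy f) = 0 := by
  rw [rightCopy, MvPowerSeries.pderiv_subst hasSubst_inr _ ∅, Finset.sum_empty]
  intro w _
  exact MvPowerSeries.pderiv_X_of_ne Sum.inr_ne_inl

theorem pderiv_inl_mul (v : σ) (f g : MvPowerSeries σ R) :
    MvPowerSeries.pderiv R (Sum.inl v) (leftCopy f * rightCopy g) =
      leftCopy (MvPowerSeries.pderiv R v f) * rightCopy g := by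
  rw [Derivation.leibniz, pderiv_inl_rightCopy, pderiv_inl_leftCopy, smul_zero, zero_add,
    smul_eq_mul, mul_comm]

theorem pderiv_inr_mul (v : σ) (f g : MvPowerSeries σ R) :
    MvPowerSeries.pderiv R (Sum.inr v) (leftCopy f * rightCopy g) =
      leftCopy f * rightCopy (MvPowerSeries.pderiv R v g) := by
  rw [Derivation.leibniz, pderiv_inr_rightCopy, pderiv_inr_leftCopy, smul_zero, add_zero,
    smul_eq_mul]

theorem leftCopy_applyDiffR_mul (A : MvPolynomial σ R) (f g : MvPowerSeries σ R) :
    leftCopy (applyDiffR A f) * rightCopy g =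
      applyDiffR (MvPolynomial.rename Sum.inl A) (leftCopy f * rightCopy g) := by
  induction A using MvPolynomial.induction_on generalizing f with
  | C r => rw [MvPolynomial.rename_C, applyDiffR_C, applyDiffR_C, leftCopy_smul, smul_mul_assoc]
  | add P Q hP hQ => rw [map_add, applyDiffR_add, applyDiffR_add, leftCopy_add, add_mul, hP, hQ]
  | mul_X P v hP =>
    rw [map_mul, MvPolynomial.rename_X, applyDiffR_mul_X, applyDiffR_mul_X, hP, pderiv_inl_mul]

theorem leftCopy_mul_applyDiffR (A : MvPolynomial σ R) (f g : MvPowerSeries σ R) :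
    leftCopy f * rightCopy (applyDiffR A g) =
      applyDiffR (MvPolynomial.rename Sum.inr A) (leftCopy f * rightCopy g) := by
  induction A using MvPolynomial.induction_on generalizing g with
  | C r => rw [MvPolynomial.rename_C, applyDiffR_C, applyDiffR_C, rightCopy_smul, mul_smul_comm]
  | add P Q hP hQ => rw [map_add, applyDiffR_add, applyDiffR_add, rightCopy_add, mul_add, hP, hQ]
  | mul_X P v hP =>
    rw [map_mul, MvPolynomial.rename_X, applyDiffR_mul_X, applyDiffR_mul_X, hP, pderiv_inr_mul]

theorem applyDiffR_mul (P Q : MvPolynomial σ R) (f : MvPowerSeries σ R) :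
    applyDiffR (P * Q) f = applyDiffR P (applyDiffR Q f) := by
  induction Q using MvPolynomial.induction_on generalizing f with
  | C r => rw [applyDiffR_mul_C, applyDiffR_C, applyDiffR_smul_right]
  | add Q Q' hQ hQ' => rw [mul_add, applyDiffR_add, applyDiffR_add, applyDiffR_add_right, hQ, hQ']
  | mul_X Q v hQ => rw [← mul_assoc, applyDiffR_mul_X, applyDiffR_mul_X, hQ]

/-- The symbol `Q(∂_{v'} - ∂_{v''})`. -/
def hirotaSymbolHom : MvPolynomial σ R →ₐ[R] MvPolynomial (σ ⊕ σ) R :=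
  MvPolynomial.aeval fun v => MvPolynomial.X (Sum.inl v) - MvPolynomial.X (Sum.inr v)

/-- Hirota's bilinear operator over a ring `R`. -/
def hirotaR (Q : MvPolynomial σ R) (f g : MvPowerSeries σ R) : MvPowerSeries σ R :=
  diagonal (applyDiffR (hirotaSymbolHom Q) (leftCopy f * rightCopy g))

theorem hirotaR_add (P Q : MvPolynomial σ R) (f g : MvPowerSeries σ R) :
    hirotaR (P + Q) f g = hirotaR P f g + hirotaR Q f g := by
  rw [hirotaR, map_add, applyDiffR_add, diagonal_add]
  rfl

/-- `Q ↦ Q(D) f · g` as an additive map. -/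
def hirotaHom (f g : MvPowerSeries σ R) : MvPolynomial σ R →+ MvPowerSeries σ R :=
  AddMonoidHom.mk' (fun Q => hirotaR Q f g) fun P Q => hirotaR_add P Q f g

theorem hirotaR_sub (P Q : MvPolynomial σ R) (f g : MvPowerSeries σ R) :
    hirotaR (P - Q) f g = hirotaR P f g - hirotaR Q f g := map_sub (hirotaHom f g) P Q

theorem hirotaR_sum {ι : Type*} (s : Finset ι) (P : ι → MvPolynomial σ R)
    (f g : MvPowerSeries σ R) : hirotaR (∑ i ∈ s, P i) f g = ∑ i ∈ s, hirotaR (P i) f g :=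
  map_sum (hirotaHom f g) P s

theorem hirotaR_one (f g : MvPowerSeries σ R) : hirotaR 1 f g = f * g := by
  rw [hirotaR, map_one, ← map_one MvPolynomial.C, applyDiffR_C, one_smul,
    diagonal_leftCopy_mul_rightCopy]

theorem hirotaR_mul_C (Q : MvPolynomial σ R) (r : R) (f g : MvPowerSeries σ R) :
    hirotaR (Q * MvPolynomial.C r) f g = r • hirotaR Q f g := by
  rw [hirotaR, map_mul, ← MvPolynomial.algebraMap_eq, AlgHom.commutes, MvPolynomial.algebraMap_eq,
    applyDiffR_mul_C, diagonal_smul]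
  rfl

theorem hirotaR_C (r : R) (f g : MvPowerSeries σ R) :
    hirotaR (MvPolynomial.C r) f g = r • (f * g) := by
  rw [← one_mul (MvPolynomial.C r), hirotaR_mul_C, hirotaR_one]

theorem hirotaR_mul_X (Q : MvPolynomial σ R) (v : σ) (f g : MvPowerSeries σ R) :
    hirotaR (Q * MvPolynomial.X v) f g = hirotaR Q (MvPowerSeries.pderiv R v f) g -
      hirotaR Q f (MvPowerSeries.pderiv R v g) := by
  have h : hirotaSymbolHom (MvPolynomial.X v : MvPolynomial σ R) =
      MvPolynomial.X (Sum.inl v) - MvPolynomial.X (Sum.inr v) := MvPolynomial.aeval_X _ _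
  rw [hirotaR, map_mul, h, mul_sub, applyDiffR_sub, applyDiffR_mul_X, applyDiffR_mul_X,
    pderiv_inl_mul, pderiv_inr_mul, diagonal_sub]
  rfl

theorem hirotaR_add_left (Q : MvPolynomial σ R) (f f' g : MvPowerSeries σ R) :
    hirotaR Q (f + f') g = hirotaR Q f g + hirotaR Q f' g := by
  rw [hirotaR, leftCopy_add, add_mul, applyDiffR_add_right, diagonal_add]
  rfl

theorem hirotaR_add_right (Q : MvPolynomial σ R) (f g g' : MvPowerSeries σ R) :
    hirotaR Q f (g + g') = hirotaR Q f g + hirotaR Q f g' := by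
  rw [hirotaR, rightCopy_add, mul_add, applyDiffR_add_right, diagonal_add]
  rfl

theorem hirotaR_sub_left (Q : MvPolynomial σ R) (f f' g : MvPowerSeries σ R) :
    hirotaR Q (f - f') g = hirotaR Q f g - hirotaR Q f' g := by
  rw [eq_sub_iff_add_eq, ← hirotaR_add_left, sub_add_cancel]

theorem hirotaR_sub_right (Q : MvPolynomial σ R) (f g g' : MvPowerSeries σ R) :
    hirotaR Q f (g - g') = hirotaR Q f g - hirotaR Q f g' := by
  rw [eq_sub_iff_add_eq, ← hirotaR_add_right, sub_add_cancel]

theorem hirotaR_smul_left (Q : MvPolynomial σ R) (r : R) (f g : MvPowerSeries σ R) :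
    hirotaR Q (r • f) g = r • hirotaR Q f g := by
  rw [hirotaR, leftCopy_smul, smul_mul_assoc, applyDiffR_smul_right, diagonal_smul]
  rfl

theorem hirotaR_smul_right (Q : MvPolynomial σ R) (r : R) (f g : MvPowerSeries σ R) :
    hirotaR Q f (r • g) = r • hirotaR Q f g := by
  rw [hirotaR, rightCopy_smul, mul_smul_comm, applyDiffR_smul_right, diagonal_smul]
  rfl

theorem hirotaR_applyDiffR (Q A B : MvPolynomial σ R) (f g : MvPowerSeries σ R) :
    hirotaR Q (applyDiffR A f) (applyDiffR B g) =
      diagonal (applyDiffR (hirotaSymbolHom Q *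
        (MvPolynomial.rename Sum.inl A * MvPolynomial.rename Sum.inr B))
        (leftCopy f * rightCopy g)) := by
  rw [hirotaR, leftCopy_applyDiffR_mul, leftCopy_mul_applyDiffR, applyDiffR_mul, applyDiffR_mul]

theorem applyDiff_eq {σ : Type} (Q : MvPolynomial σ ℂ) (f : MvPowerSeries σ ℂ) :
    applyDiff Q f = applyDiffR Q f := rfl

theorem hirota_eq (Q : MvPolynomial TimeVar ℂ) (f g : Fn) : hirota Q f g = hirotaR Q f g := rfl

end Hirota

end Bogoyavlensky

end

noncomputable section

namespace Bogoyavlensky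

/-! ### Symbols annihilated by the residue -/

/-- The operators `Q` with `Res_λ Q(D) (P e^{-ξ}) · (P^* e^ξ) = 0` for all `P`, `P^*` in the orbits
of the Baker-Akhiezer functions. -/
def residueAnnihilator (W : PsDO) : AddSubgroup (MvPolynomial TimeVar Lau) where
  carrier := {q | ∀ P ∈ waveSet W, ∀ Q ∈ dualWaveSet W,
    residue (hirotaR q (P * fexp (-xi)) (Q * fexp xi)) = 0}
  zero_mem' P _ Q _ := by
    rw [← sub_self (0 : MvPolynomial TimeVar Lau), hirotaR_sub, sub_self]
    exact map_zero (lamCoeff 1)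
  add_mem' {p q} hp hq P hP Q hQ := by
    rw [hirotaR_add, residue_add, hp P hP Q hQ, hq P hP Q hQ, add_zero]
  neg_mem' {p} hp P hP Q hQ := by
    have h := residue_sub (hirotaR 0 (P * fexp (-xi)) (Q * fexp xi))
      (hirotaR p (P * fexp (-xi)) (Q * fexp xi))
    have h0 : hirotaR 0 (P * fexp (-xi)) (Q * fexp xi) = 0 :=
      map_zero (hirotaHom (P * fexp (-xi)) (Q * fexp xi))
    rw [← hirotaR_sub, zero_sub, hp P hP Q hQ, sub_zero, h0] at h
    exact h.trans (map_zero (lamCoeff 1))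

theorem pderiv_x_mul_fexp_neg_xi (n : ℕ+) (P : MvPowerSeries TimeVar Lau) :
    MvPowerSeries.pderiv Lau (TimeVar.x n) P * fexp (-xi) =
      MvPowerSeries.pderiv Lau (TimeVar.x n) (P * fexp (-xi)) + lam n • (P * fexp (-xi)) := by
  rw [Derivation.leibniz, pderiv_fexp constantCoeff_neg_xi, map_neg, pderiv_x_xi,
    MvPowerSeries.smul_eq_C_mul, smul_eq_mul, smul_eq_mul]
  ring

theorem pderiv_x_mul_fexp_xi (n : ℕ+) (P : MvPowerSeries TimeVar Lau) :
    MvPowerSeries.pderiv Lau (TimeVar.x n) P * fexp xi =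
      MvPowerSeries.pderiv Lau (TimeVar.x n) (P * fexp xi) - lam n • (P * fexp xi) := by
  rw [Derivation.leibniz, pderiv_fexp constantCoeff_xi, pderiv_x_xi,
    MvPowerSeries.smul_eq_C_mul, smul_eq_mul, smul_eq_mul]
  ring

theorem deltaY_mul_of_pderiv_eq_zero (ℓ : ℕ) (n : ℕ+) (P : MvPowerSeries TimeVar Lau)
    {E : MvPowerSeries TimeVar Lau} (hE : ∀ k, MvPowerSeries.pderiv Lau (TimeVar.y k) E = 0) :
    deltaY ℓ n P * E = MvPowerSeries.pderiv Lau (TimeVar.y n) (P * E) -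
      lam ((n : ℕ) * ℓ : ℕ) • MvPowerSeries.pderiv Lau (TimeVar.y 0) (P * E) := by
  rw [Derivation.leibniz, Derivation.leibniz, hE, hE, deltaY_apply, MvPowerSeries.smul_eq_C_mul]
  simp only [smul_eq_mul]
  ring

theorem pderiv_y_fexp_xi (k : ℕ) : MvPowerSeries.pderiv Lau (TimeVar.y k) (fexp xi) = 0 := by
  rw [pderiv_fexp constantCoeff_xi, pderiv_y_xi, mul_zero]

theorem pderiv_y_fexp_neg_xi (k : ℕ) : MvPowerSeries.pderiv Lau (TimeVar.y k) (fexp (-xi)) = 0 := by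
  rw [pderiv_fexp constantCoeff_neg_xi, map_neg, pderiv_y_xi, neg_zero, mul_zero]

section Annihilator

variable {ℓ : ℕ} {W : PsDO}

theorem one_mem_residueAnnihilator : 1 ∈ residueAnnihilator W := by
  intro P hP Q hQ
  rw [hirotaR_one, mul_mul_mul_comm, mul_comm (fexp (-xi)), fexp_xi_mul_fexp_neg_xi, mul_one]
  exact hQ P hP

theorem mul_C_C_mem_residueAnnihilator {q : MvPolynomial TimeVar Lau}
    (hq : q ∈ residueAnnihilator W) (c : ℂ) :
    q * MvPolynomial.C (HahnSeries.C c) ∈ residueAnnihilator W := by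
  intro P hP Q hQ
  have h : (HahnSeries.C c : Lau) • hirotaR q (P * fexp (-xi)) (Q * fexp xi) =
      constLam (MvPowerSeries.C c) * hirotaR q (P * fexp (-xi)) (Q * fexp xi) := by
    rw [MvPowerSeries.smul_eq_C_mul, constLam, MvPowerSeries.map_C]
  rw [hirotaR_mul_C, h, residue_eq_lamCoeff, lamCoeff_constLam_mul, ← residue_eq_lamCoeff,
    hq P hP Q hQ, mul_zero]

theorem mul_lam_mem_residueAnnihilator (hW : IsSolution ℓ W) {q : MvPolynomial TimeVar Lau}
    (hq : q ∈ residueAnnihilator W) (n : ℕ) :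
    q * MvPolynomial.C (lam (n * ℓ : ℕ)) ∈ residueAnnihilator W := by
  intro P hP Q hQ
  rw [hirotaR_mul_C, ← hirotaR_smul_left, MvPowerSeries.smul_eq_C_mul, ← mul_assoc]
  exact hq _ (lam_mul_mem_waveSet hW n hP) Q hQ

theorem mul_x_mem_residueAnnihilator (hW : IsSolution ℓ W) {q : MvPolynomial TimeVar Lau}
    (hq : q ∈ residueAnnihilator W) (n : ℕ+) :
    q * (MvPolynomial.X (TimeVar.x n) + 2 * MvPolynomial.C (lam n)) ∈ residueAnnihilator W := by
  intro P hP Q hQ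
  have h1 := hq _ (pderiv_x_mem_waveSet hW n hP) Q hQ
  have h2 := hq P hP _ (pderiv_x_mem_dualWaveSet hW n hQ)
  rw [pderiv_x_mul_fexp_neg_xi, hirotaR_add_left, hirotaR_smul_left] at h1
  rw [pderiv_x_mul_fexp_xi, hirotaR_sub_right, hirotaR_smul_right] at h2
  have h : q * (MvPolynomial.X (TimeVar.x n) + 2 * MvPolynomial.C (lam n)) =
      q * MvPolynomial.X (TimeVar.x n) + q * MvPolynomial.C (lam n) +
        q * MvPolynomial.C (lam n) := by ring
  rw [residue_add] at h1
  rw [residue_sub] at h2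
  rw [h, hirotaR_add, hirotaR_add, hirotaR_mul_X, hirotaR_mul_C, residue_add, residue_add,
    residue_sub]
  linear_combination h1 - h2

theorem mul_y_mem_residueAnnihilator (hW : IsSolution ℓ W) {q : MvPolynomial TimeVar Lau}
    (hq : q ∈ residueAnnihilator W) (n : ℕ+) :
    q * (MvPolynomial.X (TimeVar.y n) - MvPolynomial.C (lam ((n : ℕ) * ℓ : ℕ)) *
      MvPolynomial.X (TimeVar.y 0)) ∈ residueAnnihilator W := by
  intro P hP Q hQ
  have h1 := hq _ (deltaY_mem_waveSet hW n hP) Q hQ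
  have h2 := hq P hP _ (deltaY_mem_dualWaveSet hW n hQ)
  rw [deltaY_mul_of_pderiv_eq_zero ℓ n P pderiv_y_fexp_neg_xi, hirotaR_sub_left,
    hirotaR_smul_left] at h1
  rw [deltaY_mul_of_pderiv_eq_zero ℓ n Q pderiv_y_fexp_xi, hirotaR_sub_right,
    hirotaR_smul_right] at h2
  have h : q * (MvPolynomial.X (TimeVar.y n) - MvPolynomial.C (lam ((n : ℕ) * ℓ : ℕ)) *
      MvPolynomial.X (TimeVar.y 0)) = q * MvPolynomial.X (TimeVar.y n) -
      q * MvPolynomial.X (TimeVar.y 0) * MvPolynomial.C (lam ((n : ℕ) * ℓ : ℕ)) := by ring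
  rw [h, hirotaR_sub, hirotaR_mul_C, hirotaR_mul_X, hirotaR_mul_X, smul_sub]
  rw [residue_sub] at h1 h2 ⊢
  rw [residue_sub, residue_sub]
  linear_combination h1 - h2

end Annihilator

/-! ### The generating function of the Hirota equations -/

/-- `p_m(2a) p_k((κ - D_y) b) e^{⟨a, D_x⟩ + ⟨b, D_y̌⟩}` -/
def hirotaFactor (m k : ℕ) : HirotaSymbol :=
  MvPolynomial.aeval (fun n : ℕ+ => (2 * MvPowerSeries.X (ParVar.a n) : HirotaSymbol)) (schur m) *
  MvPolynomial.aeval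
    (fun n : ℕ+ => ((MvPowerSeries.X ParVar.kappa -
      MvPowerSeries.C (MvPolynomial.X (TimeVar.y 0))) * MvPowerSeries.X (ParVar.b n) :
        HirotaSymbol)) (schur k) *
  fexp (linForm ParVar.a (fun n => MvPolynomial.X (TimeVar.x n)) +
    linForm ParVar.b (fun n => MvPolynomial.X (TimeVar.y n)))

/-- `p_n(-D̃_x)` -/
def schurNegD (n : ℕ) : MvPolynomial TimeVar ℂ :=
  MvPolynomial.aeval
    (fun n : ℕ+ => MvPolynomial.C (-1 / (n : ℂ)) * MvPolynomial.X (TimeVar.x n)) (schur n)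

theorem coeff_hirotaTerm (ℓ j m k : ℕ) (θ : ParVar →₀ ℕ) :
    MvPowerSeries.coeff θ (hirotaTerm ℓ j m k) =
      MvPowerSeries.coeff θ (hirotaFactor m k) * schurNegD (m + k * ℓ + j * ℓ + 1) := by
  have h : hirotaTerm ℓ j m k =
      hirotaFactor m k * MvPowerSeries.C (schurNegD (m + k * ℓ + j * ℓ + 1)) := by
    rw [hirotaTerm, hirotaFactor, schurNegD]
    ring
  rw [h, MvPowerSeries.coeff_mul_C]

theorem constantCoeff_linForm_add :
    MvPowerSeries.constantCoeff (linForm ParVar.a (fun n => MvPolynomial.X (TimeVar.x n)) +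
      linForm ParVar.b (fun n => MvPolynomial.X (TimeVar.y n)) : HirotaSymbol) = 0 := by
  rw [map_add, coeff_linForm_zero, coeff_linForm_zero, add_zero]

theorem parVar_a_injective : Function.Injective ParVar.a := fun _ _ h => ParVar.a.inj h

theorem parVar_b_injective : Function.Injective ParVar.b := fun _ _ h => ParVar.b.inj h

theorem pderiv_a_hirotaFactor (n : ℕ+) (m k : ℕ) :
    MvPowerSeries.pderiv _ (ParVar.a n) (hirotaFactor m k) =
      hirotaFactor m k * MvPowerSeries.C (MvPolynomial.X (TimeVar.x n)) +
        if (n : ℕ) ≤ m then hirotaFactor (m - n) k * MvPowerSeries.C 2 else 0 := by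
  have h2 : (MvPowerSeries.C 2 : HirotaSymbol) = 2 := map_ofNat _ 2
  have hD2 : MvPowerSeries.pderiv (MvPolynomial TimeVar ℂ) (ParVar.a n) (2 : HirotaSymbol) = 0 := by
    rw [← h2, MvPowerSeries.pderiv_C]
  have ha := derivation_aeval_schur (MvPowerSeries.pderiv (MvPolynomial TimeVar ℂ) (ParVar.a n))
    (fun n : ℕ+ => (2 * MvPowerSeries.X (ParVar.a n) : HirotaSymbol)) n 2
    (by rw [Derivation.leibniz, hD2, MvPowerSeries.pderiv_X_self]; simp)
    (fun i hi => by
      rw [Derivation.leibniz, hD2, MvPowerSeries.pderiv_X_of_ne fun h => hi (ParVar.a.inj h)]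
      simp) m
  have hb := derivation_aeval_schur (MvPowerSeries.pderiv (MvPolynomial TimeVar ℂ) (ParVar.a n))
    (fun n : ℕ+ => ((MvPowerSeries.X ParVar.kappa -
      MvPowerSeries.C (MvPolynomial.X (TimeVar.y 0))) * MvPowerSeries.X (ParVar.b n) :
        HirotaSymbol)) n 0
    (by
      rw [Derivation.leibniz, map_sub, MvPowerSeries.pderiv_C,
        MvPowerSeries.pderiv_X_of_ne (by simp), MvPowerSeries.pderiv_X_of_ne (by simp)]; simp)
    (fun i hi => by
      rw [Derivation.leibniz, map_sub, MvPowerSeries.pderiv_C,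
        MvPowerSeries.pderiv_X_of_ne (by simp), MvPowerSeries.pderiv_X_of_ne (by simp)]; simp) k
  rw [zero_mul, ite_self] at hb
  rw [hirotaFactor, Derivation.leibniz, Derivation.leibniz, ha, hb,
    pderiv_fexp constantCoeff_linForm_add, map_add, pderiv_linForm_self parVar_a_injective,
    pderiv_linForm_of_ne _ (by simp), h2]
  simp only [smul_eq_mul]
  split_ifs
  · rw [hirotaFactor]; ring
  · ring

theorem pderiv_b_hirotaFactor (n : ℕ+) (m k : ℕ) :
    MvPowerSeries.pderiv _ (ParVar.b n) (hirotaFactor m k) =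
      hirotaFactor m k * MvPowerSeries.C (MvPolynomial.X (TimeVar.y n)) +
        if (n : ℕ) ≤ k then MvPowerSeries.X ParVar.kappa * hirotaFactor m (k - n) -
          hirotaFactor m (k - n) * MvPowerSeries.C (MvPolynomial.X (TimeVar.y 0)) else 0 := by
  have h2 : (MvPowerSeries.C 2 : HirotaSymbol) = 2 := map_ofNat _ 2
  have hD2 : MvPowerSeries.pderiv (MvPolynomial TimeVar ℂ) (ParVar.b n) (2 : HirotaSymbol) = 0 := by
    rw [← h2, MvPowerSeries.pderiv_C]
  have ha := derivation_aeval_schur (MvPowerSeries.pderiv (MvPolynomial TimeVar ℂ) (ParVar.b n))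
    (fun n : ℕ+ => (2 * MvPowerSeries.X (ParVar.a n) : HirotaSymbol)) n 0
    (by rw [Derivation.leibniz, hD2, MvPowerSeries.pderiv_X_of_ne (by simp)]; simp)
    (fun i hi => by
      rw [Derivation.leibniz, hD2, MvPowerSeries.pderiv_X_of_ne (by simp)]; simp) m
  have hb := derivation_aeval_schur (MvPowerSeries.pderiv (MvPolynomial TimeVar ℂ) (ParVar.b n))
    (fun n : ℕ+ => ((MvPowerSeries.X ParVar.kappa -
      MvPowerSeries.C (MvPolynomial.X (TimeVar.y 0))) * MvPowerSeries.X (ParVar.b n) :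
        HirotaSymbol)) n (MvPowerSeries.X ParVar.kappa -
      MvPowerSeries.C (MvPolynomial.X (TimeVar.y 0)))
    (by
      rw [Derivation.leibniz, map_sub, MvPowerSeries.pderiv_C,
        MvPowerSeries.pderiv_X_of_ne (j := ParVar.kappa) (by simp), MvPowerSeries.pderiv_X_self]; simp)
    (fun i hi => by
      rw [Derivation.leibniz, map_sub, MvPowerSeries.pderiv_C,
        MvPowerSeries.pderiv_X_of_ne (j := ParVar.kappa) (by simp),
        MvPowerSeries.pderiv_X_of_ne fun h => hi (ParVar.b.inj h)]; simp) k
  rw [zero_mul, ite_self] at ha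
  rw [hirotaFactor, Derivation.leibniz, Derivation.leibniz, ha, hb,
    pderiv_fexp constantCoeff_linForm_add, map_add, pderiv_linForm_self parVar_b_injective,
    pderiv_linForm_of_ne _ (by simp)]
  simp only [smul_eq_mul]
  split_ifs
  · rw [hirotaFactor]; ring
  · ring

/-- The series in `a`, `b`, `κ` that vanish for `a = b = 0`. -/
def vanishingAtZero : Ideal HirotaSymbol where
  carrier := {f | ∀ r, MvPowerSeries.coeff (Finsupp.single ParVar.kappa r) f = 0}
  zero_mem' _ := map_zero _
  add_mem' {f g} hf hg r := by rw [map_add, hf, hg, add_zero]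
  smul_mem' f g hg r := by
    classical
    rw [smul_eq_mul, MvPowerSeries.coeff_mul, Finsupp.antidiagonal_single, Finset.sum_map]
    refine Finset.sum_eq_zero fun p _ => ?_
    exact mul_eq_zero_of_right _ (hg p.2)

theorem coeff_kappa_hirotaFactor (m k r : ℕ) :
    MvPowerSeries.coeff (Finsupp.single ParVar.kappa r) (hirotaFactor m k) =
      if m = 0 ∧ k = 0 ∧ r = 0 then 1 else 0 := by
  classical
  have hX : ∀ v : ParVar, v ≠ ParVar.kappa → (MvPowerSeries.X v : HirotaSymbol) ∈ vanishingAtZero := by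
    intro v hv r
    rw [MvPowerSeries.coeff_X, if_neg]
    intro h
    have := DFunLike.congr_fun h v
    rw [Finsupp.single_eq_same, Finsupp.single_eq_of_ne hv] at this
    omega
  by_cases hm : m = 0
  swap
  · rw [if_neg (by tauto)]
    exact vanishingAtZero.mul_mem_right _ (vanishingAtZero.mul_mem_right _
      (aeval_schur_mem (fun n => vanishingAtZero.mul_mem_left _ (hX _ (by simp))) hm)) r
  by_cases hk : k = 0
  swap
  · rw [if_neg (by tauto)]
    exact vanishingAtZero.mul_mem_right _ (vanishingAtZero.mul_mem_left _
      (aeval_schur_mem (fun n => vanishingAtZero.mul_mem_left _ (hX _ (by simp))) hk)) r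
  subst hm hk
  rw [hirotaFactor, aeval_schur_zero, aeval_schur_zero, one_mul, one_mul]
  rcases r with _ | r
  · rw [Finsupp.single_zero, MvPowerSeries.coeff_zero_eq_constantCoeff_apply,
      constantCoeff_fexp constantCoeff_linForm_add, if_pos (by tauto)]
  · rw [if_neg (by omega), Finsupp.single_add]
    refine coeff_add_single_of_pderiv ?_
    rw [pderiv_fexp constantCoeff_linForm_add, map_add, pderiv_linForm_of_ne _ (by simp),
      pderiv_linForm_of_ne _ (by simp), add_zero, mul_zero, map_zero]

end Bogoyavlensky

end

noncomputable section

namespace Bogoyavlensky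

/-! ### The Hirota equations -/

/-- The evaluation `∑_{m,k} q_{m,k} λ^m μ^k ↦ ∑_{m,k} q_{m,k} λ^{m + kℓ}`. -/
def lamEval (ℓ : ℕ) :
    Polynomial (Polynomial (MvPolynomial TimeVar ℂ)) →+* MvPolynomial TimeVar Lau :=
  Polynomial.eval₂RingHom
    (Polynomial.eval₂RingHom (MvPolynomial.map HahnSeries.C) (MvPolynomial.C (lam 1)))
    (MvPolynomial.C (lam ℓ))

theorem lam_pow (m : ℤ) (n : ℕ) : lam m ^ n = lam (n * m) := by
  induction n with
  | zero => rw [pow_zero, Nat.cast_zero, zero_mul, lam_zero]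
  | succ n ih => rw [pow_succ, ih, lam_mul_lam, Nat.cast_succ, add_mul, one_mul]

theorem lamEval_C_C (ℓ : ℕ) (q : MvPolynomial TimeVar ℂ) :
    lamEval ℓ (Polynomial.C (Polynomial.C q)) = MvPolynomial.map HahnSeries.C q := by
  simp [lamEval]

theorem lamEval_C_X_pow (ℓ n : ℕ) :
    lamEval ℓ (Polynomial.C (Polynomial.X ^ n)) = MvPolynomial.C (lam n) := by
  simp [lamEval, ← map_pow, lam_pow]

theorem lamEval_X_pow (ℓ n : ℕ) :
    lamEval ℓ (Polynomial.X ^ n) = MvPolynomial.C (lam (n * ℓ : ℕ)) := by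
  simp [lamEval, ← map_pow, lam_pow]

theorem lamEval_monomial (ℓ m k : ℕ) (q : MvPolynomial TimeVar ℂ) :
    lamEval ℓ (Polynomial.monomial k (Polynomial.monomial m q)) =
      MvPolynomial.map HahnSeries.C q * MvPolynomial.C (lam (m + k * ℓ : ℕ)) := by
  rw [← Polynomial.C_mul_X_pow_eq_monomial, ← Polynomial.C_mul_X_pow_eq_monomial, map_mul, map_mul,
    map_mul, lamEval_C_C, lamEval_C_X_pow, lamEval_X_pow, mul_assoc, ← map_mul, lam_mul_lam,
    ← Nat.cast_add]

theorem coeff_add_single_eq_smul {σ R : Type} [CommRing R] [Algebra ℂ R]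
    (F : MvPowerSeries σ R) (d : σ →₀ ℕ) (w : σ) :
    MvPowerSeries.coeff (d + Finsupp.single w 1) F =
      MvPowerSeries.coeff d (MvPowerSeries.pderiv R w F) * algebraMap ℂ R ((d w + 1 : ℂ)⁻¹) := by
  have h : ((d w : R) + 1) * algebraMap ℂ R ((d w + 1 : ℂ)⁻¹) = 1 := by
    have h' : ((d w : R) + 1) = algebraMap ℂ R (d w + 1) := by simp
    rw [h', ← map_mul, mul_inv_cancel₀ (Nat.cast_add_one_ne_zero _), map_one]
  rw [MvPowerSeries.coeff_pderiv, mul_assoc, h, mul_one]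

/-- For fixed exponents of `a`, `b`, `κ`, the generating function of the coefficients of
`p_m(2a) p_k((κ - D_y) b) e^{⟨a, D_x⟩ + ⟨b, D_y̌⟩}` is a polynomial, and it is annihilated by the
residue. -/
theorem exists_polynomial_hirotaFactor {ℓ : ℕ} {W : PsDO} (hW : IsSolution ℓ W)
    (θ : ParVar →₀ ℕ) : ∃ g : Polynomial (Polynomial (MvPolynomial TimeVar ℂ)),
      (∀ m k, (g.coeff k).coeff m = MvPowerSeries.coeff θ (hirotaFactor m k)) ∧
      lamEval ℓ g ∈ residueAnnihilator W := by
  suffices H : ∀ d θ : ParVar →₀ ℕ, (∀ n, θ (ParVar.a n) = d (ParVar.a n)) →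
      (∀ n, θ (ParVar.b n) = d (ParVar.b n)) →
      ∃ g : Polynomial (Polynomial (MvPolynomial TimeVar ℂ)),
        (∀ m k, (g.coeff k).coeff m = MvPowerSeries.coeff θ (hirotaFactor m k)) ∧
        lamEval ℓ g ∈ residueAnnihilator W from H θ θ (fun _ => rfl) fun _ => rfl
  clear θ
  intro d
  induction d using Finsupp.induction_add_single with
  | h0 =>
    intro θ ha hb
    have hθ : θ = Finsupp.single ParVar.kappa (θ ParVar.kappa) := by
      ext v
      rcases v with n | n | _
      · rw [ha, Finsupp.single_eq_of_ne (by simp)]; rfl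
      · rw [hb, Finsupp.single_eq_of_ne (by simp)]; rfl
      · rw [Finsupp.single_eq_same]
    refine ⟨if θ ParVar.kappa = 0 then 1 else 0, fun m k => ?_, ?_⟩
    · rw [hθ, coeff_kappa_hirotaFactor, Finsupp.single_eq_same]
      by_cases h0 : θ ParVar.kappa = 0
      · by_cases hk : k = 0
        · subst hk
          simp [h0, Polynomial.coeff_one]
        · simp [h0, hk, Polynomial.coeff_one]
      · simp [h0]
    · split_ifs
      · rw [map_one]; exact one_mem_residueAnnihilator
      · rw [map_zero]; exact zero_mem _
  | h d w ih =>
    intro θ ha hb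
    rcases w with n | n | _
    · obtain ⟨θ, rfl⟩ : ∃ θ', θ = θ' + Finsupp.single (ParVar.a n) 1 :=
        ⟨θ - Finsupp.single (ParVar.a n) 1, (tsub_add_cancel_of_le (by
          rw [Finsupp.single_le_iff, ha]; simp)).symm⟩
      obtain ⟨g, hg, hgW⟩ := ih θ (fun i => by simpa using ha i) (fun i => by simpa using hb i)
      refine ⟨g * (Polynomial.C (Polynomial.C (MvPolynomial.X (TimeVar.x n))) +
        Polynomial.C (Polynomial.X ^ (n : ℕ)) * Polynomial.C (Polynomial.C 2)) *
        Polynomial.C (Polynomial.C (MvPolynomial.C ((θ (ParVar.a n) + 1 : ℂ)⁻¹))), fun m k => ?_, ?_⟩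
      · rw [coeff_add_single_eq_smul, pderiv_a_hirotaFactor, map_add, MvPowerSeries.coeff_mul_C]
        simp only [Polynomial.coeff_mul_C, mul_add, Polynomial.coeff_add, ← mul_assoc, hg,
          Polynomial.coeff_mul_X_pow', apply_ite (MvPowerSeries.coeff θ), map_zero,
          MvPowerSeries.coeff_mul_C, MvPolynomial.algebraMap_eq]
        split_ifs <;> simp
      · rw [map_mul, map_mul, map_add, map_mul, lamEval_C_C, lamEval_C_C, lamEval_C_C,
          lamEval_C_X_pow, MvPolynomial.map_C, MvPolynomial.map_X, map_ofNat, mul_comm _ 2]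
        exact mul_C_C_mem_residueAnnihilator (mul_x_mem_residueAnnihilator hW hgW n) _
    · obtain ⟨θ, rfl⟩ : ∃ θ', θ = θ' + Finsupp.single (ParVar.b n) 1 :=
        ⟨θ - Finsupp.single (ParVar.b n) 1, (tsub_add_cancel_of_le (by
          rw [Finsupp.single_le_iff, hb]; simp)).symm⟩
      obtain ⟨g, hg, hgW⟩ := ih θ (fun i => by simpa using ha i) (fun i => by simpa using hb i)
      obtain ⟨g', hg', hgW'⟩ : ∃ g' : Polynomial (Polynomial (MvPolynomial TimeVar ℂ)),
          (∀ m k, (g'.coeff k).coeff m =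
            MvPowerSeries.coeff θ (MvPowerSeries.X ParVar.kappa * hirotaFactor m k)) ∧
          lamEval ℓ g' ∈ residueAnnihilator W := by
        by_cases hκ : θ ParVar.kappa = 0
        · refine ⟨0, fun m k => ?_, by rw [map_zero]; exact zero_mem _⟩
          rw [MvPowerSeries.X, MvPowerSeries.coeff_monomial_mul, if_neg]
          · simp
          · rw [Finsupp.single_le_iff, hκ]; simp
        · have hle : Finsupp.single ParVar.kappa 1 ≤ θ := by
            rw [Finsupp.single_le_iff]; omega
          obtain ⟨g', hg', hgW'⟩ := ih (θ - Finsupp.single ParVar.kappa 1)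
            (fun i => by simpa using ha i) (fun i => by simpa using hb i)
          refine ⟨g', fun m k => ?_, hgW'⟩
          rw [hg', MvPowerSeries.X, MvPowerSeries.coeff_monomial_mul, if_pos hle, one_mul]
      refine ⟨(g * Polynomial.C (Polynomial.C (MvPolynomial.X (TimeVar.y n))) +
        g * Polynomial.C (Polynomial.C (-MvPolynomial.X (TimeVar.y 0))) * Polynomial.X ^ (n : ℕ) +
        g' * Polynomial.X ^ (n : ℕ)) *
        Polynomial.C (Polynomial.C (MvPolynomial.C ((θ (ParVar.b n) + 1 : ℂ)⁻¹))), fun m k => ?_, ?_⟩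
      · rw [coeff_add_single_eq_smul, pderiv_b_hirotaFactor, map_add, MvPowerSeries.coeff_mul_C]
        simp only [Polynomial.coeff_mul_C, Polynomial.coeff_add, hg, Polynomial.coeff_mul_X_pow',
          apply_ite (MvPowerSeries.coeff θ), map_zero, MvPolynomial.algebraMap_eq]
        split_ifs
        · rw [map_sub, Polynomial.coeff_mul_C, hg, hg', MvPowerSeries.coeff_mul_C]
          ring
        · simp
      · have h : lamEval ℓ g * MvPolynomial.X (TimeVar.y n) +
            lamEval ℓ g * -MvPolynomial.X (TimeVar.y 0) * MvPolynomial.C (lam ((n : ℕ) * ℓ : ℕ)) =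
            lamEval ℓ g * (MvPolynomial.X (TimeVar.y n) -
              MvPolynomial.C (lam ((n : ℕ) * ℓ : ℕ)) * MvPolynomial.X (TimeVar.y 0)) := by ring
        rw [map_mul, map_add, map_add, map_mul, map_mul, map_mul, map_mul, lamEval_C_C, lamEval_C_C,
          lamEval_C_C, lamEval_X_pow, MvPolynomial.map_C, map_neg, MvPolynomial.map_X,
          MvPolynomial.map_X, h]
        exact mul_C_C_mem_residueAnnihilator (add_mem (mul_y_mem_residueAnnihilator hW hgW n)
          (mul_lam_mem_residueAnnihilator hW hgW' n)) _
    · exact ih θ (fun i => by simpa using ha i) (fun i => by simpa using hb i)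

theorem lamCoeff_hirotaR (q : MvPolynomial TimeVar ℂ) {F G : MvPowerSeries TimeVar Lau}
    (hF : ∀ k < 0, lamCoeff k F = 0) (hG : ∀ k < 0, lamCoeff k G = 0) (n : ℕ) :
    lamCoeff n (hirotaR (MvPolynomial.map HahnSeries.C q) F G) =
      ∑ p ∈ Finset.HasAntidiagonal.antidiagonal n,
        hirotaR q (lamCoeff p.1 F) (lamCoeff p.2 G) := by
  induction q using MvPolynomial.induction_on generalizing F G with
  | C r =>
    have h : (HahnSeries.C r : Lau) • (F * G) = constLam (MvPowerSeries.C r) * (F * G) := by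
      rw [MvPowerSeries.smul_eq_C_mul, constLam, MvPowerSeries.map_C]
    rw [MvPolynomial.map_C, hirotaR_C, h, lamCoeff_constLam_mul, lamCoeff_mul_of_bounded hF hG,
      Finset.mul_sum]
    symm
    refine Finset.sum_of_injOn (fun p => (p.1 : ℤ)) ?_ ?_ ?_ ?_
    · rintro ⟨a, b⟩ h1 ⟨a', b'⟩ h2 h3
      simp only [Finset.mem_coe, Finset.HasAntidiagonal.mem_antidiagonal, Nat.cast_inj] at h1 h2 h3
      simp only [Prod.mk.injEq]
      omega
    · rintro ⟨a, b⟩ h1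
      simp only [Finset.mem_coe, Finset.HasAntidiagonal.mem_antidiagonal] at h1
      simp only [Finset.mem_coe, Finset.mem_Icc]
      omega
    · intro i hi h1
      simp only [Finset.mem_Icc] at hi
      refine absurd ⟨(i.toNat, n - i.toNat), ?_, ?_⟩ h1
      · simp only [Finset.mem_coe, Finset.HasAntidiagonal.mem_antidiagonal]
        omega
      · dsimp only
        omega
    · rintro ⟨a, b⟩ h1
      have h1 := Finset.HasAntidiagonal.mem_antidiagonal.mp h1
      dsimp only at h1 ⊢
      rw [hirotaR_C, MvPowerSeries.smul_eq_C_mul, show (n : ℤ) - a = b by omega]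
  | add p q hp hq =>
    simp only [map_add, hirotaR_add, hp hF hG, hq hF hG, Finset.sum_add_distrib]
  | mul_X q v hq =>
    have hF' : ∀ k < 0, lamCoeff k (MvPowerSeries.pderiv Lau v F) = 0 := fun k hk => by
      rw [lamCoeff_pderiv, hF k hk, map_zero]
    have hG' : ∀ k < 0, lamCoeff k (MvPowerSeries.pderiv Lau v G) = 0 := fun k hk => by
      rw [lamCoeff_pderiv, hG k hk, map_zero]
    rw [map_mul, MvPolynomial.map_X, hirotaR_mul_X, map_sub, hq hF' hG, hq hF hG',
      ← Finset.sum_sub_distrib]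
    simp only [hirotaR_mul_X, lamCoeff_pderiv]

theorem lamCoeff_miwaShift_of_neg (s : ℂ) (τ : Fn) (k : ℤ) (hk : k < 0) :
    lamCoeff k (miwaShift s τ) = 0 := by
  ext d
  exact if_neg (not_le.mpr hk)

theorem lamCoeff_miwaShift (s : ℂ) (τ : Fn) (k : ℕ) :
    lamCoeff k (miwaShift s τ) = applyDiffR (MvPolynomial.aeval
      (fun n : ℕ+ => MvPolynomial.C (s / (n : ℂ)) * MvPolynomial.X (TimeVar.x n)) (schur k)) τ := by
  ext d
  rw [← applyDiff_eq]
  exact (if_pos (c := (0 : ℤ) ≤ k) (e := (0 : ℂ)) (Int.natCast_nonneg k)).trans (by rw [Int.toNat_natCast]; rfl)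

theorem diagonal_sum {σ R ι : Type} [CommRing R] (s : Finset ι)
    (F : ι → MvPowerSeries (σ ⊕ σ) R) : diagonal (∑ i ∈ s, F i) = ∑ i ∈ s, diagonal (F i) :=
  map_sum (AddMonoidHom.mk' (M := MvPowerSeries (σ ⊕ σ) R) diagonal diagonal_add) F s

/-- The coefficients of `Q(D) τ(x - ε(λ)) · τ(x + ε(λ))` with respect to `λ`. -/
theorem lamCoeff_hirotaR_miwaShift (q : MvPolynomial TimeVar ℂ) (τ : Fn) (n : ℕ) :
    lamCoeff n (hirotaR (MvPolynomial.map HahnSeries.C q) (miwaShift (-1) τ) (miwaShift 1 τ)) =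
      hirotaR (q * schurNegD n) τ τ := by
  have h : hirotaSymbolHom (schurNegD n) = ∑ p ∈ Finset.HasAntidiagonal.antidiagonal n,
      MvPolynomial.rename Sum.inl (MvPolynomial.aeval (fun n : ℕ+ =>
        MvPolynomial.C (-1 / (n : ℂ)) * MvPolynomial.X (TimeVar.x n)) (schur p.1)) *
      MvPolynomial.rename Sum.inr (MvPolynomial.aeval (fun n : ℕ+ =>
        MvPolynomial.C (1 / (n : ℂ)) * MvPolynomial.X (TimeVar.x n)) (schur p.2)) := by
    rw [schurNegD, MvPolynomial.comp_aeval_apply]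
    simp only [MvPolynomial.comp_aeval_apply]
    rw [← aeval_add_schur]
    congr 2
    funext i
    rw [map_mul, map_mul, map_mul, hirotaSymbolHom, MvPolynomial.aeval_X, MvPolynomial.aeval_C,
      MvPolynomial.rename_X, MvPolynomial.rename_X, MvPolynomial.rename_C, MvPolynomial.rename_C,
      MvPolynomial.algebraMap_eq, neg_div, map_neg]
    ring
  rw [lamCoeff_hirotaR q (lamCoeff_miwaShift_of_neg _ τ) (lamCoeff_miwaShift_of_neg _ τ)]
  simp only [lamCoeff_miwaShift, hirotaR_applyDiffR]
  rw [hirotaR, map_mul, h, Finset.mul_sum, applyDiffR_sum]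
  exact (diagonal_sum _ _).symm

theorem residue_lam_smul {σ : Type} (n : ℕ) (F : MvPowerSeries σ Lau) :
    residue (lam n • F) = lamCoeff (n + 1 : ℕ) F := by
  rw [residue_eq_lamCoeff, MvPowerSeries.smul_eq_C_mul, lamCoeff_lam_mul, add_comm, Nat.cast_succ]

/-- The `τ`-functions of the hierarchy satisfy the Hirota equations. -/
theorem hirotaEquations_of_isTau {ℓ : ℕ} {W : PsDO} (hW : IsSolution ℓ W) {τ : Fn}
    (hτ : IsTau W τ) : HirotaEquations ℓ τ := by
  classical
  have hT : miwaShift (-1) τ = constLam τ * bakerAkhiezer W * fexp (-xi) := by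
    rw [hτ.wave, mul_assoc, fexp_xi_mul_fexp_neg_xi, mul_one]
  have hU : miwaShift 1 τ = constLam τ * dualBakerAkhiezer W * fexp xi := by
    rw [hτ.dual_wave, mul_assoc, mul_comm (fexp (-xi)), fexp_xi_mul_fexp_neg_xi, mul_one]
  intro j θ
  obtain ⟨g, hg, hgW⟩ := exists_polynomial_hirotaFactor hW θ
  have hzero := mul_lam_mem_residueAnnihilator hW hgW j _
    (constLam_mul_mem_waveSet τ (bakerAkhiezer_mem_waveSet W)) _
    (constLam_mul_mem_dualWaveSet τ (dualBakerAkhiezer_mem_dualWaveSet hW.wilsonSato))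
  rw [← hT, ← hU] at hzero
  filter_upwards [eventually_ge_atTop ((Finset.range
    (g.support.sup (fun k => (g.coeff k).natDegree) + 1)) ×ˢ g.support)] with S hS
  have hgS : g = ∑ p ∈ S, Polynomial.monomial p.2 (Polynomial.monomial p.1
      (MvPowerSeries.coeff θ (hirotaFactor p.1 p.2))) := by
    ext1 k
    ext1 m
    have h1 : ∀ p : ℕ × ℕ, ((Polynomial.monomial p.2 (Polynomial.monomial p.1
        (MvPowerSeries.coeff θ (hirotaFactor p.1 p.2)))).coeff k).coeff m =
        if (m, k) = p then (g.coeff k).coeff m else 0 := by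
      rintro ⟨m', k'⟩
      rw [Polynomial.coeff_monomial]
      by_cases hk : k' = k
      · subst hk
        rw [if_pos rfl, Polynomial.coeff_monomial]
        by_cases hm : m' = m
        · subst hm
          rw [if_pos rfl, if_pos rfl, hg]
        · rw [if_neg hm, if_neg (by simpa using Ne.symm hm)]
      · rw [if_neg hk, Polynomial.coeff_zero, if_neg (by simp; tauto)]
    simp only [Polynomial.finsetSum_coeff, h1, Finset.sum_ite_eq]
    split_ifs with hmk
    · rfl
    · by_contra hne
      refine hmk (hS (Finset.mem_product.mpr ⟨?_, ?_⟩))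
      · have hk : k ∈ g.support := by
          rw [Polynomial.mem_support_iff]
          intro hc
          exact hne (by rw [hc, Polynomial.coeff_zero])
        have h2 := Finset.le_sup (f := fun k => (g.coeff k).natDegree) hk
        exact Finset.mem_range.mpr (Nat.lt_succ_of_le
          ((Polynomial.le_natDegree_of_ne_zero hne).trans h2))
      · rw [Polynomial.mem_support_iff]
        intro hc
        exact hne (by rw [hc, Polynomial.coeff_zero])
  rw [hgS, map_sum, Finset.sum_mul, hirotaR_sum, residue_eq_lamCoeff, map_sum] at hzero
  rw [← hzero]
  refine Finset.sum_congr rfl fun p _ => ?_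
  rw [hirota_eq, coeff_hirotaTerm, ← lamCoeff_hirotaR_miwaShift, ← residue_lam_smul, lamEval_monomial,
    mul_assoc, ← map_mul, lam_mul_lam, hirotaR_mul_C, ← residue_eq_lamCoeff, Nat.cast_add]

end Bogoyavlensky

end

theorem mainTheorem2 (ℓ : ℕ) (hℓ : 2 ≤ ℓ) (W : Bogoyavlensky.PsDO)
    (hW : Bogoyavlensky.IsSolution ℓ W) :
    Bogoyavlensky.residue
        (MvPowerSeries.subst
            (Bogoyavlensky.shiftArgs ℓ Bogoyavlensky.BilVar.x' Bogoyavlensky.BilVar.b)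
            (Bogoyavlensky.bakerAkhiezer W) *
          MvPowerSeries.subst
            (Bogoyavlensky.shiftArgs ℓ Bogoyavlensky.BilVar.x Bogoyavlensky.BilVar.c)
            (Bogoyavlensky.dualBakerAkhiezer W)) = 0 ∧
      ∀ τ : Bogoyavlensky.Fn, Bogoyavlensky.IsTau W τ → Bogoyavlensky.HirotaEquations ℓ τ := by
  refine ⟨Bogoyavlensky.residue_subst_mul_subst hW (Bogoyavlensky.bakerAkhiezer_mem_waveSet W)
    (Bogoyavlensky.dualBakerAkhiezer_mem_dualWaveSet hW.wilsonSato),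
    fun _ hτ => Bogoyavlensky.hirotaEquations_of_isTau hW hτ⟩
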